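/- Let $V$ be a $\mathbb{Q}$-vector space of finite dimension $n\ge 1$ with basis $w_1,\dots,w_n$, let $L\subset V$ be a lattice (a finitely generated subgroup spanning $V$), and let $p$ be a prime. For a prime $\ell$ put $V_\ell=V\otimes\mathbb{Q}_\ell$, $L_\ell=L\otimes\mathbb{Z}_\ell$, let $\mathcal{S}(V_\ell)$ be the group of locally constant, compactly supported functions $V_\ell\to\mathbb{Z}$, and write $[X]$ for the characteristic function of a set $X$. *Test functions.* A test function away from $p$ is an element $f'$ of $\bigotimes'_{\ell\ne p}\mathcal{S}(V_\ell)$ (restricted with respect to the $[L_\ell]$), regarded as a function on $V$. Put $(f'\otimes[L_p])(v)=f'(v)[L_p](v)$ for $v\in V$, and let $\Gamma\subset\mathrm{GL}(V)$ be the group of all $\gamma$ with $(f'\otimes[L_p])(\gamma v)=(f'\otimes[L_p])(v)$ for all $v\in V$. For a test function $g$ on $\mathbb{Q}$ away from $p$ let $h^{(p)}(g)=\frac1M\sum_{x\in\mathbb{Q}/M\mathbb{Z}}g(x)[\mathbb{Z}_p](x)$, where $M\ge1$ is any integer such that $g\cdot[\mathbb{Z}_p]$ is $M\mathbb{Z}$-periodic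 on $\mathbb{Q}$. For $0\ne w\in V$, $f'$ satisfies the Vanishing Hypothesis for $w$ if for every $v\in V$ the function $x\mapsto f'(v+xw)$ on $\mathbb{Q}$ has $h^{(p)}=0$. *Pseudo-measures.* Let $\mathcal{M}(L_p)$ be the ring, under convolution, of $p$-adic measures on $L_p$, i.e. of continuous $\mathbb{Q}_p$-linear functionals on $C(L_p,\mathbb{Q}_p)$. Let $\delta_v$ be the Dirac measure at $v$, and let $\widetilde{\mathcal{M}}(L_p)=S^{-1}\mathcal{M}(L_p)$, where $S$ is the multiplicative set generated by the $\delta_0-\delta_v$, $0\ne v\in L_p$. *Cone functions.* For linearly independent $u_1,\dots,u_r\in V$ let $C^o(u_1,\dots,u_r)$ be the set of their positive linear combinations. Let $\mathcal{K}_V$ be the group of functions $V\to\mathbb{Z}$ that agree on $V\setminus\{0\}$ with a finite $\mathbb{Z}$-linear combination of characteristic functions of such cones. There is a homomorphism $\mathcal{K}_V\to\widetilde{\mathcal{M}}(L_p)$, $\kappa\mapsto\mu_{\kappa,f'}$, such that $\mu_{\kappa,f'}$ is represented by the formal sum $\sum_{v\in V}(f'\otimes[L_p])(v)\,\kappa(v)\,\delta_v$.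 This means that for suitable nonzero $u_1,\dots,u_m\in V\cap L_p$ the product of the formal sum with $\prod_j(\delta_0-\delta_{u_j})$ is a finite sum of Dirac measures and equals $\prod_j(\delta_0-\delta_{u_j})\cdot\mu_{\kappa,f'}$. *Hill's cocycle.* Let $\mathbb{F}=\mathbb{Q}((\varepsilon_1))\cdots((\varepsilon_n))$, ordered so that every positive power of $\varepsilon_1$ is smaller than every positive rational number and every positive power of $\varepsilon_j$ is smaller than every positive power of $\varepsilon_{j-1}$; let $b_i=\sum_{k=1}^n\varepsilon_i^{k-1}w_k\in V\otimes\mathbb{F}$. For $\alpha_1,\dots,\alpha_n\in\mathrm{GL}(V)$ the function $$\sigma_{\mathrm{Hill}}(\alpha_1,\dots,\alpha_n)=\operatorname{sign}\det(\alpha_1b_1,\dots,\alpha_nb_n)\cdot[C^o(\alpha_1b_1,\dots,\alpha_nb_n)]\big|_V$$ belongs to $\mathcal{K}_V$, where now $C^o$ is the set of linear combinations with positive coefficients in $\mathbb{F}$. The $p$-adic Shintani cocycle $\Phi_{f'}$ is the composition $\Gamma^n\xrightarrow{\sigma_{\mathrm{Hill}}}\mathcal{K}_V\to\widetilde{\mathcal{M}}(L_p)\to\widetilde{\mathcal{M}}(L_p)/\mathbb{Z}\delta_0$.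 **Theorem.** Suppose that $f'$ satisfies the Vanishing Hypothesis for $w_1$. Then for every $(\alpha_1,\dots,\alpha_n)\in\Gamma^n$ that is non-degenerate, i.e. such that $\alpha_1w_1,\dots,\alpha_nw_1$ are linearly independent, $\Phi_{f'}(\alpha_1,\dots,\alpha_n)$ is a $p$-adic measure on $L_p$: it lies in the image of $\mathcal{M}(L_p)$ in $\widetilde{\mathcal{M}}(L_p)/\mathbb{Z}\delta_0$. -/

import Mathlib

open scoped TensorProduct

set_option linter.unusedSectionVars false

namespace PadicShintani

/-! ### Local completions -/

section Local

variable (p : ℕ) [Fact p.Prime] {V : Type*} [AddCommGroup V] [Module ℚ V]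

/-- `V_p = V ⊗ ℚ_p`. -/
abbrev LocalSpace (V : Type*) [AddCommGroup V] [Module ℚ V] : Type _ := ℚ_[p] ⊗[ℚ] V

/-- The usual topology of the `ℚ_p`-vector space `V_p`. -/
noncomputable instance : TopologicalSpace (LocalSpace p V) := moduleTopology ℚ_[p] _

instance : IsModuleTopology ℚ_[p] (LocalSpace p V) := ⟨rfl⟩

instance : IsTopologicalAddGroup (LocalSpace p V) :=
  IsModuleTopology.topologicalAddGroup ℚ_[p] _

/-- The diagonal embedding `V → V_p`. -/
noncomputable def toLocal : V →+ LocalSpace p V :=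
  (TensorProduct.mk ℚ ℚ_[p] V 1).toAddMonoidHom

/-- `L_p = L ⊗ ℤ_p`, realised as the `ℤ_p`-submodule of `V_p` generated by `L`. -/
noncomputable def localLattice (L : Submodule ℤ V) : Submodule ℤ_[p] (LocalSpace p V) :=
  Submodule.span ℤ_[p] (toLocal p '' (L : Set V))

/-- `V ∩ L_p`, as a subgroup of `V`. -/
noncomputable def globalPoints (L : Submodule ℤ V) : AddSubgroup V :=
  (localLattice p L).toAddSubgroup.comap (toLocal p)

theorem toLocal_apply (v : V) : toLocal p v = 1 ⊗ₜ v := rfl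

theorem toLocal_smul (q : ℚ) (v : V) : toLocal p (q • v) = (q : ℚ_[p]) • toLocal p v := by
  simp [toLocal_apply, TensorProduct.smul_tmul', Algebra.smul_def]

theorem toLocal_nsmul (k : ℕ) (v : V) : toLocal p (k • v) = (k : ℚ_[p]) • toLocal p v := by
  rw [map_nsmul, Nat.cast_smul_eq_nsmul]

theorem mem_globalPoints {L : Submodule ℤ V} {v : V} :
    v ∈ globalPoints p L ↔ toLocal p v ∈ localLattice p L := Iff.rfl

theorem toLocal_mem {L : Submodule ℤ V} {v : V} (hv : v ∈ L) :
    toLocal p v ∈ localLattice p L := Submodule.subset_span ⟨v, hv, rfl⟩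

variable (L : Submodule ℤ V) [L.IsLattice ℚ]

instance : Module.Free ℤ L := Submodule.IsLattice.free ℚ L

/-- The index type of a `ℤ`-basis of `L`. -/
abbrev LatIndex : Type _ := Module.Free.ChooseBasisIndex ℤ L

/-- A `ℤ`-basis of `L`, as a `ℚ`-basis of `V`. -/
noncomputable def latticeBasis :
    Module.Basis (LatIndex L) ℚ V :=
  (Module.Free.chooseBasis ℤ L).extendOfIsLattice ℚ

theorem latticeBasis_mem (i) : latticeBasis L i ∈ L := by
  simp [latticeBasis]

theorem mem_lattice_iff (v : V) : v ∈ L ↔ ∀ i, ∃ k : ℤ, (latticeBasis L).repr v i = k := by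
  constructor
  · intro hv i
    refine ⟨(Module.Free.chooseBasis ℤ L).repr ⟨v, hv⟩ i, ?_⟩
    have h := (Module.Free.chooseBasis ℤ L).sum_repr ⟨v, hv⟩
    have h2 : v = ∑ j, ((((Module.Free.chooseBasis ℤ L).repr ⟨v, hv⟩ j : ℤ) : ℚ)) • latticeBasis L j := by
      have h3 := congrArg (Subtype.val) h
      rw [Submodule.coe_sum] at h3
      refine h3.symm.trans (Finset.sum_congr rfl fun j _ => ?_)
      rw [Int.cast_smul_eq_zsmul]
      simp [latticeBasis]
    conv_lhs => rw [h2]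
    rw [Module.Basis.repr_sum_self]
  · intro h
    choose k hk using h
    rw [← (latticeBasis L).sum_repr v]
    refine Submodule.sum_mem _ fun i _ => ?_
    rw [hk, Int.cast_smul_eq_zsmul]
    exact L.smul_mem _ (latticeBasis_mem L i)

/-- The basis of `V_p` coming from a basis of `L`. -/
noncomputable def localBasis : Module.Basis (LatIndex L) ℚ_[p] (LocalSpace p V) :=
  (latticeBasis L).baseChange ℚ_[p]

theorem localBasis_repr_toLocal (v : V) (i) :
    (localBasis p L).repr (toLocal p v) i = ((latticeBasis L).repr v i : ℚ_[p]) := by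
  simp [localBasis, toLocal_apply, Algebra.smul_def]

theorem mem_localLattice_iff (x : LocalSpace p V) :
    x ∈ localLattice p L ↔ ∀ i, ‖(localBasis p L).repr x i‖ ≤ 1 := by
  constructor
  · intro hx
    induction hx using Submodule.span_induction with
    | mem x hx =>
      obtain ⟨v, hv, rfl⟩ := hx
      intro i
      obtain ⟨k, hk⟩ := (mem_lattice_iff L v).1 hv i
      rw [localBasis_repr_toLocal, hk]
      simpa using Padic.norm_int_le_one k
    | zero => simp
    | add x y _ _ hx hy =>
      intro i
      rw [map_add, Finsupp.add_apply]
      exact (IsUltrametricDist.norm_add_le_max _ _).trans (max_le (hx i) (hy i))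
    | smul a x _ hx =>
      intro i
      have : a • x = (a : ℚ_[p]) • x := rfl
      rw [this, map_smul, Finsupp.smul_apply, smul_eq_mul, norm_mul]
      exact mul_le_one₀ a.2 (norm_nonneg _) (hx i)
  · intro h
    rw [← (localBasis p L).sum_repr x]
    refine Submodule.sum_mem _ fun i _ => ?_
    have h2 : localBasis p L i = toLocal p (latticeBasis L i) := by
      simp [localBasis, toLocal_apply]
    rw [h2]
    exact (localLattice p L).smul_mem ⟨_, h i⟩ (toLocal_mem p (latticeBasis_mem L i))

theorem continuous_localRepr (i) : Continuous fun x : LocalSpace p V => (localBasis p L).repr x i :=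
  IsModuleTopology.continuous_of_linearMap ((localBasis p L).coord i)

theorem isOpen_localLattice : IsOpen (localLattice p L : Set (LocalSpace p V)) := by
  have : (localLattice p L : Set (LocalSpace p V)) =
      ⋂ i, (fun x => (localBasis p L).repr x i) ⁻¹' (Metric.closedBall 0 1) := by
    ext x
    simp [mem_localLattice_iff]
  rw [this]
  refine isOpen_iInter_of_finite fun i => IsOpen.preimage (continuous_localRepr p L i) ?_
  exact IsUltrametricDist.isOpen_closedBall _ one_ne_zero

theorem isCompact_localLattice : IsCompact (localLattice p L : Set (LocalSpace p V)) := by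
  have : (localLattice p L : Set (LocalSpace p V)) =
      (localBasis p L).equivFun.symm '' (Set.univ.pi fun _ => Metric.closedBall 0 1) := by
    ext x
    rw [SetLike.mem_coe, mem_localLattice_iff, LinearEquiv.image_symm_eq_preimage]
    simp
  rw [this]
  refine IsCompact.image (isCompact_univ_pi fun i => isCompact_closedBall _ _) ?_
  exact IsModuleTopology.continuous_of_linearMap (localBasis p L).equivFun.symm.toLinearMap

theorem injective_equivFun_lattice :
    Function.Injective fun x : localLattice p L => (localBasis p L).equivFun x.1 :=
  (LinearEquiv.injective _).comp Subtype.val_injective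

theorem continuous_equivFun_lattice :
    Continuous fun x : localLattice p L => (localBasis p L).equivFun x.1 :=
  (IsModuleTopology.continuous_of_linearMap (localBasis p L).equivFun.toLinearMap).comp
    continuous_subtype_val

instance : CompactSpace (localLattice p L) :=
  isCompact_iff_compactSpace.1 (isCompact_localLattice p L)

instance : T2Space (localLattice p L) :=
  T2Space.of_injective_continuous (injective_equivFun_lattice p L) (continuous_equivFun_lattice p L)

instance : TotallyDisconnectedSpace (localLattice p L) :=
  ⟨fun _ _ hs x hx y hy => injective_equivFun_lattice p L
    ((hs.image _ (continuous_equivFun_lattice p L).continuousOn).subsingleton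
      ⟨x, hx, rfl⟩ ⟨y, hy, rfl⟩)⟩

/-- A rational number which is integral at every prime is an integer. -/
theorem exists_int_of_forall_norm_le_one (q : ℚ)
    (h : ∀ ℓ : ℕ, ∀ _ : Fact ℓ.Prime, ‖(q : ℚ_[ℓ])‖ ≤ 1) : ∃ k : ℤ, q = k := by
  refine ⟨q.num, (Rat.coe_int_num_of_den_eq_one ?_).symm⟩
  by_contra hd
  obtain ⟨ℓ, hℓ, hdvd⟩ := Nat.exists_prime_and_dvd hd
  have : Fact ℓ.Prime := ⟨hℓ⟩
  have h1 := h ℓ ⟨hℓ⟩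
  rw [Padic.norm_rat_le_one_iff_padicValuation_le_one, Rat.padicValuation_le_one_iff] at h1
  exact h1 hdvd

theorem mem_lattice_of_forall_local (v : V)
    (h : ∀ ℓ : ℕ, ∀ _ : Fact ℓ.Prime, toLocal ℓ v ∈ localLattice ℓ L) : v ∈ L := by
  rw [mem_lattice_iff]
  intro i
  refine exists_int_of_forall_norm_le_one _ fun ℓ _ => ?_
  rw [← localBasis_repr_toLocal ℓ L]
  exact (mem_localLattice_iff ℓ L _).1 (h ℓ ‹_›) i

theorem exists_nsmul_mem (v : V) : ∃ k : ℕ, 0 < k ∧ k • v ∈ L := by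
  refine ⟨∏ i, ((latticeBasis L).repr v i).den, Finset.prod_pos fun i _ => Rat.den_pos _, ?_⟩
  rw [mem_lattice_iff]
  intro i
  obtain ⟨c, hc⟩ := Finset.dvd_prod_of_mem (fun i => ((latticeBasis L).repr v i).den) (Finset.mem_univ i)
  refine ⟨((latticeBasis L).repr v i).num * c, ?_⟩
  rw [map_nsmul, Finsupp.smul_apply, hc, nsmul_eq_mul]
  push_cast
  rw [mul_right_comm, Rat.den_mul_eq_num]

end Local

/-! ### Test functions -/

section TestFunctions

/-- The local test functions `S(V_p)`: locally constant, compactly supported, integer valued. -/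
def IsLocalTestFunction (p : ℕ) [Fact p.Prime] {V : Type*} [AddCommGroup V] [Module ℚ V]
    (φ : LocalSpace p V → ℤ) : Prop :=
  IsLocallyConstant φ ∧ HasCompactSupport φ

/-- The primes different from `p`. -/
abbrev PrimesAway (p : ℕ) : Type := {ℓ : ℕ // ℓ.Prime ∧ ℓ ≠ p}

instance (p : ℕ) (ℓ : PrimesAway p) : Fact (ℓ : ℕ).Prime := ⟨ℓ.2.1⟩

open Classical in
/-- The characteristic function `[L_p]` of `L_p` in `V_p`. -/
noncomputable def latticeIndicator (p : ℕ) [Fact p.Prime] {V : Type*} [AddCommGroup V] [Module ℚ V]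
    (L : Submodule ℤ V) (x : LocalSpace p V) : ℤ :=
  if x ∈ localLattice p L then 1 else 0

/-- A factorizable test function `⨂_{ℓ ≠ p} φ_ℓ` away from `p`, with `φ_ℓ = [L_ℓ]` for almost
all `ℓ`. It is regarded as a function on `V`, which is dense in the adelic space; on `V` the
product has only finitely many factors different from `1`. -/
def IsFactorizable (p : ℕ) {V : Type*} [AddCommGroup V] [Module ℚ V]
    (L : Submodule ℤ V) (f : V → ℤ) : Prop :=
  ∃ φ : ∀ ℓ : PrimesAway p, LocalSpace ℓ V → ℤ,
    (∀ ℓ : PrimesAway p, IsLocalTestFunction ℓ (φ ℓ)) ∧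
    {ℓ : PrimesAway p | φ ℓ ≠ latticeIndicator ℓ L}.Finite ∧
    ∀ v, f v = ∏ᶠ ℓ : PrimesAway p, φ ℓ (toLocal ℓ v)

/-- The group `S(V^{(p)}) = ⨂'_{ℓ ≠ p} S(V_ℓ)` of test functions away from `p`. -/
def testFunctionsAway (p : ℕ) {V : Type*} [AddCommGroup V] [Module ℚ V]
    (L : Submodule ℤ V) : AddSubgroup (V → ℤ) :=
  AddSubgroup.closure {f | IsFactorizable p L f}

/-- The test function `f' ⊗ [L_p]` on `V`. -/
noncomputable def extendTest (p : ℕ) [Fact p.Prime] {V : Type*} [AddCommGroup V] [Module ℚ V]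
    (L : Submodule ℤ V) (f' : V → ℤ) (v : V) : ℤ :=
  f' v * latticeIndicator p L (toLocal p v)

theorem exists_pow_period (p : ℕ) [Fact p.Prime] {E : Type*} [AddCommGroup E] [Module ℚ_[p] E]
    [TopologicalSpace E] [IsTopologicalAddGroup E] [ContinuousSMul ℚ_[p] E]
    {φ : E → ℤ} (hlc : IsLocallyConstant φ)
    {K M : Set E} (hK : IsCompact K) (hM : IsCompact M) :
    ∃ m : ℕ, ∀ k, m ≤ k → ∀ x ∈ K, ∀ y ∈ M,
      φ (x + (p : ℚ_[p]) ^ k • y) = φ x := by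
  have c0 : Continuous fun q : ℚ_[p] × (E × E) =>
      q.2.1 + q.1 • q.2.2 :=
    (continuous_fst.comp continuous_snd).add
      (continuous_fst.smul (continuous_snd.comp continuous_snd))
  have hopen : IsOpen {q : ℚ_[p] × (E × E) |
      φ (q.2.1 + q.1 • q.2.2) = φ q.2.1} := by
    have c1 : Continuous fun q : ℚ_[p] × (E × E) =>
        (φ (q.2.1 + q.1 • q.2.2), φ q.2.1) :=
      (hlc.continuous.comp c0).prodMk (hlc.continuous.comp (continuous_fst.comp continuous_snd))
    exact (isOpen_discrete {z : ℤ × ℤ | z.1 = z.2}).preimage c1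
  obtain ⟨u, v, hu, -, h0, hv, huv⟩ := generalized_tube_lemma
    (isCompact_singleton (x := (0 : ℚ_[p]))) (hK.prod hM) hopen (by
      rintro ⟨a, x, y⟩ ⟨ha, -⟩
      have ha : a = 0 := ha
      subst ha
      change φ (x + (0 : ℚ_[p]) • y) = φ x
      rw [zero_smul, add_zero])
  have hlim : Filter.Tendsto (fun k : ℕ => (p : ℚ_[p]) ^ k) Filter.atTop (nhds 0) :=
    tendsto_pow_atTop_nhds_zero_of_norm_lt_one Padic.norm_p_lt_one
  obtain ⟨m, hm⟩ := Filter.eventually_atTop.1 (hlim.eventually (hu.mem_nhds (h0 rfl)))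
  exact ⟨m, fun k hk x hx y hy => huv (a := ((p : ℚ_[p]) ^ k, (x, y)))
    (Set.mk_mem_prod (hm k hk) (hv ⟨hx, hy⟩))⟩

section Local

variable (p : ℕ) [Fact p.Prime] {V : Type*} [AddCommGroup V] [Module ℚ V]
variable (L : Submodule ℤ V)

theorem pow_smul_mem_mono {x : LocalSpace p V} {m k : ℕ} (hmk : m ≤ k)
    (h : (p : ℚ_[p]) ^ m • x ∈ localLattice p L) : (p : ℚ_[p]) ^ k • x ∈ localLattice p L := by
  obtain ⟨c, rfl⟩ := Nat.exists_eq_add_of_le hmk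
  have h2 := (localLattice p L).smul_mem ((p : ℤ_[p]) ^ c) h
  have h3 : ((p : ℤ_[p]) ^ c) • ((p : ℚ_[p]) ^ m • x) = (p : ℚ_[p]) ^ (m + c) • x := by
    rw [pow_add, mul_comm, mul_smul, ← algebraMap_smul ℚ_[p] ((p : ℤ_[p]) ^ c)]
    simp
  rwa [h3] at h2

variable [L.IsLattice ℚ]

theorem exists_pow_smul_mem (x : LocalSpace p V) :
    ∃ m : ℕ, (p : ℚ_[p]) ^ m • x ∈ localLattice p L := by
  have h : ∀ i, ∃ m : ℕ, ‖(localBasis p L).repr x i‖ ≤ (p : ℝ) ^ m := fun i =>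
    pow_unbounded_of_one_lt _ (by exact_mod_cast (Fact.out : p.Prime).one_lt) |>.imp
      fun _ h => h.le
  choose m hm using h
  refine ⟨∑ i, m i, ?_⟩
  rw [mem_localLattice_iff]
  intro i
  have hp : (0 : ℝ) < p := by exact_mod_cast (Fact.out : p.Prime).pos
  have hp1 : (1 : ℝ) ≤ p := by exact_mod_cast (Fact.out : p.Prime).one_lt.le
  rw [map_smul, Finsupp.smul_apply, smul_eq_mul, norm_mul, norm_pow, Padic.norm_p, inv_pow,
    inv_mul_le_iff₀ (by positivity), mul_one]
  exact (hm i).trans (pow_le_pow_right₀ hp1 (Finset.single_le_sum (fun _ _ => Nat.zero_le _)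
    (Finset.mem_univ i)))

theorem exists_pow_of_isCompact {K : Set (LocalSpace p V)} (hK : IsCompact K) :
    ∃ m : ℕ, ∀ x ∈ K, (p : ℚ_[p]) ^ m • x ∈ localLattice p L := by
  have hcont : ∀ a : ℚ_[p], Continuous fun x : LocalSpace p V => a • x := fun a =>
    continuous_const_smul a
  refine hK.elim_directed_cover
    (fun m : ℕ => (fun x : LocalSpace p V => (p : ℚ_[p]) ^ m • x) ⁻¹' (localLattice p L))
    (fun m => (isOpen_localLattice p L).preimage (hcont _)) ?_ ?_
  · intro x _
    obtain ⟨m, hm⟩ := exists_pow_smul_mem p L x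
    exact Set.mem_iUnion.2 ⟨m, hm⟩
  · intro a b
    exact ⟨max a b, fun x hx => pow_smul_mem_mono p L (le_max_left _ _) hx,
      fun x hx => pow_smul_mem_mono p L (le_max_right _ _) hx⟩

theorem IsLocalTestFunction.exists_pow {φ : LocalSpace p V → ℤ} (hφ : IsLocalTestFunction p φ) :
    ∃ m : ℕ, (∀ x, ∀ y ∈ localLattice p L, φ (x + (p : ℚ_[p]) ^ m • y) = φ x) ∧
      ∀ x, φ x ≠ 0 → (p : ℚ_[p]) ^ m • x ∈ localLattice p L := by
  obtain ⟨hlc, hcs⟩ := hφ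
  have hK : IsCompact (tsupport φ) := hcs
  obtain ⟨m₁, hm₁⟩ := exists_pow_of_isCompact p L hK
  obtain ⟨m₂, hm₂⟩ := exists_pow_period p hlc hK (isCompact_localLattice p L)
  refine ⟨max m₁ m₂, fun x y hy => ?_, fun x hx => pow_smul_mem_mono p L (le_max_left _ _)
    (hm₁ _ (subset_tsupport _ hx))⟩
  by_cases h1 : φ x = 0
  · by_cases h2 : φ (x + (p : ℚ_[p]) ^ max m₁ m₂ • y) = 0
    · rw [h1, h2]
    · have := hm₂ _ (le_max_right m₁ m₂) _ (subset_tsupport _ h2) (-y) (neg_mem hy)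
      rw [smul_neg, add_neg_cancel_right] at this
      exact this.symm
  · exact hm₂ _ (le_max_right m₁ m₂) _ (subset_tsupport _ h1) y hy

end Local

theorem smul_nat_mem (p : ℕ) [Fact p.Prime] {V : Type*} [AddCommGroup V] [Module ℚ V]
    {L : Submodule ℤ V} {x : LocalSpace p V} (hx : x ∈ localLattice p L) (c : ℕ) :
    (c : ℚ_[p]) • x ∈ localLattice p L := by
  rw [Nat.cast_smul_eq_nsmul]
  exact nsmul_mem hx c

theorem finite_not_mem_localLattice (p : ℕ) {V : Type*} [AddCommGroup V] [Module ℚ V]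
    (L : Submodule ℤ V) [L.IsLattice ℚ] (v : V) :
    {ℓ : PrimesAway p | toLocal ℓ v ∉ localLattice ℓ L}.Finite := by
  obtain ⟨k, hk, hkv⟩ := exists_nsmul_mem L v
  refine Set.Finite.of_finite_image (f := Subtype.val) ?_ Subtype.val_injective.injOn
  refine (k.primeFactors.finite_toSet).subset ?_
  rintro _ ⟨ℓ, hℓ, rfl⟩
  simp only [Finset.mem_coe, Nat.mem_primeFactors]
  refine ⟨ℓ.2.1, ?_, hk.ne'⟩
  by_contra hnd
  apply hℓ
  have h := toLocal_mem (ℓ : ℕ) hkv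
  rw [mem_localLattice_iff] at h ⊢
  intro i
  have h2 := h i
  rw [toLocal_nsmul, map_smul, Finsupp.smul_apply, smul_eq_mul, norm_mul] at h2
  have h3 : ‖((k : ℕ) : ℚ_[(ℓ : ℕ)])‖ = 1 := by
    rw [Padic.norm_natCast_eq_one_iff]
    exact (Nat.Prime.coprime_iff_not_dvd ℓ.2.1).2 hnd
  rwa [h3, one_mul] at h2

/-- A test function away from `p` is periodic under a lattice and, after multiplication with
`[L_p]`, is supported on a lattice. -/
theorem exists_period (p : ℕ) [Fact p.Prime] {V : Type*} [AddCommGroup V] [Module ℚ V]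
    (L : Submodule ℤ V) [L.IsLattice ℚ] {f : V → ℤ} (hf : f ∈ testFunctionsAway p L) :
    ∃ N : ℕ, 0 < N ∧ (∀ v, ∀ l ∈ L, f (v + N • l) = f v) ∧
      ∀ v, f v ≠ 0 → toLocal p v ∈ localLattice p L → N • v ∈ L := by
  induction hf using AddSubgroup.closure_induction with
  | mem f hf =>
    obtain ⟨φ, hφ, hfin, hprod⟩ := hf
    choose m hm1 hm2 using fun ℓ => (hφ ℓ).exists_pow ℓ L
    set T := hfin.toFinset with hT
    have hpos : 0 < ∏ ℓ ∈ T, (ℓ : ℕ) ^ m ℓ :=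
      Finset.prod_pos fun ℓ _ => pow_pos ℓ.2.1.pos _
    refine ⟨∏ ℓ ∈ T, (ℓ : ℕ) ^ m ℓ, hpos, ?_, ?_⟩
    · intro v l hl
      rw [hprod, hprod]
      refine finprod_congr fun ℓ => ?_
      rw [map_add, toLocal_nsmul]
      by_cases hℓ : ℓ ∈ T
      · obtain ⟨c, hc⟩ := Finset.dvd_prod_of_mem (fun ℓ : PrimesAway p => (ℓ : ℕ) ^ m ℓ) hℓ
        rw [hc, Nat.cast_mul, mul_smul, Nat.cast_pow]
        exact hm1 ℓ _ _ (smul_nat_mem _ (toLocal_mem _ hl) c)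
      · have : φ ℓ = latticeIndicator ℓ L := by
          by_contra hne
          exact hℓ (hfin.mem_toFinset.2 hne)
        rw [this]
        have h1 := smul_nat_mem _ (toLocal_mem ℓ hl) (∏ ℓ ∈ T, (ℓ : ℕ) ^ m ℓ)
        have h2 := (localLattice (ℓ : ℕ) L).add_mem_iff_left (x := toLocal ℓ v) h1
        by_cases h3 : toLocal ℓ v ∈ localLattice (ℓ : ℕ) L
        · rw [latticeIndicator, latticeIndicator, if_pos h3, if_pos (h2.2 h3)]
        · rw [latticeIndicator, latticeIndicator, if_neg h3, if_neg (mt h2.1 h3)]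
    · intro v hv hpv
      have hne : ∀ ℓ : PrimesAway p, φ ℓ (toLocal ℓ v) ≠ 0 := by
        intro ℓ h0
        apply hv
        rw [hprod]
        refine finprod_eq_zero _ ℓ h0 ?_
        refine (hfin.union (finite_not_mem_localLattice p L v)).subset ?_
        intro ℓ hℓ
        by_contra hcon
        simp only [Set.mem_union, Set.mem_ofPred_eq, not_or, not_not] at hcon
        apply hℓ
        simp only [hcon.1, latticeIndicator, hcon.2, if_true]
      refine mem_lattice_of_forall_local L _ fun ℓ hℓ => ?_
      rw [toLocal_nsmul]
      by_cases hlp : ℓ = p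
      · subst hlp
        exact smul_nat_mem _ hpv _
      · let q : PrimesAway p := ⟨ℓ, hℓ.out, hlp⟩
        by_cases hq : q ∈ T
        · obtain ⟨c, hc⟩ := Finset.dvd_prod_of_mem (fun ℓ : PrimesAway p => (ℓ : ℕ) ^ m ℓ) hq
          rw [hc, mul_comm, Nat.cast_mul, mul_smul, Nat.cast_pow]
          exact smul_nat_mem _ (hm2 q _ (hne q)) c
        · have h1 : φ q = latticeIndicator q L := by
            by_contra hne
            exact hq (hfin.mem_toFinset.2 hne)
          have h2 := hne q
          rw [h1] at h2
          refine smul_nat_mem _ ?_ _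
          by_contra h3
          exact h2 (if_neg h3)
  | zero => exact ⟨1, one_pos, fun _ _ _ => rfl, fun v hv => absurd rfl hv⟩
  | add f g _ _ hf hg =>
    obtain ⟨N, hN, h1, h2⟩ := hf
    obtain ⟨M, hM, h3, h4⟩ := hg
    refine ⟨N * M, Nat.mul_pos hN hM, fun v l hl => ?_, fun v hv hp => ?_⟩
    · simp only [Pi.add_apply]
      congr 1
      · rw [mul_smul]; exact h1 v _ (L.smul_of_tower_mem M hl)
      · rw [mul_comm, mul_smul]; exact h3 v _ (L.smul_of_tower_mem N hl)
    · by_cases hfv : f v = 0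
      · rw [mul_smul]
        refine L.smul_of_tower_mem N (h4 v ?_ hp)
        intro h
        exact hv (by simp [hfv, h])
      · rw [mul_comm, mul_smul]
        exact L.smul_of_tower_mem M (h2 v hfv hp)
  | neg f _ hf =>
    obtain ⟨N, hN, h1, h2⟩ := hf
    exact ⟨N, hN, fun v l hl => by simp [h1 v l hl], fun v hv => h2 v (by simpa using hv)⟩

end TestFunctions

/-! ### Measures and pseudo-measures -/

section Measures

open AbstractMeasure

variable (p : ℕ) [Fact p.Prime] (G : Type*) [TopologicalSpace G]

/-- The `p`-adic measures on `G`: continuous `ℚ_p`-linear functionals on `C(G, ℚ_p)`. -/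
def PadicMeasure : Type _ := D(G, ℚ_[p])

namespace PadicMeasure

noncomputable instance : AddCommGroup (PadicMeasure p G) :=
  inferInstanceAs (AddCommGroup D(G, ℚ_[p]))

noncomputable instance : FunLike (PadicMeasure p G) C(G, ℚ_[p]) ℚ_[p] :=
  inferInstanceAs (FunLike D(G, ℚ_[p]) C(G, ℚ_[p]) ℚ_[p])

variable {G}

/-- The Dirac measure `δ_x`. -/
noncomputable def dirac (x : G) : PadicMeasure p G := AbstractMeasure.dirac ℚ_[p] x

variable {p}

@[ext]
theorem ext {μ ν : PadicMeasure p G} (h : ∀ f : C(G, ℚ_[p]), μ f = ν f) : μ = ν :=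
  DFunLike.ext _ _ h

@[simp] theorem add_apply (μ ν : PadicMeasure p G) (f : C(G, ℚ_[p])) :
    (μ + ν) f = μ f + ν f := rfl

@[simp] theorem zero_apply (f : C(G, ℚ_[p])) : (0 : PadicMeasure p G) f = 0 := rfl

@[simp] theorem map_zero' (μ : PadicMeasure p G) : μ (0 : C(G, ℚ_[p])) = 0 :=
  map_zero (AbstractMeasure.toCLMEquiv μ)

theorem map_add' (μ : PadicMeasure p G) (f g : C(G, ℚ_[p])) : μ (f + g) = μ f + μ g :=
  map_add (AbstractMeasure.toCLMEquiv μ) f g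

@[simp] theorem dirac_apply (x : G) (f : C(G, ℚ_[p])) : dirac p x f = f x := rfl

variable [AddCommGroup G] [IsTopologicalAddGroup G]

/-- The translate `w ↦ f (v + w)` of a continuous function. -/
noncomputable def translate (f : C(G, ℚ_[p])) (v : G) : C(G, ℚ_[p]) :=
  ⟨fun w => f (v + w), f.continuous.comp (continuous_const.add continuous_id)⟩

/-- The continuous function `v ↦ ∫ f (v + w) dν(w)`. -/
noncomputable def inner (ν : PadicMeasure p G) (f : C(G, ℚ_[p])) : C(G, ℚ_[p]) :=
  AbstractMeasure.contractSnd (X := G) ν (f.comp ⟨fun x : G × G => x.1 + x.2, continuous_add⟩)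

@[simp] theorem inner_apply (ν : PadicMeasure p G) (f : C(G, ℚ_[p])) (v : G) :
    inner ν f v = ν (translate f v) := rfl

variable [CompactSpace G]

/-- Convolution: `(μ * ν)(f) = ∫ (∫ f (v + w) dν(w)) dμ(v)`. -/
noncomputable instance : Mul (PadicMeasure p G) :=
  ⟨fun μ ν => AbstractMeasure.map ⟨fun x : G × G => x.1 + x.2, continuous_add⟩
    (AbstractMeasure.prodMk' (X := G) (Y := G) μ ν)⟩

theorem mul_apply (μ ν : PadicMeasure p G) (f : C(G, ℚ_[p])) : (μ * ν) f = μ (inner ν f) := rfl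

noncomputable instance : One (PadicMeasure p G) := ⟨dirac p 0⟩

theorem one_def : (1 : PadicMeasure p G) = dirac p 0 := rfl

variable [T2Space G] [TotallyDisconnectedSpace G]

protected theorem mul_comm' (μ ν : PadicMeasure p G) : μ * ν = ν * μ := by
  ext f
  have h := AbstractMeasure.prodMk_eq_prodMk' (X := G) (Y := G) (R := ℚ_[p]) ν μ
  have h2 := congrArg (fun κ : D(G × G, ℚ_[p]) =>
    κ (f.comp ⟨fun x : G × G => x.1 + x.2, continuous_add⟩)) h
  refine Eq.trans ?_ h2
  change μ _ = μ _
  congr 1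
  ext v
  change ν _ = ν _
  congr 1
  ext w
  change f (v + w) = f (w + v)
  rw [add_comm]

noncomputable instance : CommRing (PadicMeasure p G) :=
  { (inferInstance : AddCommGroup (PadicMeasure p G)) with
    mul := (· * ·)
    one := 1
    mul_assoc := fun μ ν κ => by
      ext f
      have h : inner ν (inner κ f) = inner (ν * κ) f := by
        ext v
        have h2 : translate (inner κ f) v = inner κ (translate f v) := by
          ext w
          have h3 : translate f (v + w) = translate (translate f v) w := by
            ext u
            simp [translate, add_assoc]
          change κ (translate f (v + w)) = κ (translate (translate f v) w)
          rw [h3]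
        change ν (translate (inner κ f) v) = ν (inner κ (translate f v))
        rw [h2]
      rw [mul_apply, mul_apply, mul_apply, h]
    one_mul := fun (μ : PadicMeasure p G) => by
      ext f
      have h : translate f 0 = f := by
        ext
        simp [translate]
      change μ (translate f 0) = μ f
      rw [h]
    mul_one := fun (μ : PadicMeasure p G) => by
      ext f
      have h : inner (1 : PadicMeasure p G) f = f := by
        ext v
        change f (v + 0) = f v
        rw [add_zero]
      rw [mul_apply, h]
    zero_mul := fun μ => rfl
    mul_zero := fun μ => by
      ext f
      rw [mul_apply]
      have : inner (0 : PadicMeasure p G) f = 0 := rfl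
      simp [this]
    left_distrib := fun μ ν κ => by
      ext f
      rw [mul_apply, add_apply, mul_apply, mul_apply, ← map_add']
      rfl
    right_distrib := fun μ ν κ => rfl
    mul_comm := PadicMeasure.mul_comm' }

theorem dirac_mul_dirac (x y : G) : dirac p x * dirac p y = dirac p (x + y) := rfl

variable (p G)

/-- The multiplicative set generated by the measures `δ_0 - δ_v`, `v ≠ 0`. -/
noncomputable def denominators : Submonoid (PadicMeasure p G) :=
  Submonoid.closure {μ | ∃ v : G, v ≠ 0 ∧ μ = dirac p 0 - dirac p v}

end PadicMeasure

variable [AddCommGroup G] [IsTopologicalAddGroup G] [CompactSpace G]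
  [T2Space G] [TotallyDisconnectedSpace G]

/-- The `p`-adic pseudo-measures on `G`: the localization of the convolution algebra of measures at
the multiplicative set generated by the `δ_0 - δ_v`, `v ≠ 0`. -/
abbrev PseudoMeasure : Type _ := Localization (PadicMeasure.denominators p G)

end Measures

/-! ### Cone functions -/

section Cones

variable {V : Type*} [AddCommGroup V] [Module ℚ V]

/-- The points of `V` in the open cone `C°(u_1, …, u_r)` spanned by independent vectors of `V`
(the coefficients of a point of `V` are automatically rational); for `r = 0` this is `{0}`. -/
def openCone {r : ℕ} (u : Fin r → V) : Set V :=
  {v | ∃ a : Fin r → ℚ, (∀ i, 0 < a i) ∧ v = ∑ i, a i • u i}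

open Classical in
/-- The characteristic function of a subset of `V`. -/
noncomputable def charFn (s : Set V) (v : V) : ℤ := if v ∈ s then 1 else 0

variable (V) in
/-- The group of functions generated by the characteristic functions of the rational (simplicial)
open cones. -/
def openConeFunctions : AddSubgroup (V → ℤ) :=
  AddSubgroup.closure
    {κ | ∃ (r : ℕ) (u : Fin r → V), LinearIndependent ℚ u ∧ κ = charFn (openCone u)}

variable (V) in
/-- The group `K_V` of rational cone functions: functions on `V` whose restriction to `V \ {0}` is
a `ℤ`-linear combination of characteristic functions of rational open cones. -/
def coneFunctions : AddSubgroup (V → ℤ) where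
  carrier := {κ | ∃ κ₀ ∈ openConeFunctions V, ∀ v, v ≠ 0 → κ v = κ₀ v}
  zero_mem' := ⟨0, zero_mem _, fun _ _ => rfl⟩
  add_mem' := by
    rintro κ κ' ⟨a, ha, h⟩ ⟨b, hb, h'⟩
    exact ⟨a + b, add_mem ha hb, fun v hv => by simp [h v hv, h' v hv]⟩
  neg_mem' := by
    rintro κ ⟨a, ha, h⟩
    exact ⟨-a, neg_mem ha, fun v hv => by simp [h v hv]⟩

theorem openConeFunctions_le : openConeFunctions V ≤ coneFunctions V :=
  fun κ hκ => ⟨κ, hκ, fun _ _ => rfl⟩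

/-- The relatively open face of the cone spanned by `u` with support `S`. -/
def face {r : ℕ} (u : Fin r → V) (S : Finset (Fin r)) : Set V :=
  {v | ∃ a : Fin r → ℚ, (∀ k, if k ∈ S then 0 < a k else a k = 0) ∧ v = ∑ i, a i • u i}

theorem mem_face_iff {r : ℕ} {u : Fin r → V} (hu : LinearIndependent ℚ u) (S : Finset (Fin r))
    (a : Fin r → ℚ) :
    ∑ i, a i • u i ∈ face u S ↔ ∀ k, if k ∈ S then 0 < a k else a k = 0 := by
  constructor
  · rintro ⟨b, hb, h⟩
    have : a = b := by
      have h2 : ∑ i, (a i - b i) • u i = 0 := by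
        simp only [sub_smul, Finset.sum_sub_distrib, h, sub_self]
      ext i
      exact sub_eq_zero.1 (Fintype.linearIndependent_iff.1 hu _ h2 i)
    rwa [this]
  · intro h
    exact ⟨a, h, rfl⟩

theorem charFn_face_mem {r : ℕ} {u : Fin r → V} (hu : LinearIndependent ℚ u)
    (S : Finset (Fin r)) : charFn (face u S) ∈ openConeFunctions V := by
  refine AddSubgroup.subset_closure ⟨S.card, fun k => u (S.orderEmbOfFin rfl k),
    hu.comp _ (S.orderEmbOfFin rfl).injective, ?_⟩
  congr 1
  ext v
  have key : ∀ a : Fin r → ℚ, ∑ k : Fin S.card, a (S.orderEmbOfFin rfl k) • u (S.orderEmbOfFin rfl k)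
      = ∑ i ∈ S, a i • u i := by
    intro a
    conv_rhs => rw [← Finset.image_orderEmbOfFin_univ S rfl]
    rw [Finset.sum_image (fun x _ y _ h => (S.orderEmbOfFin rfl).injective h)]
  constructor
  · rintro ⟨a, ha, rfl⟩
    refine ⟨fun k => a (S.orderEmbOfFin rfl k), fun k => ?_, ?_⟩
    · have := ha (S.orderEmbOfFin rfl k)
      rwa [if_pos (Finset.orderEmbOfFin_mem S rfl k)] at this
    · rw [key a]
      symm
      refine Finset.sum_subset (Finset.subset_univ _) fun i _ hi => ?_
      have := ha i
      rw [if_neg hi] at this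
      rw [this, zero_smul]
  · rintro ⟨a, ha, rfl⟩
    classical
    let b : Fin r → ℚ := fun i => if h : i ∈ S then a ((S.orderIsoOfFin rfl).symm ⟨i, h⟩) else 0
    have hb : ∀ k, b (S.orderEmbOfFin rfl k) = a k := by
      intro k
      have h1 := Finset.orderEmbOfFin_mem S rfl k
      have h2 : (⟨S.orderEmbOfFin rfl k, h1⟩ : S) = S.orderIsoOfFin rfl k := by
        ext; simp
      simp only [b, h1, dif_pos, h2, OrderIso.symm_apply_apply]
    refine ⟨b, fun k => ?_, ?_⟩
    · by_cases hk : k ∈ S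
      · simp only [hk, if_true, b, dif_pos, ha]
      · simp [hk, b]
    · have h3 := key b
      simp only [hb] at h3
      rw [h3]
      refine Finset.sum_subset (Finset.subset_univ _) fun i _ hi => ?_
      simp [b, hi]

/-- Replace `u_j` by `x u_i + y u_j`. -/
def subdiv {r : ℕ} (u : Fin r → V) (i j : Fin r) (x y : ℚ) : Fin r → V :=
  u + Pi.single j (x • u i + (y - 1) • u j)

theorem sum_subdiv {r : ℕ} (u : Fin r → V) (i j : Fin r) (x y : ℚ) (c : Fin r → ℚ) :
    ∑ k, c k • subdiv u i j x y k =
      ∑ k, (c + Pi.single i (c j * x) + Pi.single j (c j * (y - 1)) : Fin r → ℚ) k • u k := by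
  simp only [subdiv, Pi.add_apply, smul_add, add_smul, Finset.sum_add_distrib, Pi.single_apply,
    smul_ite, ite_smul, smul_zero, zero_smul, Finset.sum_ite_eq',
    Finset.mem_univ, if_true, mul_smul, add_assoc]

theorem linearIndependent_subdiv {r : ℕ} {u : Fin r → V} (hu : LinearIndependent ℚ u)
    {i j : Fin r} (hij : i ≠ j) (x : ℚ) {y : ℚ} (hy : y ≠ 0) :
    LinearIndependent ℚ (subdiv u i j x y) := by
  rw [Fintype.linearIndependent_iff] at hu ⊢
  intro c hc
  rw [sum_subdiv] at hc
  have h := hu _ hc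
  have hj : c j = 0 := by
    have := h j
    simp only [Pi.add_apply, Pi.single_apply, hij.symm, if_false, if_true] at this
    have h2 : c j * y = 0 := by linarith
    exact (mul_eq_zero.1 h2).resolve_right hy
  intro k
  have := h k
  simpa [hj] using this

theorem mem_face_subdiv_iff {r : ℕ} {u : Fin r → V} (hu : LinearIndependent ℚ u)
    {i j : Fin r} (hij : i ≠ j) (x : ℚ) {y : ℚ} (hy : y ≠ 0) (S : Finset (Fin r))
    (a : Fin r → ℚ) :
    ∑ k, a k • u k ∈ face (subdiv u i j x y) S ↔
      (∀ k, k ≠ i → k ≠ j → if k ∈ S then 0 < a k else a k = 0) ∧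
      (if i ∈ S then 0 < a i - x * (a j / y) else a i - x * (a j / y) = 0) ∧
      (if j ∈ S then 0 < a j / y else a j / y = 0) := by
  have h : ∑ k, a k • u k =
      ∑ k, (a + Pi.single i (- (x * (a j / y))) + Pi.single j (a j / y - a j) : Fin r → ℚ) k •
        subdiv u i j x y k := by
    rw [sum_subdiv]
    refine Finset.sum_congr rfl fun k _ => ?_
    congr 1
    have e : a j / y * y = a j := div_mul_cancel₀ _ hy
    simp only [Pi.add_apply, Pi.single_apply, hij.symm, if_false, if_true]
    by_cases hi : k = i <;> by_cases hj : k = j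
    · exact absurd (hi.symm.trans hj) hij
    · simp only [hi, hij, if_true, if_false]; ring
    · simp only [hj, hij.symm, if_true, if_false]; linear_combination -e
    · simp only [hi, hj, if_false]; ring
  rw [h, mem_face_iff (linearIndependent_subdiv hu hij x hy)]
  constructor
  · intro H
    refine ⟨fun k hi hj => ?_, ?_, ?_⟩
    · simpa [hi, hj] using H k
    · have := H i
      simp only [Pi.add_apply, Pi.single_apply, hij, if_false, if_true, add_zero] at this
      simpa [sub_eq_add_neg] using this
    · have := H j
      simp only [Pi.add_apply, Pi.single_apply, hij.symm, if_false, if_true, add_zero,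
        add_sub_cancel] at this
      exact this
  · rintro ⟨h1, h2, h3⟩ k
    simp only [Pi.add_apply, Pi.single_apply]
    by_cases hi : k = i
    · subst hi
      simp only [hij, if_false, if_true, add_zero]
      simpa [sub_eq_add_neg] using h2
    · by_cases hj : k = j
      · subst hj
        simp only [hij.symm, if_false, if_true, add_zero, add_sub_cancel]
        exact h3
      · simpa [hi, hj] using h1 k hi hj

theorem face_subset_span {r : ℕ} {u : Fin r → V} {S : Finset (Fin r)} {v : V}
    (h : v ∈ face u S) : ∃ a : Fin r → ℚ, v = ∑ k, a k • u k := ⟨_, h.choose_spec.2⟩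

theorem face_subdiv_subset_span {r : ℕ} {u : Fin r → V} {S : Finset (Fin r)} {v : V}
    {i j : Fin r} {x y : ℚ} (h : v ∈ face (subdiv u i j x y) S) :
    ∃ a : Fin r → ℚ, v = ∑ k, a k • u k := by
  obtain ⟨a, ha⟩ := face_subset_span h
  exact ⟨_, ha.trans (sum_subdiv _ _ _ _ _ _)⟩

theorem charFn_of_mem {s : Set V} {v : V} (h : v ∈ s) : charFn s v = 1 := if_pos h

theorem charFn_of_notMem {s : Set V} {v : V} (h : v ∉ s) : charFn s v = 0 := if_neg h

/-- Stellar subdivision of an open cone. -/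
theorem charFn_face_subdiv {r : ℕ} {u : Fin r → V} (hu : LinearIndependent ℚ u)
    {i j : Fin r} (hij : i ≠ j) {s t : ℚ} (hs : 0 < s) (ht : 0 < t) {S : Finset (Fin r)}
    (hi : i ∈ S) (hj : j ∈ S) :
    charFn (face u S) = charFn (face (subdiv u i j s t) S) +
      charFn (face (subdiv u i j s t) (S.erase i)) + charFn (face (subdiv u j i t s) S) := by
  classical
  ext v
  by_cases hv : ∃ a : Fin r → ℚ, v = ∑ k, a k • u k
  · obtain ⟨a, rfl⟩ := hv
    set P : Prop := ∀ k, k ≠ i → k ≠ j → if k ∈ S then 0 < a k else a k = 0 with hP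
    have hP1 : (∀ k, k ≠ i → k ≠ j → if k ∈ S.erase i then 0 < a k else a k = 0) ↔ P := by
      refine forall_congr' fun k => imp_congr_right fun hk => ?_
      simp [hk]
    have hP2 : (∀ k, k ≠ j → k ≠ i → if k ∈ S then 0 < a k else a k = 0) ↔ P :=
      forall_congr' fun k => ⟨fun h a b => h b a, fun h a b => h b a⟩
    have e0 : (∑ k, a k • u k ∈ face u S) ↔ P ∧ 0 < a i ∧ 0 < a j := by
      rw [mem_face_iff hu]
      constructor
      · intro H
        exact ⟨fun k _ _ => H k, by simpa [hi] using H i, by simpa [hj] using H j⟩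
      · rintro ⟨h1, h2, h3⟩ k
        by_cases hki : k = i
        · subst hki; simpa [hi] using h2
        · by_cases hkj : k = j
          · subst hkj; simpa [hj] using h3
          · exact h1 k hki hkj
    have e1 := mem_face_subdiv_iff hu hij s ht.ne' S a
    have e2 := mem_face_subdiv_iff hu hij s ht.ne' (S.erase i) a
    have e3 := mem_face_subdiv_iff hu hij.symm t hs.ne' S a
    rw [← hP] at e1
    rw [hP1] at e2
    rw [hP2] at e3
    simp only [hi, hj, if_true, Finset.mem_erase, hij.symm, ne_eq, not_true_eq_false,
      false_and, if_false, not_false_eq_true, true_and] at e1 e2 e3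
    have d1 : 0 < a j / t ↔ 0 < a j := div_pos_iff_of_pos_right ht
    have d2 : 0 < a i / s ↔ 0 < a i := div_pos_iff_of_pos_right hs
    have d3 : 0 < a i - s * (a j / t) ↔ s * a j < t * a i := by
      rw [sub_pos, ← mul_div_assoc, div_lt_iff₀ ht, mul_comm (a i)]
    have d4 : a i - s * (a j / t) = 0 ↔ s * a j = t * a i := by
      rw [sub_eq_zero, ← mul_div_assoc, eq_div_iff ht.ne', mul_comm (a i), eq_comm]
    have d5 : 0 < a j - t * (a i / s) ↔ t * a i < s * a j := by
      rw [sub_pos, ← mul_div_assoc, div_lt_iff₀ hs, mul_comm (a j)]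
    rw [d1, d3] at e1
    rw [d1, d4] at e2
    rw [d2, d5] at e3
    simp only [Pi.add_apply, charFn, e0, e1, e2, e3]
    by_cases hp : P
    · by_cases h1 : 0 < a i <;> by_cases h2 : 0 < a j
      · rcases lt_trichotomy (s * a j) (t * a i) with h | h | h
        · simp [hp, h1, h2, h, h.ne, h.not_gt]
        · simp [hp, h1, h2, h]
        · simp [hp, h1, h2, h, h.ne', h.not_gt]
      · have h3 : ¬ t * a i < s * a j := by
          have := mul_pos ht h1
          have := mul_nonpos_of_nonneg_of_nonpos hs.le (not_lt.1 h2)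
          linarith
        simp [h2, h3]
      · have h3 : ¬ s * a j < t * a i := by
          have := mul_pos hs h2
          have := mul_nonpos_of_nonneg_of_nonpos ht.le (not_lt.1 h1)
          linarith
        have h4 : ¬ s * a j = t * a i := by
          have := mul_pos hs h2
          have := mul_nonpos_of_nonneg_of_nonpos ht.le (not_lt.1 h1)
          linarith
        simp [h1, h3, h4]
      · simp [h1, h2]
    · simp [hp]
  · rw [Pi.add_apply, Pi.add_apply, charFn_of_notMem fun h => hv (face_subset_span h),
      charFn_of_notMem fun h => hv (face_subdiv_subset_span h),
      charFn_of_notMem fun h => hv (face_subdiv_subset_span h),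
      charFn_of_notMem fun h => hv (face_subdiv_subset_span h)]
    rfl

theorem subdiv_apply_self {r : ℕ} (u : Fin r → V) (i j : Fin r) (x y : ℚ) :
    subdiv u i j x y j = x • u i + y • u j := by
  simp only [subdiv, Pi.add_apply, Pi.single_eq_same, sub_smul, one_smul]
  abel

theorem subdiv_apply_of_ne {r : ℕ} (u : Fin r → V) (i : Fin r) {j k : Fin r} (x y : ℚ)
    (h : k ≠ j) : subdiv u i j x y k = u k := by
  simp [subdiv, h]

theorem charFn_inter_pos (s : Set V) (l : V →ₗ[ℚ] ℚ) (v : V) :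
    charFn (s ∩ {v | 0 < l v}) v = if 0 < l v then charFn s v else 0 := by
  by_cases h1 : v ∈ s <;> by_cases h2 : 0 < l v <;> simp [charFn, h1, h2]

/-- Intersecting an open cone with a rational half-space gives a cone function. -/
theorem charFn_face_halfSpace (l : V →ₗ[ℚ] ℚ) (m : ℕ) {r : ℕ} {u : Fin r → V}
    (hu : LinearIndependent ℚ u) (S : Finset (Fin r))
    (hm : (S.filter fun k => l (u k) ≠ 0).card ≤ m) :
    charFn (face u S ∩ {v | 0 < l v}) ∈ openConeFunctions V := by
  induction m generalizing u S with
  | zero =>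
    have h0 : ∀ k ∈ S, l (u k) = 0 := by
      intro k hk
      by_contra h
      have := Finset.card_eq_zero.1 (Nat.le_zero.1 hm)
      exact Finset.notMem_empty k (this ▸ Finset.mem_filter.2 ⟨hk, h⟩)
    have : charFn (face u S ∩ {v | 0 < l v}) = 0 := by
      ext v
      refine charFn_of_notMem ?_
      rintro ⟨⟨a, ha, rfl⟩, hv⟩
      have hv : 0 < l (∑ k, a k • u k) := hv
      rw [map_sum, Finset.sum_eq_zero] at hv
      · exact lt_irrefl _ hv
      · intro k _
        by_cases hk : k ∈ S
        · simp [h0 k hk]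
        · have := ha k
          rw [if_neg hk] at this
          simp [this]
    rw [this]
    exact zero_mem _
  | succ m ih =>
    by_cases hpos : ∃ i ∈ S, 0 < l (u i)
    · obtain ⟨i, hi, hli⟩ := hpos
      by_cases hneg : ∃ j ∈ S, l (u j) < 0
      · obtain ⟨j, hj, hlj⟩ := hneg
        have hij : i ≠ j := by
          rintro rfl
          exact lt_asymm hli hlj
        have hs : 0 < -l (u j) := by linarith
        have hdec := charFn_face_subdiv hu hij hs hli hi hj
        have hA0 : l (subdiv u i j (-l (u j)) (l (u i)) j) = 0 := by
          rw [subdiv_apply_self]; simp; ring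
        have hB0 : l (subdiv u j i (l (u i)) (-l (u j)) i) = 0 := by
          rw [subdiv_apply_self]; simp; ring
        have hcA : (S.filter fun k => l (subdiv u i j (-l (u j)) (l (u i)) k) ≠ 0).card ≤ m := by
          have hsub : (S.filter fun k => l (subdiv u i j (-l (u j)) (l (u i)) k) ≠ 0) ⊆
              (S.filter fun k => l (u k) ≠ 0).erase j := by
            intro k hk
            rw [Finset.mem_filter] at hk
            have hkj : k ≠ j := by rintro rfl; exact hk.2 hA0
            rw [subdiv_apply_of_ne _ _ _ _ hkj] at hk
            exact Finset.mem_erase.2 ⟨hkj, Finset.mem_filter.2 hk⟩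
          have := Finset.card_le_card hsub
          rw [Finset.card_erase_of_mem (Finset.mem_filter.2 ⟨hj, hlj.ne⟩)] at this
          omega
        have hcB : (S.filter fun k => l (subdiv u j i (l (u i)) (-l (u j)) k) ≠ 0).card ≤ m := by
          have hsub : (S.filter fun k => l (subdiv u j i (l (u i)) (-l (u j)) k) ≠ 0) ⊆
              (S.filter fun k => l (u k) ≠ 0).erase i := by
            intro k hk
            rw [Finset.mem_filter] at hk
            have hkj : k ≠ i := by rintro rfl; exact hk.2 hB0
            rw [subdiv_apply_of_ne _ _ _ _ hkj] at hk
            exact Finset.mem_erase.2 ⟨hkj, Finset.mem_filter.2 hk⟩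
          have := Finset.card_le_card hsub
          rw [Finset.card_erase_of_mem (Finset.mem_filter.2 ⟨hi, hli.ne'⟩)] at this
          omega
        have hcD : ((S.erase i).filter fun k =>
            l (subdiv u i j (-l (u j)) (l (u i)) k) ≠ 0).card ≤ m :=
          (Finset.card_le_card (Finset.filter_subset_filter _ (Finset.erase_subset _ _))).trans hcA
        have hIA := linearIndependent_subdiv hu hij (-l (u j)) hli.ne'
        have hIB := linearIndependent_subdiv hu hij.symm (l (u i)) hs.ne'
        have key : charFn (face u S ∩ {v | 0 < l v}) =
            charFn (face (subdiv u i j (-l (u j)) (l (u i))) S ∩ {v | 0 < l v}) +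
            charFn (face (subdiv u i j (-l (u j)) (l (u i))) (S.erase i) ∩ {v | 0 < l v}) +
            charFn (face (subdiv u j i (l (u i)) (-l (u j))) S ∩ {v | 0 < l v}) := by
          ext v
          have h2 := congrFun hdec v
          simp only [Pi.add_apply, charFn_inter_pos] at h2 ⊢
          by_cases hv : 0 < l v
          · simp only [hv, if_true]
            exact h2
          · simp [hv]
        rw [key]
        exact add_mem (add_mem (ih hIA S hcA) (ih hIA _ hcD)) (ih hIB S hcB)
      · have hneg : ∀ j ∈ S, 0 ≤ l (u j) := by
          intro j hj
          by_contra h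
          exact hneg ⟨j, hj, not_le.1 h⟩
        have : face u S ∩ {v | 0 < l v} = face u S := by
          refine Set.inter_eq_left.2 ?_
          rintro v ⟨a, ha, rfl⟩
          change 0 < l (∑ k, a k • u k)
          rw [map_sum]
          refine Finset.sum_pos' (fun k _ => ?_) ⟨i, Finset.mem_univ _, ?_⟩
          · rw [map_smul, smul_eq_mul]
            by_cases hk : k ∈ S
            · have := ha k
              rw [if_pos hk] at this
              exact mul_nonneg this.le (hneg k hk)
            · have := ha k
              rw [if_neg hk] at this
              simp [this]
          · have := ha i
            rw [if_pos hi] at this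
            rw [map_smul, smul_eq_mul]
            exact mul_pos this hli
        rw [this]
        exact charFn_face_mem hu S
    · have hle : ∀ j ∈ S, l (u j) ≤ 0 := by
        intro j hj
        by_contra h
        exact hpos ⟨j, hj, not_le.1 h⟩
      have : charFn (face u S ∩ {v | 0 < l v}) = 0 := by
        ext v
        refine charFn_of_notMem ?_
        rintro ⟨⟨a, ha, rfl⟩, hv⟩
        have hv : 0 < l (∑ k, a k • u k) := hv
        rw [map_sum] at hv
        refine hv.not_ge (Finset.sum_nonpos fun k _ => ?_)
        rw [map_smul, smul_eq_mul]
        by_cases hk : k ∈ S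
        · have := ha k
          rw [if_pos hk] at this
          exact mul_nonpos_of_nonneg_of_nonpos this.le (hle k hk)
        · have := ha k
          rw [if_neg hk] at this
          simp [this]
      rw [this]
      exact zero_mem _

theorem openCone_eq_face {r : ℕ} (u : Fin r → V) : openCone u = face u Finset.univ := by
  simp [openCone, face]

theorem mul_halfSpace_mem (l : V →ₗ[ℚ] ℚ) {κ : V → ℤ} (hκ : κ ∈ openConeFunctions V) :
    κ * charFn {v | 0 < l v} ∈ openConeFunctions V := by
  induction hκ using AddSubgroup.closure_induction with
  | mem κ h =>
    obtain ⟨r, u, hu, rfl⟩ := h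
    have := charFn_face_halfSpace l _ hu Finset.univ le_rfl
    rw [← openCone_eq_face] at this
    convert! this using 1
    ext v
    by_cases h1 : v ∈ openCone u <;> by_cases h2 : 0 < l v <;> simp [charFn, h1, h2]
  | zero => rw [zero_mul]; exact zero_mem _
  | add κ κ' _ _ h h' => rw [add_mul]; exact add_mem h h'
  | neg κ _ h => rw [neg_mul]; exact neg_mem h

/-- The constant function `1` is a cone function. -/
theorem one_mem_openConeFunctions {n : ℕ} (w : Module.Basis (Fin n) ℚ V) :
    (1 : V → ℤ) ∈ openConeFunctions V := by
  classical
  have key : (1 : V → ℤ) = ∑ s : Fin n → SignType,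
      charFn (face (fun i => if s i = -1 then -w i else w i)
        (Finset.univ.filter fun i => s i ≠ 0)) := by
    ext v
    rw [Finset.sum_apply]
    have hmem : ∀ s : Fin n → SignType,
        v ∈ face (fun i => if s i = -1 then -w i else w i)
          (Finset.univ.filter fun i => s i ≠ 0) ↔ s = fun i => SignType.sign (w.repr v i) := by
      intro s
      constructor
      · rintro ⟨a, ha, rfl⟩
        have h2 : ∑ i, a i • (if s i = -1 then -w i else w i) =
            ∑ i, (if s i = -1 then - a i else a i) • w i := by
          refine Finset.sum_congr rfl fun i _ => ?_
          split_ifs <;> simp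
        ext i
        rw [h2, Module.Basis.repr_sum_self]
        have h3 := ha i
        simp only [Finset.mem_filter, Finset.mem_univ, true_and] at h3
        rcases hsi : s i with _ | _ | _
        · simp [hsi] at h3
          simp [h3]
        · simp [hsi] at h3
          simp [h3]
        · simp [hsi] at h3
          simp [h3]
      · rintro rfl
        refine ⟨fun i => |w.repr v i|, fun k => ?_, ?_⟩
        · simp only [Finset.mem_filter, Finset.mem_univ, true_and, ne_eq, sign_eq_zero_iff]
          split_ifs with h
          · simpa using h
          · exact abs_pos.2 h
        · conv_lhs => rw [← w.sum_repr v]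
          refine Finset.sum_congr rfl fun i _ => ?_
          simp only [sign_eq_neg_one_iff]
          split_ifs with h
          · rw [abs_of_neg h]; simp
          · rw [abs_of_nonneg (not_lt.1 h)]
    simp only [charFn, hmem]
    simp
  rw [key]
  refine sum_mem fun s _ => charFn_face_mem ?_ _
  have := w.linearIndependent.units_smul fun i => if s i = -1 then (-1 : ℚˣ) else 1
  convert! this using 1
  ext i
  by_cases h : s i = -1 <;> simp [h]

end Cones

/-! ### Hill's cocycle -/

section Hill

/-- The iterated Laurent series field `ℚ((ε_1))⋯((ε_n))`, bundled with its field structure. -/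
noncomputable def hillFieldAux : ℕ → Σ K : Type, Field K
  | 0 => ⟨ℚ, inferInstance⟩
  | n + 1 =>
    letI := (hillFieldAux n).2
    ⟨LaurentSeries (hillFieldAux n).1, inferInstance⟩

/-- The iterated Laurent series field `𝔽 = ℚ((ε_1))⋯((ε_n))`. -/
def HillField (n : ℕ) : Type := (hillFieldAux n).1

noncomputable instance (n : ℕ) : Field (HillField n) := (hillFieldAux n).2

/-- `ℚ((ε_1))⋯((ε_{n+1}))` is the field of Laurent series in `ε_{n+1}` over
`ℚ((ε_1))⋯((ε_n))`. -/
noncomputable def toLaurent (n : ℕ) : HillField (n + 1) ≃+* LaurentSeries (HillField n) :=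
  RingEquiv.refl _

/-- The field `ℚ((ε_1))⋯((ε_0))` is `ℚ`. -/
noncomputable def toRat : HillField 0 ≃+* ℚ := RingEquiv.refl _

instance (n : ℕ) : CharZero (HillField n) := by
  induction n with
  | zero => exact charZero_of_injective_ringHom (f := toRat.symm.toRingHom) toRat.symm.injective
  | succ n ih =>
    exact charZero_of_injective_ringHom
      (f := (toLaurent n).symm.toRingHom.comp (HahnSeries.C : HillField n →+* _))
      ((toLaurent n).symm.injective.comp HahnSeries.C_injective)

/-- The coefficient of the leading monomial of an element of `𝔽` (and `0` for the element `0`).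
The leading monomial is the largest one for the order in which every positive power of `ε_1` is
smaller than every positive rational, and every positive power of `ε_j` is smaller than every power
of `ε_{j-1}`: one first minimises the exponent of `ε_n`, then that of `ε_{n-1}`, and so on. -/
noncomputable def leadCoeff : (n : ℕ) → HillField n → ℚ
  | 0, x => toRat x
  | n + 1, x => leadCoeff n (toLaurent n x).leadingCoeff

/-- The order of `𝔽`: an element is positive if its leading coefficient is. -/
def HillPos {n : ℕ} (x : HillField n) : Prop := 0 < leadCoeff n x

/-- The elements `ε_1, …, ε_n` of `𝔽`. -/
noncomputable def eps : (n : ℕ) → Fin n → HillField n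
  | 0, i => i.elim0
  | n + 1, i => Fin.lastCases (motive := fun _ => HillField (n + 1))
      ((toLaurent n).symm (HahnSeries.single 1 1))
      (fun j => (toLaurent n).symm (HahnSeries.C (eps n j))) i

variable {V : Type*} [AddCommGroup V] [Module ℚ V] {n : ℕ}
variable (w : Module.Basis (Fin n) ℚ V)

/-- The vectors `b_i = w_1 + ε_i w_2 + ⋯ + ε_i^{n-1} w_n` of `V_𝔽 = V ⊗ 𝔽`. -/
noncomputable def hillVector (i : Fin n) : HillField n ⊗[ℚ] V :=
  ∑ k : Fin n, (eps n i ^ (k : ℕ)) ⊗ₜ[ℚ] w k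

/-- The vectors `α_i b_i`. -/
noncomputable def hillFamily (α : Fin n → (V ≃ₗ[ℚ] V)) (i : Fin n) : HillField n ⊗[ℚ] V :=
  (α i).toLinearMap.baseChange (HillField n) (hillVector w i)

/-- The sign of `det (α_1 b_1, …, α_n b_n)`. -/
noncomputable def hillSign (α : Fin n → (V ≃ₗ[ℚ] V)) : ℤ :=
  SignType.sign (leadCoeff n ((w.baseChange (HillField n)).det (hillFamily w α)))

/-- `C°(α_1 b_1, …, α_n b_n) ∩ V`. -/
def hillCone (α : Fin n → (V ≃ₗ[ℚ] V)) : Set V :=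
  {v | ∃ c : Fin n → HillField n, (∀ i, HillPos (c i)) ∧
    (1 : HillField n) ⊗ₜ[ℚ] v = ∑ i, c i • hillFamily w α i}

/-- The function `sign det (α_1 b_1, …, α_n b_n) [C°(α_1 b_1, …, α_n b_n)]` on `V`. -/
noncomputable def hillFunction (α : Fin n → (V ≃ₗ[ℚ] V)) : V → ℤ :=
  hillSign w α • charFn (hillCone w α)

theorem leadCoeff_zero (n : ℕ) : leadCoeff n 0 = 0 := by
  induction n with
  | zero => simp [leadCoeff]
  | succ n ih => simp [leadCoeff, ih]

theorem leadCoeff_neg (n : ℕ) (x : HillField n) : leadCoeff n (-x) = -leadCoeff n x := by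
  induction n with
  | zero => simp [leadCoeff]
  | succ n ih => simp [leadCoeff, ih, HahnSeries.leadingCoeff_neg]

theorem leadCoeff_eq_zero {n : ℕ} {x : HillField n} : leadCoeff n x = 0 ↔ x = 0 := by
  induction n with
  | zero => simp [leadCoeff]
  | succ n ih => simp [leadCoeff, ih]

theorem mul_charFn_zero {n : ℕ} (l : V →+ HillField n)
    (h : ∀ l : V →+ HillField n, ∀ κ ∈ openConeFunctions V,
      κ * charFn {v | HillPos (l v)} ∈ openConeFunctions V)
    {κ : V → ℤ} (hκ : κ ∈ openConeFunctions V) :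
    κ * charFn {v | l v = 0} ∈ openConeFunctions V := by
  have : κ * charFn {v | l v = 0} = κ - κ * charFn {v | HillPos (l v)} -
      κ * charFn {v | HillPos ((-l) v)} := by
    ext v
    have h0 : l v = 0 ↔ leadCoeff n (l v) = 0 := leadCoeff_eq_zero.symm
    simp only [charFn, Pi.sub_apply, Pi.mul_apply, Set.mem_ofPred_eq, HillPos,
      AddMonoidHom.neg_apply, leadCoeff_neg, h0, Left.neg_pos_iff]
    rcases lt_trichotomy (leadCoeff n (l v)) 0 with h | h | h
    · simp [h, h.ne, h.not_gt]
    · simp [h]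
    · simp [h, h.ne', h.not_gt]
  rw [this]
  exact sub_mem (sub_mem hκ (h _ _ hκ)) (h _ _ hκ)

theorem leadingCoeff_eq_of_coeff {R : Type*} [Zero R] {x : LaurentSeries R} {g : ℤ}
    (hg : x.coeff g ≠ 0) (h : ∀ k < g, x.coeff k = 0) : x.leadingCoeff = x.coeff g := by
  have hx : x ≠ 0 := by
    rintro rfl
    exact hg rfl
  have h1 : x.order ≤ g := HahnSeries.order_le_of_coeff_ne_zero hg
  have h2 : ¬ x.order < g := fun hlt => HahnSeries.leadingCoeff_ne_zero.2 hx
    (HahnSeries.leadingCoeff_eq.trans (h _ hlt))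
  rw [HahnSeries.leadingCoeff_eq, le_antisymm h1 (not_lt.1 h2)]

/-- The coefficient of `ε_{n+1}^g`. -/
noncomputable def coeffHom (n : ℕ) (g : ℤ) : HillField (n + 1) →+ HillField n where
  toFun x := (toLaurent n x).coeff g
  map_zero' := by simp
  map_add' x y := by simp

theorem map_rat_smul_hill {n : ℕ} (l : V →+ HillField n) (q : ℚ) (v : V) :
    l (q • v) = q • l v := map_rat_smul l q v

/-- The kernel of an additive map to `𝔽`. -/
def kerSubmodule {n : ℕ} (l : V →+ HillField n) : Submodule ℚ V where
  carrier := {v | l v = 0}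
  zero_mem' := map_zero l
  add_mem' {a b} ha hb := by
    change l (a + b) = 0
    rw [map_add, show l a = 0 from ha, show l b = 0 from hb, add_zero]
  smul_mem' q v hv := by
    change l (q • v) = 0
    rw [map_rat_smul_hill, show l v = 0 from hv, smul_zero]

theorem exists_lower_bound {n : ℕ} (l : V →+ HillField (n + 1)) (W : Submodule ℚ V)
    (hW : W.FG) : ∃ b : ℤ, ∀ g < b, ∀ v ∈ W, coeffHom n g (l v) = 0 := by
  induction W, hW using Submodule.fg_induction with
  | singleton x =>
    refine ⟨(toLaurent n (l x)).order, fun g hg v hv => ?_⟩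
    have hx : x ∈ kerSubmodule ((coeffHom n g).comp l) :=
      HahnSeries.coeff_eq_zero_of_lt_order hg
    exact (Submodule.span_singleton_le_iff_mem _ _).2 hx hv
  | sup N₁ N₂ _ _ h₁ h₂ =>
    obtain ⟨b₁, h₁⟩ := h₁
    obtain ⟨b₂, h₂⟩ := h₂
    refine ⟨min b₁ b₂, fun g hg v hv => ?_⟩
    have : N₁ ⊔ N₂ ≤ kerSubmodule ((coeffHom n g).comp l) :=
      sup_le (fun v hv => h₁ g (hg.trans_le (min_le_left _ _)) v hv)
        (fun v hv => h₂ g (hg.trans_le (min_le_right _ _)) v hv)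
    exact this hv

theorem mul_hillPos_mem [FiniteDimensional ℚ V] {n : ℕ} (l : V →+ HillField n) (κ : V → ℤ)
    (hκ : κ ∈ openConeFunctions V) :
    κ * charFn {v | HillPos (l v)} ∈ openConeFunctions V := by
  induction n generalizing κ with
  | zero =>
    exact mul_halfSpace_mem (toRat.toAddMonoidHom.comp l).toRatLinearMap hκ
  | succ n ih =>
    suffices H : ∀ d : ℕ, ∀ W : Submodule ℚ V, Module.finrank ℚ W ≤ d →
        ∀ κ ∈ openConeFunctions V, (∀ v, κ v ≠ 0 → v ∈ W) →
        κ * charFn {v | HillPos (l v)} ∈ openConeFunctions V from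
      H _ ⊤ le_rfl κ hκ fun _ _ => Submodule.mem_top
    clear hκ κ
    intro d
    induction d with
    | zero =>
      intro W hW κ hκ hs
      have hW0 : W = ⊥ := Submodule.finrank_eq_zero.1 (Nat.le_zero.1 hW)
      have : κ * charFn {v | HillPos (l v)} = 0 := by
        ext v
        by_cases hv : κ v = 0
        · simp [hv]
        · have h0 : v = 0 := by simpa [hW0] using hs v hv
          have : ¬ HillPos (l v) := by simp [HillPos, h0, leadCoeff_zero]
          simp [charFn, this]
      rw [this]
      exact zero_mem _
    | succ d ihd =>
      intro W hW κ hκ hs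
      by_cases hl : ∀ v ∈ W, l v = 0
      · have : κ * charFn {v | HillPos (l v)} = 0 := by
          ext v
          by_cases hv : κ v = 0
          · simp [hv]
          · have : ¬ HillPos (l v) := by simp [HillPos, hl v (hs v hv), leadCoeff_zero]
            simp [charFn, this]
        rw [this]
        exact zero_mem _
      push Not at hl
      obtain ⟨v₀, hv₀, hlv₀⟩ := hl
      obtain ⟨b, hb⟩ := exists_lower_bound l W (IsNoetherian.noetherian W)
      obtain ⟨g, ⟨v₁, hv₁, hg⟩, hmin⟩ := Int.exists_least_of_bdd
        (P := fun g => ∃ v ∈ W, coeffHom n g (l v) ≠ 0)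
        ⟨b, fun z ⟨v, hv, hz⟩ => by
          by_contra h
          exact hz (hb z (not_le.1 h) v hv)⟩
        (by
          by_contra hcon
          push Not at hcon
          apply hlv₀
          apply (toLaurent n).injective
          ext z
          simpa [coeffHom] using hcon z v₀ hv₀)
      set l' : V →+ HillField n := (coeffHom n g).comp l with hl'
      have hlt : ∀ k < g, ∀ v ∈ W, coeffHom n k (l v) = 0 := by
        intro k hk v hv
        by_contra h
        exact (hmin k ⟨v, hv, h⟩).not_gt hk
      have hW' : W ⊓ kerSubmodule l' < W := by
        refine lt_of_le_of_ne inf_le_left fun h => hg ?_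
        have : v₁ ∈ W ⊓ kerSubmodule l' := h.symm ▸ hv₁
        exact this.2
      have hfr := Submodule.finrank_lt_finrank_of_lt hW'
      have key : κ * charFn {v | HillPos (l v)} = κ * charFn {v | HillPos (l' v)} +
          (κ * charFn {v | l' v = 0}) * charFn {v | HillPos (l v)} := by
        ext v
        by_cases hv : κ v = 0
        · simp [hv]
        · have hvW := hs v hv
          by_cases h0 : l' v = 0
          · have : ¬ HillPos (l' v) := by simp [HillPos, h0, leadCoeff_zero]
            have e1 : charFn {v | HillPos (l' v)} v = 0 := charFn_of_notMem this
            have e2 : charFn {v | l' v = 0} v = 1 := charFn_of_mem h0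
            simp only [Pi.add_apply, Pi.mul_apply, e1, e2, mul_zero, mul_one, zero_add]
          · have : HillPos (l v) ↔ HillPos (l' v) := by
              have h2 : (toLaurent n (l v)).leadingCoeff = (toLaurent n (l v)).coeff g :=
                leadingCoeff_eq_of_coeff h0 fun k hk => hlt k hk v hvW
              rw [HillPos, leadCoeff, h2]
              rfl
            have e1 : charFn {v | HillPos (l v)} v = charFn {v | HillPos (l' v)} v := by
              by_cases h : HillPos (l v)
              · rw [charFn_of_mem (s := {v | HillPos (l v)}) h,
                  charFn_of_mem (s := {v | HillPos (l' v)}) (this.1 h)]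
              · rw [charFn_of_notMem (s := {v | HillPos (l v)}) h,
                  charFn_of_notMem (s := {v | HillPos (l' v)}) (mt this.2 h)]
            have e2 : charFn {v | l' v = 0} v = 0 := charFn_of_notMem h0
            simp only [Pi.add_apply, Pi.mul_apply, e1, e2, mul_zero, zero_mul, add_zero]
      rw [key]
      refine add_mem (ih l' κ hκ) (ihd (W ⊓ kerSubmodule l') (by omega) _
        (mul_charFn_zero l' (fun l κ h => ih l κ h) hκ) fun v hv => ⟨hs v ?_, ?_⟩)
      · intro h
        exact hv (by simp [h])
      · by_contra h
        have h : ¬ l' v = 0 := h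
        exact hv (by simp [charFn, h])

theorem hillFunction_mem_openConeFunctions (α : Fin n → (V ≃ₗ[ℚ] V)) :
    hillFunction w α ∈ openConeFunctions V := by
  have : FiniteDimensional ℚ V := Module.Basis.finiteDimensional_of_finite w
  by_cases hdet : (w.baseChange (HillField n)).det (hillFamily w α) = 0
  · have : hillFunction w α = 0 := by
      simp [hillFunction, hillSign, hdet, leadCoeff_zero]
    rw [this]
    exact zero_mem _
  obtain ⟨hli, hsp⟩ := (Module.Basis.is_basis_iff_det (w.baseChange (HillField n))).2
    (isUnit_iff_ne_zero.2 hdet)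
  let B := Module.Basis.mk hli hsp.ge
  have hB : ∀ i, B i = hillFamily w α i := fun i => by simp [B]
  let ι : V →+ HillField n ⊗[ℚ] V := (TensorProduct.mk ℚ (HillField n) V 1).toAddMonoidHom
  let l : Fin n → V →+ HillField n := fun i => (B.coord i).toAddMonoidHom.comp ι
  have hcone : charFn (hillCone w α) = ∏ i, charFn {v : V | HillPos (l i v)} := by
    ext v
    have hiff : v ∈ hillCone w α ↔ ∀ i, HillPos (l i v) := by
      constructor
      · rintro ⟨c, hc, hv⟩ i
        have : l i v = c i := by
          change B.repr ((1 : HillField n) ⊗ₜ[ℚ] v) i = c i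
          simp only [hv, ← hB]
          rw [Module.Basis.repr_sum_self]
        rw [this]
        exact hc i
      · intro h
        refine ⟨fun i => l i v, h, ?_⟩
        simp only [← hB]
        exact (B.sum_repr _).symm
    rw [Finset.prod_apply]
    by_cases h : ∀ i, HillPos (l i v)
    · rw [charFn_of_mem (hiff.2 h), Finset.prod_eq_one]
      exact fun i _ => charFn_of_mem (s := {v | HillPos (l i v)}) (h i)
    · rw [charFn_of_notMem (mt hiff.1 h)]
      push Not at h
      obtain ⟨i, hi⟩ := h
      exact (Finset.prod_eq_zero (Finset.mem_univ i)
        (charFn_of_notMem (s := {v | HillPos (l i v)}) hi)).symm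
  have hprod : ∀ s : Finset (Fin n), ∏ i ∈ s, charFn {v : V | HillPos (l i v)} ∈
      openConeFunctions V := by
    intro s
    induction s using Finset.induction_on with
    | empty => simpa using one_mem_openConeFunctions w
    | insert i s hi ih =>
      rw [Finset.prod_insert hi, mul_comm]
      exact mul_hillPos_mem _ _ ih
  rw [hillFunction, hcone]
  exact zsmul_mem (hprod _) _

/-- Hill's cocycle `σ_Hill : GL(V)^n → K_V`. -/
noncomputable def hillCocycle (α : Fin n → (V ≃ₗ[ℚ] V)) : coneFunctions V :=
  ⟨hillFunction w α, openConeFunctions_le (hillFunction_mem_openConeFunctions w α)⟩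

end Hill

/-! ### From cone functions to pseudo-measures -/

section ConePseudoMeasures

variable (p : ℕ) [Fact p.Prime] {V : Type*} [AddCommGroup V] [Module ℚ V]
variable (L : Submodule ℤ V)

/-- Multiplication of a formal sum `∑ g(v) δ_v`, `v ∈ V ∩ L_p`, by `δ_0 - δ_u`. -/
noncomputable def formalDiff {p : ℕ} [Fact p.Prime] {L : Submodule ℤ V} (u : globalPoints p L)
    (g : globalPoints p L → ℤ) : globalPoints p L → ℤ :=
  fun v => g v - g (v - u)

/-- Multiplication of a formal sum by the product of the `δ_0 - δ_u`, `u` in a list. -/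
noncomputable def formalDiffs {p : ℕ} [Fact p.Prime] {L : Submodule ℤ V} (us : List (globalPoints p L))
    (g : globalPoints p L → ℤ) : globalPoints p L → ℤ :=
  us.foldr formalDiff g

section FormalDiff

variable {p L}

theorem formalDiff_comm (u v : globalPoints p L) (g : globalPoints p L → ℤ) :
    formalDiff u (formalDiff v g) = formalDiff v (formalDiff u g) := by
  ext x
  simp only [formalDiff, sub_right_comm x u v]
  ring

theorem formalDiff_add (u : globalPoints p L) (g g' : globalPoints p L → ℤ) :
    formalDiff u (g + g') = formalDiff u g + formalDiff u g' := by
  ext x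
  simp only [formalDiff, Pi.add_apply]
  ring

theorem formalDiffs_add (us : List (globalPoints p L)) (g g' : globalPoints p L → ℤ) :
    formalDiffs us (g + g') = formalDiffs us g + formalDiffs us g' := by
  induction us with
  | nil => rfl
  | cons u us ih => exact (congrArg (formalDiff u) ih).trans (formalDiff_add _ _ _)

theorem formalDiffs_append (us vs : List (globalPoints p L)) (g : globalPoints p L → ℤ) :
    formalDiffs (us ++ vs) g = formalDiffs us (formalDiffs vs g) :=
  List.foldr_append

theorem formalDiff_formalDiffs (u : globalPoints p L) (us : List (globalPoints p L))
    (g : globalPoints p L → ℤ) :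
    formalDiff u (formalDiffs us g) = formalDiffs us (formalDiff u g) := by
  induction us with
  | nil => rfl
  | cons v us ih =>
    change formalDiff u (formalDiff v (formalDiffs us g)) = formalDiff v (formalDiffs us _)
    rw [formalDiff_comm, ih]

theorem formalDiffs_comm (us vs : List (globalPoints p L)) (g : globalPoints p L → ℤ) :
    formalDiffs us (formalDiffs vs g) = formalDiffs vs (formalDiffs us g) := by
  induction us with
  | nil => rfl
  | cons u us ih =>
    change formalDiff u (formalDiffs us (formalDiffs vs g)) =
      formalDiffs vs (formalDiff u (formalDiffs us g))
    rw [ih, formalDiff_formalDiffs]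

theorem formalDiffs_neg (us : List (globalPoints p L)) (g : globalPoints p L → ℤ) :
    formalDiffs us (-g) = -formalDiffs us g := by
  induction us with
  | nil => rfl
  | cons u us ih =>
    refine (congrArg (formalDiff u) ih).trans ?_
    ext x
    change -formalDiffs us g x - -formalDiffs us g (x - u) =
      -(formalDiffs us g x - formalDiffs us g (x - u))
    ring

end FormalDiff

variable [L.IsLattice ℚ]

/-- The Dirac measure `δ_v` on `L_p`, for `v ∈ V ∩ L_p`. -/
noncomputable def diracAt (v : globalPoints p L) : PadicMeasure p (localLattice p L) :=
  PadicMeasure.dirac p ⟨toLocal p v.1, v.2⟩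

/-- The measure `∑ h(v) δ_v` attached to a finite formal sum. -/
noncomputable def finiteMeasure (h : globalPoints p L →₀ ℤ) :
    PadicMeasure p (localLattice p L) :=
  h.sum fun v k => k • diracAt p L v

/-- The formal sum `∑ g(v) δ_v`, `v ∈ V ∩ L_p`, represents the pseudo-measure `μ`: after
multiplication by finitely many factors `δ_0 - δ_u`, `u ≠ 0`, the formal sum becomes finite, and
multiplying `μ` by the same factors gives the measure attached to this finite sum. -/
def Represents (g : globalPoints p L → ℤ) (μ : PseudoMeasure p (localLattice p L)) : Prop :=
  ∃ us : List (globalPoints p L), (∀ u ∈ us, u ≠ 0) ∧ ∃ h : globalPoints p L →₀ ℤ,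
    formalDiffs us g = h ∧
    algebraMap (PadicMeasure p (localLattice p L)) (PseudoMeasure p (localLattice p L))
      (us.map fun u => PadicMeasure.dirac p 0 - diracAt p L u).prod * μ =
    algebraMap (PadicMeasure p (localLattice p L)) (PseudoMeasure p (localLattice p L))
      (finiteMeasure p L h)

theorem toLocal_injective (p : ℕ) [Fact p.Prime] {V : Type*} [AddCommGroup V] [Module ℚ V]
    (L : Submodule ℤ V) [L.IsLattice ℚ] : Function.Injective (toLocal p : V →+ LocalSpace p V) := by
  rw [injective_iff_map_eq_zero]
  intro v hv
  apply (latticeBasis L).repr.injective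
  ext i
  have := localBasis_repr_toLocal p L v i
  rw [hv] at this
  simpa using this.symm

section Represents

variable {p L}

theorem finiteMeasure_add (h h' : globalPoints p L →₀ ℤ) :
    finiteMeasure p L (h + h') = finiteMeasure p L h + finiteMeasure p L h' :=
  Finsupp.sum_add_index' (fun _ => zero_smul _ _) (fun _ _ _ => add_smul _ _ _)

theorem finiteMeasure_neg (h : globalPoints p L →₀ ℤ) :
    finiteMeasure p L (-h) = -finiteMeasure p L h := by
  rw [eq_neg_iff_add_eq_zero, ← finiteMeasure_add, neg_add_cancel]
  rfl

theorem finiteMeasure_single (v : globalPoints p L) (k : ℤ) :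
    finiteMeasure p L (Finsupp.single v k) = k • diracAt p L v :=
  Finsupp.sum_single_index (zero_smul _ _)

theorem diracAt_add (u v : globalPoints p L) :
    diracAt p L (u + v) = diracAt p L u * diracAt p L v := by
  rw [diracAt, diracAt, diracAt, PadicMeasure.dirac_mul_dirac]
  congr 1
  ext
  exact map_add (toLocal p) _ _

/-- Translation of finite formal sums. -/
noncomputable def shift (u : globalPoints p L) (h : globalPoints p L →₀ ℤ) :
    globalPoints p L →₀ ℤ :=
  h.mapDomain fun v => v + u

theorem shift_apply (u : globalPoints p L) (h : globalPoints p L →₀ ℤ) (v : globalPoints p L) :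
    shift u h v = h (v - u) := by
  have := Finsupp.mapDomain_apply (f := fun v : globalPoints p L => v + u)
    (add_left_injective u) h (v - u)
  simpa [shift] using this

theorem finiteMeasure_shift (u : globalPoints p L) (h : globalPoints p L →₀ ℤ) :
    finiteMeasure p L (shift u h) = diracAt p L u * finiteMeasure p L h := by
  induction h using Finsupp.induction_linear with
  | zero =>
    have h0 : finiteMeasure p L 0 = 0 := rfl
    have h1 : shift u (0 : globalPoints p L →₀ ℤ) = 0 := rfl
    rw [h1, h0, mul_zero]
  | add f g hf hg =>
    rw [shift, Finsupp.mapDomain_add, finiteMeasure_add, finiteMeasure_add, mul_add, ← hf, ← hg]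
    rfl
  | single v k =>
    rw [shift, Finsupp.mapDomain_single, finiteMeasure_single, finiteMeasure_single, diracAt_add,
      mul_smul_comm, mul_comm]

theorem exists_formalDiffs_finsupp (us : List (globalPoints p L)) (h : globalPoints p L →₀ ℤ) :
    ∃ h' : globalPoints p L →₀ ℤ, formalDiffs us h = h' ∧ finiteMeasure p L h' =
      (us.map fun u => PadicMeasure.dirac p 0 - diracAt p L u).prod * finiteMeasure p L h := by
  induction us with
  | nil => exact ⟨h, rfl, by simp⟩
  | cons u us ih =>
    obtain ⟨h', h1, h2⟩ := ih
    refine ⟨h' + -shift u h', ?_, ?_⟩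
    · refine (congrArg (formalDiff u) h1).trans ?_
      ext v
      simp [formalDiff, shift_apply, sub_eq_add_neg]
    · rw [finiteMeasure_add, finiteMeasure_neg, finiteMeasure_shift, h2, List.map_cons,
        List.prod_cons, ← PadicMeasure.one_def]
      ring

theorem isUnit_prod (us : List (globalPoints p L)) (hus : ∀ u ∈ us, u ≠ 0) :
    IsUnit (algebraMap (PadicMeasure p (localLattice p L)) (PseudoMeasure p (localLattice p L))
      (us.map fun u => PadicMeasure.dirac p 0 - diracAt p L u).prod) := by
  refine IsLocalization.map_units (M := PadicMeasure.denominators p (localLattice p L)) _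
    ⟨_, Submonoid.list_prod_mem _ ?_⟩
  intro x hx
  obtain ⟨u, hu, rfl⟩ := List.mem_map.1 hx
  refine Submonoid.subset_closure ⟨_, ?_, rfl⟩
  intro h
  apply hus u hu
  have h2 : toLocal p u.1 = 0 := congrArg Subtype.val h
  ext
  exact toLocal_injective p L (h2.trans (map_zero _).symm)

theorem Represents.unique {g : globalPoints p L → ℤ} {μ ν : PseudoMeasure p (localLattice p L)}
    (hμ : Represents p L g μ) (hν : Represents p L g ν) : μ = ν := by
  obtain ⟨us, hus, h, h1, h2⟩ := hμ
  obtain ⟨vs, hvs, k, k1, k2⟩ := hν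
  obtain ⟨a, a1, a2⟩ := exists_formalDiffs_finsupp vs h
  obtain ⟨b, b1, b2⟩ := exists_formalDiffs_finsupp us k
  have hab : a = b := by
    apply DFunLike.coe_injective
    rw [← a1, ← b1, ← h1, ← k1, formalDiffs_comm]
  rw [hab] at a2
  have h3 := a2.symm.trans b2
  have h4 := congrArg (algebraMap (PadicMeasure p (localLattice p L))
    (PseudoMeasure p (localLattice p L))) h3
  rw [map_mul, map_mul, ← h2, ← k2, mul_left_comm] at h4
  exact (isUnit_prod vs hvs).mul_left_cancel ((isUnit_prod us hus).mul_left_cancel h4)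

theorem Represents.add {g g' : globalPoints p L → ℤ} {μ ν : PseudoMeasure p (localLattice p L)}
    (hμ : Represents p L g μ) (hν : Represents p L g' ν) : Represents p L (g + g') (μ + ν) := by
  obtain ⟨us, hus, h, h1, h2⟩ := hμ
  obtain ⟨vs, hvs, k, k1, k2⟩ := hν
  obtain ⟨a, a1, a2⟩ := exists_formalDiffs_finsupp vs h
  obtain ⟨b, b1, b2⟩ := exists_formalDiffs_finsupp us k
  refine ⟨us ++ vs, fun u hu => (List.mem_append.1 hu).elim (hus u) (hvs u), a + b, ?_, ?_⟩
  · rw [formalDiffs_add, formalDiffs_append, formalDiffs_append, k1, formalDiffs_comm, h1, a1, b1]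
    rfl
  · rw [finiteMeasure_add, a2, b2, List.map_append, List.prod_append, map_add, map_mul, map_mul,
      map_mul, ← h2, ← k2]
    ring

theorem Represents.neg {g : globalPoints p L → ℤ} {μ : PseudoMeasure p (localLattice p L)}
    (hμ : Represents p L g μ) : Represents p L (-g) (-μ) := by
  obtain ⟨us, hus, h, h1, h2⟩ := hμ
  refine ⟨us, hus, -h, ?_, ?_⟩
  · rw [formalDiffs_neg, h1]
    rfl
  · rw [finiteMeasure_neg, map_neg, mul_neg, h2]

theorem represents_finsupp (h : globalPoints p L →₀ ℤ) :
    Represents p L h (algebraMap _ _ (finiteMeasure p L h)) :=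
  ⟨[], by simp, h, rfl, by simp⟩

theorem exists_represents_of_formalDiffs {g : globalPoints p L → ℤ} (us : List (globalPoints p L))
    (hus : ∀ u ∈ us, u ≠ 0) (h : (Function.support (formalDiffs us g)).Finite) :
    ∃ μ, Represents p L g μ := by
  refine ⟨↑(isUnit_prod us hus).unit⁻¹ * algebraMap _ _ (finiteMeasure p L
    (Finsupp.ofSupportFinite _ h)), us, hus, Finsupp.ofSupportFinite _ h, rfl, ?_⟩
  rw [← mul_assoc, IsUnit.mul_val_inv, one_mul]

end Represents

/-! #### Open cones -/

/-- The half-open cell `{∑ a_i u_i : a_i > 0, and a_i ≤ 1 for i ∈ s}`. -/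
def cell {r : ℕ} (u : Fin r → V) (s : Finset (Fin r)) : Set V :=
  {v | ∃ a : Fin r → ℚ, (∀ i, 0 < a i ∧ (i ∈ s → a i ≤ 1)) ∧ v = ∑ i, a i • u i}

theorem mem_cell_iff {r : ℕ} {u : Fin r → V} (hu : LinearIndependent ℚ u) (s : Finset (Fin r))
    (a : Fin r → ℚ) :
    ∑ i, a i • u i ∈ cell u s ↔ ∀ i, 0 < a i ∧ (i ∈ s → a i ≤ 1) := by
  constructor
  · rintro ⟨b, hb, h⟩
    have : a = b := by
      have h2 : ∑ i, (a i - b i) • u i = 0 := by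
        simp only [sub_smul, Finset.sum_sub_distrib, h, sub_self]
      ext i
      exact sub_eq_zero.1 (Fintype.linearIndependent_iff.1 hu _ h2 i)
    rwa [this]
  · intro h
    exact ⟨a, h, rfl⟩

theorem openCone_eq_cell {r : ℕ} (u : Fin r → V) : openCone u = cell u ∅ := by
  simp [openCone, cell]

theorem charFn_cell_sub {r : ℕ} {u : Fin r → V} (hu : LinearIndependent ℚ u)
    {s : Finset (Fin r)} {j : Fin r} (hj : j ∉ s) (v : V) :
    charFn (cell u s) v - charFn (cell u s) (v - u j) = charFn (cell u (insert j s)) v := by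
  by_cases hv : ∃ a : Fin r → ℚ, v = ∑ i, a i • u i
  · obtain ⟨a, rfl⟩ := hv
    have e : ∑ i, a i • u i - u j = ∑ i, (a - Pi.single j 1 : Fin r → ℚ) i • u i := by
      simp only [Pi.sub_apply, sub_smul, Finset.sum_sub_distrib, Pi.single_apply, ite_smul,
        one_smul, zero_smul, Finset.sum_ite_eq', Finset.mem_univ, if_true]
    have e1 := mem_cell_iff hu s a
    have e2 := mem_cell_iff hu s (a - Pi.single j 1)
    have e3 := mem_cell_iff hu (insert j s) a
    rw [← e] at e2
    have i2 : (∑ i, a i • u i - u j ∈ cell u s) ↔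
        (∑ i, a i • u i ∈ cell u s) ∧ 1 < a j := by
      rw [e1, e2]
      constructor
      · intro H
        have hj1 := (H j).1
        simp only [Pi.sub_apply, Pi.single_eq_same, sub_pos] at hj1
        refine ⟨fun i => ?_, hj1⟩
        by_cases hij : i = j
        · subst hij
          exact ⟨by linarith, fun h => absurd h hj⟩
        · simpa [hij] using H i
      · rintro ⟨H, h1⟩ i
        by_cases hij : i = j
        · subst hij
          exact ⟨by simpa using h1, fun h => absurd h hj⟩
        · simpa [hij] using H i
    have i3 : (∑ i, a i • u i ∈ cell u (insert j s)) ↔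
        (∑ i, a i • u i ∈ cell u s) ∧ a j ≤ 1 := by
      rw [e1, e3]
      constructor
      · intro H
        exact ⟨fun i => ⟨(H i).1, fun h => (H i).2 (Finset.mem_insert_of_mem h)⟩,
          (H j).2 (Finset.mem_insert_self _ _)⟩
      · rintro ⟨H, h1⟩ i
        refine ⟨(H i).1, fun h => ?_⟩
        rcases Finset.mem_insert.1 h with rfl | h
        · exact h1
        · exact (H i).2 h
    by_cases h : ∑ i, a i • u i ∈ cell u s
    · by_cases h1 : a j ≤ 1
      · rw [charFn_of_mem h, charFn_of_notMem fun h => h1.not_gt (i2.1 h).2,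
          charFn_of_mem (i3.2 ⟨h, h1⟩), sub_zero]
      · rw [charFn_of_mem h, charFn_of_mem (i2.2 ⟨h, not_le.1 h1⟩),
          charFn_of_notMem fun h => h1 (i3.1 h).2, sub_self]
    · rw [charFn_of_notMem h, charFn_of_notMem fun h' => h (i2.1 h').1,
        charFn_of_notMem fun h' => h (i3.1 h').1, sub_zero]
  · have h1 : v ∉ cell u s := fun ⟨a, _, h⟩ => hv ⟨a, h⟩
    have h2 : v ∉ cell u (insert j s) := fun ⟨a, _, h⟩ => hv ⟨a, h⟩
    have h3 : v - u j ∉ cell u s := by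
      rintro ⟨a, _, h⟩
      apply hv
      refine ⟨a + Pi.single j 1, ?_⟩
      simp only [Pi.add_apply, add_smul, Finset.sum_add_distrib, Pi.single_apply, ite_smul,
        one_smul, zero_smul, Finset.sum_ite_eq', Finset.mem_univ, if_true]
      rw [← h, sub_add_cancel]
    rw [charFn_of_notMem h1, charFn_of_notMem h2, charFn_of_notMem h3, sub_zero]

theorem openCone_smul {r : ℕ} (u : Fin r → V) (c : Fin r → ℚ) (hc : ∀ i, 0 < c i) :
    openCone (fun i => c i • u i) = openCone u := by
  ext v
  constructor
  · rintro ⟨a, ha, rfl⟩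
    exact ⟨fun i => a i * c i, fun i => mul_pos (ha i) (hc i), by simp only [mul_smul]⟩
  · rintro ⟨a, ha, rfl⟩
    refine ⟨fun i => a i / c i, fun i => div_pos (ha i) (hc i), ?_⟩
    refine Finset.sum_congr rfl fun i _ => ?_
    rw [← mul_smul, div_mul_cancel₀ _ (hc i).ne']

/-- The coefficients of the formal sum `∑ (f' ⊗ [L_p])(v) κ(v) δ_v`. -/
noncomputable def coneSum (f' : V → ℤ) (κ : V → ℤ) : globalPoints p L → ℤ :=
  fun v => extendTest p L f' v.1 * κ v.1

theorem finite_cell_inter {N : ℕ} (hN : 0 < N) {r : ℕ} (u : Fin r → V) :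
    {v : V | v ∈ cell u Finset.univ ∧ N • v ∈ L}.Finite := by
  let C : LatIndex L → ℚ := fun i => ∑ k, |(latticeBasis L).repr (N • u k) i|
  refine Set.Finite.of_finite_image (f := fun v => fun i => (latticeBasis L).repr (N • v) i) ?_ ?_
  · refine (Set.Finite.pi' (t := fun i =>
      ((fun k : ℤ => (k : ℚ)) '' Set.Icc (-⌈C i⌉) ⌈C i⌉)) fun i =>
        (Set.finite_Icc _ _).image _).subset ?_
    rintro _ ⟨v, ⟨⟨a, ha, hv⟩, hNv⟩, rfl⟩ i
    obtain ⟨k, hk⟩ := (mem_lattice_iff L _).1 hNv i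
    refine ⟨k, ?_, hk.symm⟩
    have hle : |(k : ℚ)| ≤ C i := by
      rw [← hk, hv, Finset.smul_sum, map_sum, Finsupp.finsetSum_apply]
      refine (Finset.abs_sum_le_sum_abs _ _).trans (Finset.sum_le_sum fun j _ => ?_)
      rw [smul_comm, map_smul, Finsupp.smul_apply, smul_eq_mul, abs_mul,
        abs_of_pos (ha j).1]
      exact mul_le_of_le_one_left (abs_nonneg _) ((ha j).2 (Finset.mem_univ _))
    have h2 := abs_le.1 (hle.trans (Int.le_ceil (C i)))
    constructor
    · exact_mod_cast h2.1
    · exact_mod_cast h2.2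
  · intro v _ v' _ h
    have h2 : N • v = N • v' := (latticeBasis L).repr.injective (Finsupp.ext fun i => congrFun h i)
    have hN' : (N : ℚ) ≠ 0 := by exact_mod_cast hN.ne'
    rw [← Nat.cast_smul_eq_nsmul ℚ, ← Nat.cast_smul_eq_nsmul ℚ] at h2
    exact smul_right_injective V hN' h2

theorem exists_represents_openCone {f' : V → ℤ} (hf : f' ∈ testFunctionsAway p L) {r : ℕ}
    {u : Fin r → V} (hu : LinearIndependent ℚ u) :
    ∃ μ, Represents p L (coneSum p L f' (charFn (openCone u))) μ := by
  classical
  obtain ⟨N, hN, hper, hsupp⟩ := exists_period p L hf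
  choose k hk hkL using fun i => exists_nsmul_mem L (u i)
  set u' : Fin r → V := fun i => N • (k i • u i) with hu'
  have hcast : u' = fun i => ((N * k i : ℕ) : ℚ) • u i := by
    ext i
    rw [hu', Nat.cast_smul_eq_nsmul, mul_smul]
  have hpos : ∀ i, (0 : ℚ) < ((N * k i : ℕ) : ℚ) := fun i => by
    exact_mod_cast Nat.mul_pos hN (hk i)
  have hcone : openCone u = openCone u' := by rw [hcast, openCone_smul u _ hpos]
  have hli : LinearIndependent ℚ u' := by
    have := hu.units_smul fun i => Units.mk0 _ (hpos i).ne'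
    rw [hcast]
    exact this
  have hu'L : ∀ i, u' i ∈ L := fun i => L.smul_of_tower_mem N (hkL i)
  let x : Fin r → globalPoints p L := fun i => ⟨u' i, toLocal_mem p (hu'L i)⟩
  have hperF : ∀ v i, extendTest p L f' (v - u' i) = extendTest p L f' v := by
    intro v i
    have h1 := hper (v - u' i) _ (hkL i)
    rw [show N • (k i • u i) = u' i from rfl, sub_add_cancel] at h1
    have h2 : toLocal p (v - u' i) ∈ localLattice p L ↔ toLocal p v ∈ localLattice p L := by
      rw [map_sub]
      exact (localLattice p L).sub_mem_iff_left (toLocal_mem p (hu'L i))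
    rw [extendTest, extendTest, h1]
    congr 1
    by_cases h3 : toLocal p v ∈ localLattice p L
    · rw [latticeIndicator, latticeIndicator, if_pos h3, if_pos (h2.2 h3)]
    · rw [latticeIndicator, latticeIndicator, if_neg h3, if_neg (mt h2.1 h3)]
  have key : ∀ s : Finset (Fin r), ∃ us : List (globalPoints p L), (∀ u ∈ us, u ≠ 0) ∧
      formalDiffs us (coneSum p L f' (charFn (openCone u))) =
        coneSum p L f' (charFn (cell u' s)) := by
    intro s
    induction s using Finset.induction_on with
    | empty => exact ⟨[], by simp, by rw [hcone, openCone_eq_cell]; rfl⟩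
    | insert j s hj ih =>
      obtain ⟨us, hus, h⟩ := ih
      refine ⟨x j :: us, ?_, ?_⟩
      · intro y hy
        rcases List.mem_cons.1 hy with rfl | hy
        · intro h0
          exact hli.ne_zero j (congrArg Subtype.val h0)
        · exact hus y hy
      · refine (congrArg (formalDiff (x j)) h).trans ?_
        ext v
        change extendTest p L f' v.1 * _ - extendTest p L f' (v.1 - u' j) * _ = _
        rw [hperF, ← mul_sub]
        congr 1
        exact charFn_cell_sub hli hj v.1
  obtain ⟨us, hus, h⟩ := key Finset.univ
  refine exists_represents_of_formalDiffs us hus ?_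
  rw [h]
  refine Set.Finite.of_finite_image (f := Subtype.val) ?_ Subtype.val_injective.injOn
  refine (finite_cell_inter L hN u').subset ?_
  rintro _ ⟨v, hv, rfl⟩
  have hv : extendTest p L f' v.1 * charFn (cell u' Finset.univ) v.1 ≠ 0 := hv
  refine ⟨?_, ?_⟩
  · by_contra h
    rw [charFn_of_notMem h, mul_zero] at hv
    exact hv rfl
  · refine hsupp v.1 ?_ v.2
    intro h
    apply hv
    rw [extendTest, h, zero_mul, zero_mul]

theorem exists_represents {f' : V → ℤ} (hf : f' ∈ testFunctionsAway p L) {κ : V → ℤ}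
    (hκ : κ ∈ coneFunctions V) : ∃ μ, Represents p L (coneSum p L f' κ) μ := by
  obtain ⟨κ₀, hκ₀, hne⟩ := hκ
  have h1 : ∃ μ, Represents p L (coneSum p L f' κ₀) μ := by
    clear hne
    induction hκ₀ using AddSubgroup.closure_induction with
    | mem κ h =>
      obtain ⟨r, u, hu, rfl⟩ := h
      exact exists_represents_openCone p L hf hu
    | zero =>
      refine ⟨algebraMap _ _ (finiteMeasure p L 0), ?_⟩
      have h0 : coneSum p L f' 0 = ⇑(0 : globalPoints p L →₀ ℤ) := by
        ext v
        simp [coneSum]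
      rw [h0]
      exact represents_finsupp 0
    | add κ κ' _ _ h h' =>
      obtain ⟨μ, h⟩ := h
      obtain ⟨ν, h'⟩ := h'
      refine ⟨μ + ν, ?_⟩
      have h0 : coneSum p L f' (κ + κ') = coneSum p L f' κ + coneSum p L f' κ' := by
        ext v
        simp [coneSum, mul_add]
      rw [h0]
      exact h.add h'
    | neg κ _ h =>
      obtain ⟨μ, h⟩ := h
      refine ⟨-μ, ?_⟩
      have h0 : coneSum p L f' (-κ) = -coneSum p L f' κ := by
        ext v
        simp [coneSum]
      rw [h0]
      exact h.neg
  obtain ⟨μ, hμ⟩ := h1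
  let h : globalPoints p L →₀ ℤ := Finsupp.single 0 (extendTest p L f' 0 * (κ 0 - κ₀ 0))
  refine ⟨μ + algebraMap _ _ (finiteMeasure p L h), ?_⟩
  have h0 : coneSum p L f' κ = coneSum p L f' κ₀ + ⇑h := by
    ext v
    by_cases hv : v = 0
    · subst hv
      simp [coneSum, h]
      ring
    · have hv' : v.1 ≠ 0 := fun e => hv (Subtype.ext e)
      have h2 : h v = 0 := Finsupp.single_eq_of_ne hv
      simp only [coneSum, Pi.add_apply, h2, add_zero, hne v.1 hv']
  rw [h0]
  exact hμ.add (represents_finsupp h)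

/-- The homomorphism `K_V → M~(L_p)` attached to a test function `f'` away from `p`: it sends a cone
function `κ` to the pseudo-measure represented by `∑_{v ∈ V} (f' ⊗ [L_p])(v) κ(v) δ_v`. -/
noncomputable def conePseudoMeasure (f' : testFunctionsAway p L) :
    coneFunctions V →+ PseudoMeasure p (localLattice p L) :=
  AddMonoidHom.mk' (fun κ => Classical.choose (exists_represents p L f'.2 κ.2)) (by
    intro κ κ'
    refine (Classical.choose_spec (exists_represents p L f'.2 (κ + κ').2)).unique ?_
    have h := (Classical.choose_spec (exists_represents p L f'.2 κ.2)).add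
      (Classical.choose_spec (exists_represents p L f'.2 κ'.2))
    have h0 : coneSum p L f'.1 (κ + κ').1 = coneSum p L f'.1 κ.1 + coneSum p L f'.1 κ'.1 := by
      ext v
      simp [coneSum, mul_add]
    rw [h0]
    exact h)

theorem represents_conePseudoMeasure (f' : testFunctionsAway p L) (κ : coneFunctions V) :
    Represents p L (coneSum p L f'.1 κ.1) (conePseudoMeasure p L f' κ) :=
  Classical.choose_spec (exists_represents p L f'.2 κ.2)

end ConePseudoMeasures

/-! ### The vanishing hypothesis and the Shintani cocycle -/

section Shintani

/-- The smallest integer `M ≥ 1` such that the function `g` is periodic under `Mℤ`. -/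
noncomputable def minPeriod (g : ℚ → ℤ) : ℕ :=
  sInf {M : ℕ | 0 < M ∧ ∀ x, g (x + M) = g x}

/-- The Haar measure of a test function `g` on `ℚ`, normalized with respect to `ℤ`: if `g` is
periodic under `Mℤ`, it is `[ℤ : Mℤ]⁻¹ ∑_{x ∈ ℚ / Mℤ} g(x)`. The value does not depend on the
period; we use the smallest one. -/
noncomputable def haarRat (g : ℚ → ℤ) : ℚ :=
  (minPeriod g : ℚ)⁻¹ * ∑ᶠ x ∈ Set.Ico (0 : ℚ) (minPeriod g), (g x : ℚ)

open Classical in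
/-- The Haar measure `h^{(p)}(g) = h_ℚ(g ⊗ [ℤ_p])` of a test function on `ℚ` away from `p`. -/
noncomputable def haarAway (p : ℕ) [Fact p.Prime] (g : ℚ → ℤ) : ℚ :=
  haarRat fun x => g x * if ‖(x : ℚ_[p])‖ ≤ 1 then 1 else 0

variable (p : ℕ) [Fact p.Prime] {V : Type*} [AddCommGroup V] [Module ℚ V]
variable (L : Submodule ℤ V)

/-- The Vanishing Hypothesis for `w`: the test function `π_{v,w} f' : x ↦ f'(v + x w)` on `ℚ`
has Haar measure zero for every `v ∈ V`. -/
def VanishingHypothesis (f' : testFunctionsAway p L) (w : V) : Prop :=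
  ∀ v : V, haarAway p (fun x => f'.1 (v + x • w)) = 0

/-- The stabilizer `Γ` of `f' ⊗ [L_p]` in `GL(V)`. -/
noncomputable def stabilizerGroup (f' : testFunctionsAway p L) : Subgroup (V ≃ₗ[ℚ] V) where
  carrier := {γ | ∀ v, extendTest p L f'.1 (γ v) = extendTest p L f'.1 v}
  one_mem' := fun _ => rfl
  mul_mem' {a b} ha hb := fun v => (ha (b v)).trans (hb v)
  inv_mem' {a} ha := fun v => by
    have h := ha (a⁻¹ v)
    rw [← LinearEquiv.mul_apply, mul_inv_cancel] at h
    exact h.symm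

/-- The quotient `M~(L_p) / ℤ δ_0`. -/
abbrev PseudoMeasureQuotient [L.IsLattice ℚ] : Type _ :=
  PseudoMeasure p (localLattice p L) ⧸
    AddSubgroup.zmultiples (algebraMap (PadicMeasure p (localLattice p L))
      (PseudoMeasure p (localLattice p L)) (PadicMeasure.dirac p 0))

/-- The `p`-adic Shintani cocycle `Φ_{f'} : Γ^n → M~(L_p) / ℤ δ_0`. -/
noncomputable def shintaniCocycle [L.IsLattice ℚ] {n : ℕ} (w : Module.Basis (Fin n) ℚ V)
    (f' : testFunctionsAway p L) (α : Fin n → stabilizerGroup p L f') :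
    PseudoMeasureQuotient p L :=
  QuotientAddGroup.mk (conePseudoMeasure p L f' (hillCocycle w fun i => (α i).1))

end Shintani

end PadicShintani

namespace PadicShintani

/-! ### Division by `δ_0 - δ_u` -/

section Division

open scoped fwdDiff
open Filter Topology

variable {p : ℕ} [Fact p.Prime]

/-! Non-degeneracy makes Hill's perturbation harmless: the perturbed cone is a union of relatively
open faces of the cone spanned by the `α i (w 0)` (`mem_hillCone_of_mem_face`,
`charFn_hillCone_mem`). Up to sign, Hill's function is therefore a sum of characteristic functions
of open cones whose generators are `γ i (w 0)` with `γ i` in `Γ`, and it suffices that each of these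
gives a measure.

Scale the generators to periods `u i = M • γ i (w 0)` of `F = f' ⊗ [L_p]`. Multiplying the formal
sum over the cone by `∏ (δ_0 - δ_{u i})` leaves the finite sum of `F(v) δ_v` over the half-open
parallelepiped on the `u i`. The point is that this finite sum is divisible by the same product in
the ring of measures (`prod_one_sub_diracLoc_dvd`). Two facts give this.

(a) `δ_0 - δ_u` divides `δ_0 - δ_{xu}` for every `p`-integral rational `x`. This comes from `ℤ_p`,
where the indefinite sum of a continuous function is again continuous by Mahler's theorem
(`dirac_sub_dirac_dvd`).

(b) On a segment in direction `u i`, the sum of `F` over each class modulo `ℤ_(p)` is zero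
(`VanishingHypothesis.finsum_class_eq_zero`). The hypothesis concerns only `w 0`, but `F` is
`Γ`-invariant, so it carries over to `γ i (w 0)`.

Write `v = ∑ a_i u_i`, let `ρ(a_i)` represent `a_i` modulo `ℤ_(p)`, and factor `δ_v` as `δ` at `∑
ρ(a_i) u_i` times `∏ E_i`, where `E_i` is `δ` at `(a_i - ρ(a_i)) u_i`. By (b), `E_i` may be replaced
by `E_i - 1` in the whole sum, for one `i` after the other; by (a), each `E_i - 1` is divisible by
`δ_0 - δ_{u i}`.

In (b) the length `M = p^k m` of the segment may be divisible by `p`. The passage from the Haar sum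
over `[0, m)` to the segment rests on the fact that both, cut down to the appropriate `p`-adic
class, are fundamental domains for `ℚ / m ℤ[1/p]` (`finsum_fundamentalDomain`). -/

instance : IsBoundedSMul ℤ_[p] ℚ_[p] :=
  IsBoundedSMul.of_norm_smul_le fun a x => by
    rw [Algebra.smul_def, norm_mul]
    rfl

theorem tendsto_mahler_smul_fwdDiff (x : ℤ_[p]) (f : C(ℤ_[p], ℚ_[p])) (m : ℕ) :
    Tendsto (fun k => mahler (k + m) x • (fwdDiff 1)^[k] f 0) atTop (𝓝 0) := by
  refine squeeze_zero_norm (fun k => ?_)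
    (tendsto_zero_iff_norm_tendsto_zero.1 (PadicInt.fwdDiff_tendsto_zero f))
  exact (norm_smul_le _ _).trans (mul_le_of_le_one_left (norm_nonneg _) (PadicInt.norm_le_one _))

theorem summable_mahler_smul_fwdDiff (x : ℤ_[p]) (f : C(ℤ_[p], ℚ_[p])) (m : ℕ) :
    Summable fun k => mahler (k + m) x • (fwdDiff 1)^[k] f 0 :=
  NonarchimedeanAddGroup.summable_of_tendsto_cofinite_zero
    (Nat.cofinite_eq_atTop ▸ tendsto_mahler_smul_fwdDiff x f m)

/-- The measure on `ℤ_p` which sends a function to the value at `x` of its indefinite sum. -/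
noncomputable def indefiniteSum (x : ℤ_[p]) : PadicMeasure p ℤ_[p] :=
  (AbstractMeasure.toCLMEquiv (R := ℚ_[p])).symm <|
    LinearMap.mkContinuous
      -- Since `Δ binom(·, k+1) = binom(·, k)`, raising the index of every binomial in the Mahler
      -- series of `f` inverts `Δ`, and the result vanishes at `x = 0`.
      { toFun := fun f : C(ℤ_[p], ℚ_[p]) => ∑' k, mahler (k + 1) x • (fwdDiff 1)^[k] f 0
        map_add' := fun f g => by
          rw [← (summable_mahler_smul_fwdDiff x f 1).tsum_add (summable_mahler_smul_fwdDiff x g 1)]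
          refine tsum_congr fun k => ?_
          rw [ContinuousMap.coe_add, fwdDiff_iter_add, Pi.add_apply, smul_add]
        map_smul' := fun r f => by
          rw [RingHom.id_apply, smul_eq_mul, ← tsum_mul_left]
          refine tsum_congr fun k => ?_
          rw [ContinuousMap.coe_smul, fwdDiff_iter_const_smul, Pi.smul_apply, ← smul_eq_mul, smul_comm] }
      -- The operator norm is at most `1`: binomials are `p`-adically integral, and iterated
      -- differences do not increase the norm, by the ultrametric inequality.
      1 fun f => by
        rw [one_mul]
        refine (IsUltrametricDist.norm_tsum_le _).trans (ciSup_le fun k => ?_)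
        refine (norm_smul_le _ _).trans ?_
        refine (mul_le_of_le_one_left (norm_nonneg _) (PadicInt.norm_le_one _)).trans ?_
        exact IsUltrametricDist.norm_fwdDiff_iter_apply_le 1 f 0 k

theorem indefiniteSum_apply (x : ℤ_[p]) (f : C(ℤ_[p], ℚ_[p])) :
    indefiniteSum x f = ∑' k, mahler (k + 1) x • (fwdDiff 1)^[k] f 0 := rfl

/-- With `g = f + Δf`, the difference of the two series has coefficients `Δ^(k+1) f(0)` against
`binom(x, k+1)`. That is the Mahler series of `f` at `x` without its constant term `f(0)`. -/
theorem indefiniteSum_shift (x : ℤ_[p]) (f g : C(ℤ_[p], ℚ_[p])) (hg : ∀ y, g y = f (1 + y)) :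
    indefiniteSum x g - indefiniteSum x f = f x - f 0 := by
  have h1 : ∀ k, (fwdDiff 1)^[k] g 0 = (fwdDiff 1)^[k + 1] f 0 + (fwdDiff 1)^[k] f 0 := by
    intro k
    have : (g : ℤ_[p] → ℚ_[p]) = fwdDiff 1 f + f := by
      ext y
      simp [fwdDiff, hg, add_comm]
    rw [this, fwdDiff_iter_add, Function.iterate_succ_apply]
    rfl
  have h2 : HasSum (fun k => mahler k x • (fwdDiff 1)^[k] f 0) (f x) := by
    have := (PadicInt.hasSum_mahler f).map (ContinuousMap.evalCLM ℚ_[p] x)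
      (ContinuousMap.evalCLM ℚ_[p] x).continuous
    simpa [Function.comp_def, PadicInt.mahlerTerm_apply] using! this
  rw [indefiniteSum_apply, indefiniteSum_apply,
    ← (summable_mahler_smul_fwdDiff x g 1).tsum_sub (summable_mahler_smul_fwdDiff x f 1),
    ← h2.tsum_eq, h2.summable.tsum_eq_zero_add]
  have h0 : mahler 0 x • (fwdDiff 1)^[0] f 0 = f 0 := by
    simp [mahler_apply]
  rw [h0, add_sub_cancel_left]
  refine tsum_congr fun k => ?_
  rw [h1, smul_add, add_sub_cancel_right]

variable {G : Type*} [TopologicalSpace G] [AddCommGroup G] [IsTopologicalAddGroup G]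
  [CompactSpace G] [T2Space G] [TotallyDisconnectedSpace G]

/-- On a one-parameter subgroup `φ`, the measure `δ_0 - δ_{φ(x)}` is divisible by `δ_0 - δ_{φ(1)}`
for every `x ∈ ℤ_p`. -/
theorem dirac_sub_dirac_dvd (φ : ℤ_[p] →+ G) (hφ : Continuous φ) (x : ℤ_[p]) :
    PadicMeasure.dirac p 0 - PadicMeasure.dirac p (φ 1) ∣
      PadicMeasure.dirac p 0 - PadicMeasure.dirac p (φ x) := by
  let φ' : C(ℤ_[p], G) := ⟨φ, hφ⟩
  let ν : PadicMeasure p G := AbstractMeasure.map φ' (indefiniteSum x)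
  have hν : ∀ f, ν f = indefiniteSum x (f.comp φ') := fun _ => rfl
  -- Convolution with `δ_{φ(1)}` is translation of the argument by `φ(1)`, which on `ℤ_p` is the
  -- shift by `1`; the identity is then `indefiniteSum_shift` pulled back along `φ`.
  have key : PadicMeasure.dirac p (φ x) - PadicMeasure.dirac p 0 =
      PadicMeasure.dirac p (φ 1) * ν - ν := by
    rw [sub_eq_iff_eq_add, sub_add_eq_add_sub, eq_sub_iff_add_eq]
    ext f
    have h := indefiniteSum_shift x (f.comp φ') ((PadicMeasure.translate f (φ 1)).comp φ')
      fun y => by simp [φ', PadicMeasure.translate]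
    have h2 : (PadicMeasure.dirac p (φ 1) * ν) f = ν (PadicMeasure.translate f (φ 1)) := rfl
    simp only [PadicMeasure.add_apply, h2, PadicMeasure.dirac_apply, hν]
    have h3 : (f.comp φ') x = f (φ x) := rfl
    have h4 : (f.comp φ') 0 = f 0 := by simp [φ']
    rw [h3, h4] at h
    linear_combination -h
  refine ⟨ν, ?_⟩
  rw [← neg_sub, key, sub_mul, ← PadicMeasure.one_def]
  ring

end Division

/-! ### Sums over the quotients `ℚ / m ℤ[1/p]` -/

section RationalSums

variable (p : ℕ) [hp : Fact p.Prime]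

/-- The subgroup `m ℤ[1/p]` of `ℚ`. -/
def awayMultiples (m : ℕ) : AddSubgroup ℚ where
  carrier := {h | ∃ (j : ℕ) (z : ℤ), h * p ^ j = m * z}
  zero_mem' := ⟨0, 0, by simp⟩
  add_mem' := by
    rintro a b ⟨j, z, h⟩ ⟨k, y, h'⟩
    refine ⟨j + k, z * p ^ k + y * p ^ j, ?_⟩
    push_cast
    rw [pow_add]
    linear_combination (p : ℚ) ^ k * h + (p : ℚ) ^ j * h'
  neg_mem' := by
    rintro a ⟨j, z, h⟩
    exact ⟨j, -z, by push_cast; linear_combination -h⟩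

variable {p}

theorem norm_natCast_of_coprime {m : ℕ} (hm : m.Coprime p) : ‖(m : ℚ_[p])‖ = 1 :=
  Padic.norm_natCast_eq_one_iff.2 hm.symm

theorem norm_sub_le_one_of_le {x y : ℚ_[p]} (hx : ‖x‖ ≤ 1) (hy : ‖y‖ ≤ 1) : ‖x - y‖ ≤ 1 := by
  rw [sub_eq_add_neg]
  exact (IsUltrametricDist.norm_add_le_max _ _).trans (max_le hx ((norm_neg y).trans_le hy))

theorem norm_add_le_one_iff {x y : ℚ_[p]} (hy : ‖y‖ ≤ 1) : ‖x + y‖ ≤ 1 ↔ ‖x‖ ≤ 1 := by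
  constructor
  · intro h
    rw [← add_sub_cancel_right x y]
    exact norm_sub_le_one_of_le h hy
  · intro h
    exact (IsUltrametricDist.norm_add_le_max _ _).trans (max_le h hy)

theorem exists_natCast_near {x : ℚ_[p]} (hx : ‖x‖ ≤ 1) {ε : ℝ} (hε : 0 < ε) :
    ∃ z : ℕ, ‖x - z‖ < ε := by
  let y : ℤ_[p] := ⟨x, hx⟩
  obtain ⟨z, hz⟩ := PadicInt.denseRange_natCast.exists_dist_lt y hε
  refine ⟨z, ?_⟩
  rw [dist_eq_norm, PadicInt.norm_def, PadicInt.coe_sub, PadicInt.coe_natCast] at hz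
  exact hz

/-- Since `m` is a `p`-adic unit, `m ℤ[1/p]` is dense in `ℚ_p`; hence every class of `ℚ / m ℤ[1/p]`
meets `p^k ℤ_(p)`. This is the surjectivity in `finsum_fundamentalDomain`. -/
theorem exists_awayMultiple_near {m : ℕ} (hm : 0 < m) (hmp : m.Coprime p) (k : ℕ) (q : ℚ) :
    ∃ h ∈ awayMultiples p m, ‖(((q + h) / p ^ k : ℚ) : ℚ_[p])‖ ≤ 1 := by
  have hp0 : (p : ℝ) ≠ 0 := by exact_mod_cast hp.out.ne_zero
  have hpq : (p : ℚ) ≠ 0 := by exact_mod_cast hp.out.ne_zero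
  have hmq : (m : ℚ) ≠ 0 := by exact_mod_cast hm.ne'
  obtain ⟨j, hj⟩ : ∃ j : ℕ, ‖((p ^ j * (q / m) : ℚ) : ℚ_[p])‖ ≤ 1 := by
    obtain ⟨j, hj⟩ := pow_unbounded_of_one_lt ‖((q / m : ℚ) : ℚ_[p])‖
      (show (1 : ℝ) < p by exact_mod_cast hp.out.one_lt)
    refine ⟨j, ?_⟩
    rw [Rat.cast_mul, Rat.cast_pow, Rat.cast_natCast, norm_mul, norm_pow, Padic.norm_p, inv_pow,
      inv_mul_le_iff₀ (by have := hp.out.pos; positivity), mul_one]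
    exact hj.le
  -- The precision `p^(-(j+k))` pays for both divisions: by `p^j`, which restores the scale of `q`,
  -- and by the `p^k` of the goal.
  obtain ⟨z, hz⟩ := exists_natCast_near hj (show (0 : ℝ) < ((p : ℝ) ^ (j + k))⁻¹ by
    have := hp.out.pos; positivity)
  refine ⟨-(m * z / p ^ j), ⟨j, -z, by push_cast; field_simp⟩, ?_⟩
  have e : (q + -(m * z / p ^ j)) / p ^ k = m * ((p ^ j * (q / m) - z) / p ^ (j + k) : ℚ) := by
    rw [pow_add]
    field_simp
    ring
  rw [e, Rat.cast_mul, norm_mul, Rat.cast_natCast, norm_natCast_of_coprime hmp, one_mul,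
    Rat.cast_div, norm_div, Rat.cast_pow, Rat.cast_natCast, norm_pow, Padic.norm_p, inv_pow,
    div_inv_eq_mul]
  have h2 := mul_le_mul_of_nonneg_right hz.le (show (0 : ℝ) ≤ (p : ℝ) ^ (j + k) by positivity)
  rw [inv_mul_cancel₀ (pow_ne_zero _ hp0)] at h2
  simpa using h2

/-- The quotient `h / (p^k m)` is an integer because it is integral at every prime: at `p` by
hypothesis and because `m` is a unit there, elsewhere because it equals `z / p^(j+k)`. This is the
injectivity in `finsum_fundamentalDomain`. -/
theorem exists_int_of_mem_awayMultiples {m : ℕ} (hm : 0 < m) (hmp : m.Coprime p) (k : ℕ) {h : ℚ}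
    (hh : h ∈ awayMultiples p m) (hk : ‖((h / p ^ k : ℚ) : ℚ_[p])‖ ≤ 1) :
    ∃ z : ℤ, h = z * (p ^ k * m) := by
  have hpq : (p : ℚ) ≠ 0 := by exact_mod_cast hp.out.ne_zero
  have hmq : (m : ℚ) ≠ 0 := by exact_mod_cast hm.ne'
  obtain ⟨j, z, hz⟩ := hh
  obtain ⟨y, hy⟩ := exists_int_of_forall_norm_le_one (h / (p ^ k * m)) (by
    intro ℓ hℓ
    by_cases hlp : ℓ = p
    · subst hlp
      rw [← div_div, Rat.cast_div, norm_div, Rat.cast_natCast, norm_natCast_of_coprime hmp, div_one]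
      exact hk
    · have e : h / (p ^ k * m) = z / p ^ (j + k) := by
        rw [pow_add]
        field_simp
        linear_combination hz
      have h1 : ‖(p : ℚ_[ℓ])‖ = 1 :=
        norm_natCast_of_coprime ((Nat.coprime_primes hp.out hℓ.out).2 (Ne.symm hlp))
      rw [e, Rat.cast_div, norm_div, Rat.cast_pow, Rat.cast_natCast, norm_pow, h1, one_pow, div_one,
        Rat.cast_intCast]
      exact Padic.norm_int_le_one z)
  refine ⟨y, ?_⟩
  rw [← hy]
  field_simp

/-- A function which is periodic under `m ℤ[1/p]`, as a function on the quotient. -/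
noncomputable def liftAway {m : ℕ} (g : ℚ → ℤ)
    (hg : ∀ x, ∀ h ∈ awayMultiples p m, g (x + h) = g x) : ℚ ⧸ awayMultiples p m → ℤ :=
  Quotient.lift g fun a b hab => by
    have h := QuotientAddGroup.leftRel_apply.1 hab
    have := hg a _ h
    rw [add_neg_cancel_left] at this
    exact this.symm

/-- If `I` is a fundamental domain for `p^k m ℤ`, then `I ∩ p^k ℤ_(p)` is a fundamental domain
for `m ℤ[1/p]`. -/
theorem finsum_fundamentalDomain {m : ℕ} (hm : 0 < m) (hmp : m.Coprime p) (g : ℚ → ℤ)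
    (hg : ∀ x, ∀ h ∈ awayMultiples p m, g (x + h) = g x) (k : ℕ) {I : Set ℚ}
    (hI : ∀ x, ∃! j : ℤ, x + j • (p ^ k * m : ℚ) ∈ I) :
    ∑ᶠ x ∈ I ∩ {x | ‖((x / p ^ k : ℚ) : ℚ_[p])‖ ≤ 1}, g x = ∑ᶠ x, liftAway g hg x := by
  have hpq : (p : ℚ) ≠ 0 := by exact_mod_cast hp.out.ne_zero
  rw [← finsum_mem_univ (liftAway g hg)]
  -- Two points of the set in one class differ by a multiple of `p^k m`, and `I` has just one point
  -- in each class modulo that. Conversely, a class is first moved into `p^k ℤ_(p)`, then into `I`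
  -- by multiples of `p^k m`, which do not leave `p^k ℤ_(p)`.
  refine finsum_mem_eq_of_bijOn (QuotientAddGroup.mk (s := awayMultiples p m))
    ⟨fun _ _ => Set.mem_univ _, ?_, ?_⟩ fun _ _ => rfl
  · rintro x ⟨hxI, hx⟩ y ⟨hyI, hy⟩ hxy
    have h := QuotientAddGroup.eq.1 hxy
    obtain ⟨z, hz⟩ := exists_int_of_mem_awayMultiples hm hmp k h (by
      have e : (-x + y) / p ^ k = y / p ^ k - x / p ^ k := by ring
      rw [e, Rat.cast_sub]
      exact norm_sub_le_one_of_le hy hx)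
    have h0 := (hI x).unique (y₁ := 0) (y₂ := z) (by simpa using hxI) (by
      rw [zsmul_eq_mul, ← hz, add_neg_cancel_left]
      exact hyI)
    rw [← h0, Int.cast_zero, zero_mul] at hz
    linarith
  · rintro ⟨q⟩ -
    obtain ⟨h, hh, hq⟩ := exists_awayMultiple_near hm hmp k q
    obtain ⟨j, hj, -⟩ := hI (q + h)
    refine ⟨_, ⟨hj, ?_⟩, ?_⟩
    · have e : (q + h + j • (p ^ k * m : ℚ)) / p ^ k = (q + h) / p ^ k + (j * m : ℤ) := by
        rw [zsmul_eq_mul]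
        push_cast
        field_simp
      rw [Set.mem_ofPred_eq, e, Rat.cast_add, norm_add_le_one_iff]
      · exact hq
      · rw [Rat.cast_intCast]
        exact Padic.norm_int_le_one _
    · refine (QuotientAddGroup.eq.2 ?_).symm
      have e : -q + (q + h + j • (p ^ k * m : ℚ)) = h + j • (p ^ k * m : ℚ) := by ring
      have hmem : (p ^ k * m : ℚ) ∈ awayMultiples p m := ⟨0, p ^ k, by push_cast; ring⟩
      rw [e]
      exact add_mem hh (zsmul_mem hmem _)

theorem finsum_mem_mul_ite {ι R : Type*} [Semiring R] (s : Set ι) (P : ι → Prop)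
    [DecidablePred P] (g : ι → R) :
    ∑ᶠ x ∈ s, (g x * if P x then 1 else 0) = ∑ᶠ x ∈ s ∩ {x | P x}, g x := by
  rw [finsum_mem_def, finsum_mem_def]
  refine finsum_congr fun x => ?_
  by_cases h1 : x ∈ s <;> by_cases h2 : P x <;> simp [Set.indicator, h1, h2]

end RationalSums

/-! ### Haar sums on `ℚ`: from the minimal period to an arbitrary one -/

section MinPeriod

variable {g : ℚ → ℤ}

theorem minPeriod_spec {M : ℕ} (hM : 0 < M) (hg : Function.Periodic g (M : ℚ)) :
    0 < minPeriod g ∧ Function.Periodic g (minPeriod g : ℚ) :=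
  Nat.sInf_mem (s := {M : ℕ | 0 < M ∧ ∀ x, g (x + M) = g x}) ⟨M, hM, hg⟩

/-- The remainder of `M` modulo the minimal period is again a period, and it is smaller, so it is
zero. -/
theorem minPeriod_dvd {M : ℕ} (hM : 0 < M) (hg : Function.Periodic g (M : ℚ)) :
    minPeriod g ∣ M := by
  obtain ⟨hP, hper⟩ := minPeriod_spec hM hg
  set P := minPeriod g with hPdef
  have h1 : Function.Periodic g ((M % P : ℕ) : ℚ) := by
    have h2 := hg.sub_period (hper.nat_mul (M / P))
    have e : (M : ℚ) - (M / P : ℕ) * P = (M % P : ℕ) := by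
      rw [sub_eq_iff_eq_add]
      exact_mod_cast (Nat.mod_add_div' M P).symm
    rwa [e] at h2
  by_contra hnd
  have h3 : 0 < M % P := Nat.pos_of_ne_zero fun h => hnd (Nat.dvd_of_mod_eq_zero h)
  exact (Nat.mod_lt M hP).not_ge (Nat.sInf_le ⟨h3, h1⟩)

/-- Local finiteness of the support is essential: a `finsum` with infinite support has the default
value `0`, and additivity over adjacent intervals could fail. -/
theorem finsum_Ico_mul_period {P : ℚ} (hP : 0 ≤ P) (hg : Function.Periodic g P)
    (hfin : ∀ a b : ℚ, (Set.Ico a b ∩ Function.support g).Finite) (k : ℕ) :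
    ∑ᶠ x ∈ Set.Ico 0 (k * P), g x = k * ∑ᶠ x ∈ Set.Ico 0 P, g x := by
  induction k with
  | zero => simp
  | succ k ih =>
    have h1 : Set.Ico 0 ((k + 1 : ℕ) * P) = Set.Ico 0 (k * P) ∪ Set.Ico (k * P) (k * P + P) := by
      rw [Set.Ico_union_Ico_eq_Ico (by positivity) (by linarith)]
      push_cast
      ring_nf
    have h2 : ∑ᶠ x ∈ Set.Ico (k * P) (k * P + P), g x = ∑ᶠ x ∈ Set.Ico 0 P, g x := by
      symm
      refine finsum_mem_eq_of_bijOn (fun x => x + k * P) ⟨?_, ?_, ?_⟩ fun x _ =>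
        (hg.nat_mul k x).symm
      · rintro x ⟨h, h'⟩
        exact ⟨by simpa using h, by linarith⟩
      · exact fun x _ y _ h => add_right_cancel h
      · rintro x ⟨h, h'⟩
        exact ⟨x - k * P, ⟨by linarith, by linarith⟩, by simp⟩
    rw [h1, finsum_mem_union' _ (hfin _ _) (hfin _ _), ih, h2]
    · push_cast
      ring
    · rw [Set.disjoint_left]
      rintro x ⟨-, h⟩ ⟨h', -⟩
      exact h.not_ge h'

/-- `haarRat` is defined through the minimal period, whereas the geometry supplies some period `M`.
As the minimal period divides `M`, the sum over `[0, M)` is an integral multiple of the sum that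
vanishes. -/
theorem finsum_Ico_eq_zero_of_haarRat_eq_zero {M : ℕ} (hM : 0 < M)
    (hg : Function.Periodic g (M : ℚ))
    (hfin : ∀ a b : ℚ, (Set.Ico a b ∩ Function.support g).Finite) (h0 : haarRat g = 0) :
    ∑ᶠ x ∈ Set.Ico 0 (M : ℚ), g x = 0 := by
  obtain ⟨hP, hper⟩ := minPeriod_spec hM hg
  have hP' : ((minPeriod g : ℕ) : ℚ)⁻¹ ≠ 0 := inv_ne_zero (by exact_mod_cast hP.ne')
  have h1 := (mul_eq_zero.1 h0).resolve_left hP'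
  have h2 : ∑ᶠ x ∈ Set.Ico (0 : ℚ) (minPeriod g), g x = 0 := by
    have h3 := (Int.castAddHom ℚ).map_finsum_mem' (f := g) (hfin 0 (minPeriod g))
    have h4 : ((∑ᶠ x ∈ Set.Ico (0 : ℚ) (minPeriod g), g x : ℤ) : ℚ) = 0 := h3.trans h1
    exact_mod_cast h4
  obtain ⟨c, hc⟩ := minPeriod_dvd hM hg
  have h3 := finsum_Ico_mul_period (Nat.cast_nonneg _) hper hfin c
  rw [h2, mul_zero, ← Nat.cast_mul, mul_comm c, ← hc] at h3
  exact h3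

end MinPeriod

/-! ### Periods prime to `p` -/

section Periods

variable (p : ℕ) [Fact p.Prime] {V : Type*} [AddCommGroup V] [Module ℚ V]
variable (L : Submodule ℤ V)

/-- The subgroup `L[1/p]` of the vectors of `V` which are integral at all primes except `p`. -/
noncomputable def latticeAway (p : ℕ) (L : Submodule ℤ V) : AddSubgroup V :=
  ⨅ ℓ : PrimesAway p, globalPoints ℓ L

variable {p L}

theorem mem_latticeAway {v : V} :
    v ∈ latticeAway p L ↔ ∀ ℓ : PrimesAway p, toLocal ℓ v ∈ localLattice ℓ L :=
  AddSubgroup.mem_iInf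

theorem norm_coprime_prime (ℓ : PrimesAway p) : ‖(p : ℚ_[ℓ])‖ = 1 :=
  norm_natCast_of_coprime ((Nat.coprime_primes Fact.out ℓ.2.1).2 ℓ.2.2.symm)

variable [L.IsLattice ℚ]

/-- At every prime other than `p` the number `p^k` is a unit. -/
theorem mem_latticeAway_of_smul {v : V} (k : ℕ) (h : (p ^ k : ℚ) • v ∈ latticeAway p L) :
    v ∈ latticeAway p L := by
  rw [mem_latticeAway] at h ⊢
  intro ℓ
  have h1 := h ℓ
  rw [toLocal_smul] at h1
  rw [mem_localLattice_iff] at h1 ⊢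
  intro i
  have h2 := h1 i
  rw [map_smul, Finsupp.smul_apply, smul_eq_mul, norm_mul, Rat.cast_pow, Rat.cast_natCast, norm_pow,
    norm_coprime_prime, one_pow, one_mul] at h2
  exact h2

theorem mem_latticeAway_of_mem {v : V} (h : v ∈ L) : v ∈ latticeAway p L :=
  mem_latticeAway.2 fun _ => toLocal_mem _ h

theorem mem_of_mem_latticeAway {v : V} (h : v ∈ latticeAway p L)
    (hp : toLocal p v ∈ localLattice p L) : v ∈ L := by
  refine mem_lattice_of_forall_local L _ fun ℓ hℓ => ?_
  by_cases hlp : ℓ = p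
  · subst hlp
    exact hp
  · exact mem_latticeAway.1 h ⟨ℓ, hℓ.out, hlp⟩

/-- A test function away from `p` is periodic under, and supported on, lattices over `ℤ[1/p]`. -/
theorem exists_period_latticeAway {f : V → ℤ} (hf : f ∈ testFunctionsAway p L) :
    ∃ N : ℕ, 0 < N ∧
      (∀ v, ∀ l ∈ latticeAway p L, f (v + N • l) = f v) ∧
      ∀ v, f v ≠ 0 → N • v ∈ latticeAway p L := by
  induction hf using AddSubgroup.closure_induction with
  | mem f hf =>
    obtain ⟨φ, hφ, hfin, hprod⟩ := hf
    choose m hm1 hm2 using fun ℓ => (hφ ℓ).exists_pow ℓ L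
    set T := hfin.toFinset with hT
    have hstd : ∀ ℓ ∉ T, φ ℓ = latticeIndicator ℓ L := by
      intro ℓ hℓ
      by_contra hne
      exact hℓ (hfin.mem_toFinset.2 hne)
    -- Only the finitely many primes where the local factor differs from `[L_ℓ]` contribute. No
    -- condition at `p` enters, because `f'` has no component there; this is why the period lattice
    -- is a `ℤ[1/p]`-module.
    refine ⟨∏ ℓ ∈ T, (ℓ : ℕ) ^ m ℓ, Finset.prod_pos fun ℓ _ => pow_pos ℓ.2.1.pos _, ?_, ?_⟩
    · intro v l hl
      rw [mem_latticeAway] at hl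
      rw [hprod, hprod]
      refine finprod_congr fun ℓ => ?_
      rw [map_add, toLocal_nsmul]
      by_cases hℓ : ℓ ∈ T
      · obtain ⟨c, hc⟩ := Finset.dvd_prod_of_mem (fun ℓ : PrimesAway p => (ℓ : ℕ) ^ m ℓ) hℓ
        rw [hc, Nat.cast_mul, mul_smul, Nat.cast_pow]
        exact hm1 ℓ _ _ (smul_nat_mem _ (hl ℓ) c)
      · rw [hstd ℓ hℓ]
        have h1 := smul_nat_mem _ (hl ℓ) (∏ ℓ ∈ T, (ℓ : ℕ) ^ m ℓ)
        have h2 := (localLattice (ℓ : ℕ) L).add_mem_iff_left (x := toLocal ℓ v) h1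
        by_cases h3 : toLocal ℓ v ∈ localLattice (ℓ : ℕ) L
        · rw [latticeIndicator, latticeIndicator, if_pos h3, if_pos (h2.2 h3)]
        · rw [latticeIndicator, latticeIndicator, if_neg h3, if_neg (mt h2.1 h3)]
    · intro v hv
      have hne : ∀ ℓ : PrimesAway p, φ ℓ (toLocal ℓ v) ≠ 0 := by
        intro ℓ h0
        apply hv
        rw [hprod]
        -- A `finprod` with infinitely many factors different from `1` is `1` by convention, so
        -- finiteness must be checked before the zero factor counts: the other factors are `1` away
        -- from the exceptional primes and the denominators of `v`.
        refine finprod_eq_zero _ ℓ h0 ?_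
        refine (hfin.union (finite_not_mem_localLattice p L v)).subset ?_
        intro ℓ hℓ
        by_contra hcon
        simp only [Set.mem_union, Set.mem_ofPred_eq, not_or, not_not] at hcon
        apply hℓ
        simp only [hcon.1, latticeIndicator, hcon.2, if_true]
      rw [mem_latticeAway]
      intro ℓ
      rw [toLocal_nsmul]
      by_cases hℓ : ℓ ∈ T
      · obtain ⟨c, hc⟩ := Finset.dvd_prod_of_mem (fun ℓ : PrimesAway p => (ℓ : ℕ) ^ m ℓ) hℓ
        rw [hc, mul_comm, Nat.cast_mul, mul_smul, Nat.cast_pow]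
        exact smul_nat_mem _ (hm2 ℓ _ (hne ℓ)) c
      · have h2 := hne ℓ
        rw [hstd ℓ hℓ] at h2
        refine smul_nat_mem _ ?_ _
        by_contra h3
        exact h2 (if_neg h3)
  | zero => exact ⟨1, one_pos, fun _ _ _ => rfl, fun v hv => absurd rfl hv⟩
  | add f g _ _ hf hg =>
    obtain ⟨N, hN, h1, h2⟩ := hf
    obtain ⟨M, hM, h3, h4⟩ := hg
    refine ⟨N * M, Nat.mul_pos hN hM, fun v l hl => ?_, fun v hv => ?_⟩
    · simp only [Pi.add_apply]
      congr 1
      · rw [mul_smul]; exact h1 v _ (nsmul_mem hl M)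
      · rw [mul_comm, mul_smul]; exact h3 v _ (nsmul_mem hl N)
    · by_cases hfv : f v = 0
      · rw [mul_smul]
        refine nsmul_mem (h4 v ?_) N
        intro h
        exact hv (by simp [hfv, h])
      · rw [mul_comm, mul_smul]
        exact nsmul_mem (h2 v hfv) M
  | neg f _ hf =>
    obtain ⟨N, hN, h1, h2⟩ := hf
    exact ⟨N, hN, fun v l hl => by simp [h1 v l hl], fun v hv => h2 v (by simpa using hv)⟩

end Periods

/-! ### Consequences of the Vanishing Hypothesis -/

section Vanishing

variable {p : ℕ} [Fact p.Prime] {V : Type*} [AddCommGroup V] [Module ℚ V]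
variable {L : Submodule ℤ V} [L.IsLattice ℚ]

/-- On a bounded interval, a line in the direction of `w ≠ 0` contains only finitely many points of
a lattice. -/
theorem finite_Ico_inter_line {w : V} (hw : w ≠ 0) (v : V) (a b : ℚ) :
    (Set.Ico a b ∩ {x : ℚ | v + x • w ∈ L}).Finite := by
  obtain ⟨i, hi⟩ : ∃ i, (latticeBasis L).repr w i ≠ 0 := by
    by_contra! h
    exact hw ((latticeBasis L).repr.injective (Finsupp.ext fun i => by simpa using h i))
  set A := (latticeBasis L).repr v i
  set B := (latticeBasis L).repr w i
  -- On the interval `|x| ≤ |a| + |b|`, so `C` bounds the `i`-th coordinate `A + x B`. At lattice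
  -- points this is an integer, and it determines `x` because `B ≠ 0`.
  set C : ℤ := ⌈|A| + (|a| + |b|) * |B|⌉ with hC
  refine Set.Finite.of_finite_image (f := fun x : ℚ => A + x * B)
    (((Set.finite_Icc (-C) C).image (fun k : ℤ => (k : ℚ))).subset ?_) ?_
  · rintro _ ⟨x, ⟨⟨hxa, hxb⟩, hx⟩, rfl⟩
    obtain ⟨k, hk⟩ := (mem_lattice_iff L _).1 hx i
    have hk' : A + x * B = k := by rw [← hk]; simp [A, B]
    refine ⟨k, ?_, hk'.symm⟩
    have h1 : |x| ≤ |a| + |b| := by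
      rw [abs_le]
      constructor
      · have := neg_abs_le a
        have := abs_nonneg b
        linarith
      · have := le_abs_self b
        have := abs_nonneg a
        linarith
    have h2 : |(k : ℚ)| ≤ C := by
      rw [← hk']
      refine le_trans ?_ (Int.le_ceil _)
      refine (abs_add_le _ _).trans ?_
      rw [abs_mul]
      have := mul_le_mul_of_nonneg_right h1 (abs_nonneg B)
      linarith
    have h3 := abs_le.1 h2
    exact ⟨by exact_mod_cast h3.1, by exact_mod_cast h3.2⟩
  · intro x _ y _ h
    exact mul_right_cancel₀ hi (add_left_cancel h)

/-- The Vanishing Hypothesis, summed over an arbitrary period prime to `p`. -/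
theorem VanishingHypothesis.finsum_Ico_eq_zero {f' : testFunctionsAway p L} {w : V} (hw : w ≠ 0)
    (hf' : VanishingHypothesis p L f' w) {N : ℕ} (hN : 0 < N)
    (hper : ∀ v, ∀ l ∈ latticeAway p L, f'.1 (v + N • l) = f'.1 v)
    (hsupp : ∀ v, f'.1 v ≠ 0 → N • v ∈ latticeAway p L) {m : ℕ} (hm : 0 < m) {l : V}
    (hl : l ∈ latticeAway p L) (hml : m • w = N • l) (v : V) :
    ∑ᶠ x ∈ Set.Ico 0 (m : ℚ) ∩ {x | ‖(x : ℚ_[p])‖ ≤ 1}, f'.1 (v + x • w) = 0 := by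
  classical
  rw [← finsum_mem_mul_ite]
  have h0 : haarRat (fun x : ℚ => f'.1 (v + x • w) * if ‖(x : ℚ_[p])‖ ≤ 1 then 1 else 0) = 0 := by
    have := hf' v
    rw [haarAway] at this
    convert! this
  refine finsum_Ico_eq_zero_of_haarRat_eq_zero hm (fun x => ?_) (fun a b => ?_) h0
  · have h1 : v + (x + m) • w = (v + x • w) + N • l := by
      rw [add_smul, ← add_assoc, Nat.cast_smul_eq_nsmul, hml]
    have h2 : ‖((x + m : ℚ) : ℚ_[p])‖ ≤ 1 ↔ ‖(x : ℚ_[p])‖ ≤ 1 := by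
      rw [Rat.cast_add, Rat.cast_natCast]
      exact norm_add_le_one_iff (by simpa using Padic.norm_int_le_one (p := p) m)
    simp only [h1, hper _ l hl, h2]
  -- Local finiteness: `p^c` clears the `p`-denominators of `v` and `w`, and `N` those of the
  -- support away from `p`. For `p`-integral `x` in the support, `N p^c (v + x w)` is thus a point
  -- of `L` on a line.
  · obtain ⟨c, hc⟩ := exists_pow_of_isCompact p L
      (Set.toFinite {toLocal p v, toLocal p w}).isCompact
    have hcv := hc _ (Set.mem_insert _ _)
    have hcw := hc _ (Set.mem_insert_of_mem _ rfl)
    have hne : ((N * p ^ c : ℕ) : ℚ) ≠ 0 := by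
      have := (Fact.out : p.Prime).pos
      positivity
    refine (finite_Ico_inter_line (L := L) (smul_ne_zero hne hw)
      (((N * p ^ c : ℕ) : ℚ) • v) a b).subset ?_
    rintro x ⟨hx, hne⟩
    refine ⟨hx, ?_⟩
    have hx1 : ‖(x : ℚ_[p])‖ ≤ 1 := by
      by_contra h
      refine hne ?_
      change _ * (if _ then _ else _) = _
      rw [if_neg h, mul_zero]
    have hx2 : f'.1 (v + x • w) ≠ 0 := left_ne_zero_of_mul hne
    have e : ((N * p ^ c : ℕ) : ℚ) • v + x • ((N * p ^ c : ℕ) : ℚ) • w =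
        p ^ c • N • (v + x • w) := by
      rw [smul_comm x, ← smul_add, Nat.cast_smul_eq_nsmul, mul_comm, mul_smul]
    rw [Set.mem_ofPred_eq, e]
    refine mem_of_mem_latticeAway (p := p) (nsmul_mem (hsupp _ hx2) _) ?_
    rw [smul_comm, toLocal_nsmul]
    refine smul_nat_mem _ ?_ N
    rw [toLocal_nsmul, map_add, toLocal_smul, smul_add, Nat.cast_pow, smul_comm]
    exact add_mem hcv ((localLattice p L).smul_mem ⟨_, hx1⟩ hcw)

/-- The Vanishing Hypothesis implies that the sums of `f' ⊗ [L_p]` over the `p`-adic classes on the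
segments in the direction of `w` vanish. -/
theorem VanishingHypothesis.finsum_class_eq_zero {f' : testFunctionsAway p L} {w : V} (hw : w ≠ 0)
    (hf' : VanishingHypothesis p L f' w) {N : ℕ} (hN : 0 < N)
    (hper : ∀ v, ∀ l ∈ latticeAway p L, f'.1 (v + N • l) = f'.1 v)
    (hsupp : ∀ v, f'.1 v ≠ 0 → N • v ∈ latticeAway p L) {M : ℕ} (hM : 0 < M) {l : V}
    (hl : l ∈ L) (hMl : M • w = N • l) (y : V) (c : ℚ) :
    ∑ᶠ x ∈ Set.Ioc 0 1 ∩ {x : ℚ | ‖((x - c : ℚ) : ℚ_[p])‖ ≤ 1},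
      extendTest p L f'.1 (y + x • M • w) = 0 := by
  have hp : p.Prime := Fact.out
  have hpq : (p : ℚ) ≠ 0 := by exact_mod_cast hp.ne_zero
  -- Recentring at the class: with base point `y'` the relevant parameters `x - c` are `p`-integral.
  -- Since `M w` lies in `L`, the factor `[L_p]` is then constant on the class, and only `f'` has to
  -- be summed.
  set y' := y + c • M • w with hy'
  have hMw : M • w ∈ L := hMl ▸ L.smul_of_tower_mem N hl
  have hy : ∀ x : ℚ, y + x • M • w = y' + (x - c) • M • w := by
    intro x
    rw [hy', sub_smul]
    abel
  have hloc : ∀ x : ℚ, ‖((x - c : ℚ) : ℚ_[p])‖ ≤ 1 →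
      latticeIndicator p L (toLocal p (y + x • M • w)) = latticeIndicator p L (toLocal p y') := by
    intro x hx
    have h1 : toLocal p (y + x • M • w) ∈ localLattice p L ↔ toLocal p y' ∈ localLattice p L := by
      rw [hy, map_add, toLocal_smul]
      exact (localLattice p L).add_mem_iff_left
        ((localLattice p L).smul_mem ⟨_, hx⟩ (toLocal_mem p hMw))
    by_cases h2 : toLocal p y' ∈ localLattice p L
    · rw [latticeIndicator, latticeIndicator, if_pos h2, if_pos (h1.2 h2)]
    · rw [latticeIndicator, latticeIndicator, if_neg h2, if_neg (mt h1.1 h2)]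
  -- Only the part `m` of `M` prime to `p` matters for `f'`: as `f'` has no component at `p`, the
  -- function `g` is periodic even under `m ℤ[1/p]`.
  obtain ⟨k, m, hmp, rfl⟩ := Nat.exists_eq_pow_mul_and_not_dvd hM.ne' p hp.ne_one
  have hm : 0 < m := Nat.pos_of_mul_pos_left hM
  have hmq : (m : ℚ) ≠ 0 := by exact_mod_cast hm.ne'
  have hmc : m.Coprime p := ((Nat.Prime.coprime_iff_not_dvd hp).2 hmp).symm
  have hNq : (N : ℚ) ≠ 0 := by exact_mod_cast hN.ne'
  set g : ℚ → ℤ := fun t => f'.1 (y' + t • w) with hgdef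
  have hg : ∀ x, ∀ h ∈ awayMultiples p m, g (x + h) = g x := by
    rintro x h ⟨j, z, hz⟩
    have h1 : h • w = N • ((z / p ^ (j + k) : ℚ) • l) := by
      rw [smul_comm, ← hMl, ← Nat.cast_smul_eq_nsmul ℚ, smul_smul]
      congr 1
      push_cast
      rw [pow_add]
      field_simp
      linear_combination hz
    have h2 : (z / p ^ (j + k) : ℚ) • l ∈ latticeAway p L := by
      refine mem_latticeAway_of_smul (j + k) ?_
      rw [smul_smul, mul_div_cancel₀ _ (pow_ne_zero _ hpq), Int.cast_smul_eq_zsmul]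
      exact zsmul_mem (mem_latticeAway_of_mem hl) z
    simp only [hgdef, add_smul, ← add_assoc, h1]
    exact hper _ _ h2
  have hpm : (0 : ℚ) < p ^ k * m := by
    have := hp.pos
    positivity
  -- The total over `ℚ / m ℤ[1/p]`, computed on the fundamental domain `[0, m) ∩ ℤ_(p)`, is the sum
  -- governed by the Vanishing Hypothesis.
  have hzero : ∑ᶠ x, liftAway g hg x = 0 := by
    have h1 := finsum_fundamentalDomain hm hmc g hg 0 (I := Set.Ico 0 (m : ℚ)) fun x => by
      have := existsUnique_add_zsmul_mem_Ico (show (0 : ℚ) < p ^ 0 * m by simpa using hm) x 0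
      simpa using this
    rw [← h1]
    have h2 : p ^ k • l ∈ L := L.smul_of_tower_mem _ hl
    obtain ⟨l', hl', hml'⟩ : ∃ l' ∈ latticeAway p L, m • w = N • l' := by
      refine ⟨((p ^ k : ℚ)⁻¹) • l, mem_latticeAway_of_smul k ?_, ?_⟩
      · rw [smul_smul, mul_inv_cancel₀ (pow_ne_zero _ hpq), one_smul]
        exact mem_latticeAway_of_mem hl
      · rw [smul_comm, ← hMl, ← Nat.cast_smul_eq_nsmul ℚ, ← Nat.cast_smul_eq_nsmul ℚ, smul_smul]
        congr 1
        push_cast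
        field_simp
    have h3 := hf'.finsum_Ico_eq_zero hw hN hper hsupp hm hl' hml' y'
    simpa [hgdef] using h3
  -- The same total, now computed on `p^k ℤ_(p)` in a half-open interval of length `p^k m`. The
  -- substitution `t = (x - c) p^k m` identifies this domain with the class of `c` in `(0, 1]`,
  -- since `m` is a `p`-adic unit.
  have hsum : ∑ᶠ x ∈ Set.Ioc 0 1 ∩ {x : ℚ | ‖((x - c : ℚ) : ℚ_[p])‖ ≤ 1},
      f'.1 (y + x • (p ^ k * m) • w) = 0 := by
    rw [← hzero, ← finsum_fundamentalDomain hm hmc g hg k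
      (existsUnique_add_zsmul_mem_Ioc hpm · (-c * (p ^ k * m)))]
    have hnorm : ∀ x : ℚ, ‖(((x - c) * (p ^ k * m) / p ^ k : ℚ) : ℚ_[p])‖ =
        ‖((x - c : ℚ) : ℚ_[p])‖ := by
      intro x
      have e : (x - c) * (p ^ k * m) / p ^ k = (x - c) * m := by field_simp
      rw [e, Rat.cast_mul, norm_mul, Rat.cast_natCast, norm_natCast_of_coprime hmc, mul_one]
    refine finsum_mem_eq_of_bijOn (fun x => (x - c) * (p ^ k * m)) ⟨?_, ?_, ?_⟩ ?_
    · rintro x ⟨⟨h1, h2⟩, h3⟩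
      refine ⟨⟨?_, ?_⟩, ?_⟩
      · exact mul_lt_mul_of_pos_right (by linarith) hpm
      · have := mul_le_mul_of_nonneg_right h2 hpm.le
        linarith
      · rw [Set.mem_ofPred_eq, hnorm]
        exact h3
    · intro x _ x' _ h
      exact sub_left_injective (mul_right_cancel₀ hpm.ne' h)
    · rintro t ⟨⟨h1, h2⟩, h3⟩
      have e : (t / (p ^ k * m) + c - c) * (p ^ k * m) = t := by
        rw [add_sub_cancel_right, div_mul_cancel₀ _ hpm.ne']
      refine ⟨t / (p ^ k * m) + c, ⟨⟨?_, ?_⟩, ?_⟩, e⟩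
      · have := (lt_div_iff₀ hpm).2 h1
        linarith
      · have : t / (p ^ k * m) ≤ -c + 1 := (div_le_iff₀ hpm).2 (by linarith)
        linarith
      · rw [Set.mem_ofPred_eq, ← hnorm, e]
        exact h3
    · intro x _
      rw [hy]
      simp only [hgdef, ← Nat.cast_smul_eq_nsmul ℚ, smul_smul]
      push_cast
      rfl
  by_cases h : toLocal p y' ∈ localLattice p L
  · rw [← hsum]
    refine finsum_mem_congr rfl fun x hx => ?_
    rw [extendTest, hloc x hx.2, latticeIndicator, if_pos h, mul_one]
  · refine finsum_mem_eq_zero_of_forall_eq_zero fun x hx => ?_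
    rw [extendTest, hloc x hx.2, latticeIndicator, if_neg h, mul_zero]

end Vanishing

/-! ### Dirac measures at the points of `V` -/

section DiracLoc

variable (p : ℕ) [Fact p.Prime] {V : Type*} [AddCommGroup V] [Module ℚ V]
variable (L : Submodule ℤ V) [L.IsLattice ℚ]

open Classical in
/-- The measure `δ_v` on `L_p` for `v ∈ V`, extended by zero to the `v` which are not in `L_p`. -/
noncomputable def diracLoc (v : V) : PadicMeasure p (localLattice p L) :=
  if h : v ∈ globalPoints p L then diracAt p L ⟨v, h⟩ else 0

variable {p L}

theorem diracLoc_coe (v : globalPoints p L) : diracLoc p L v.1 = diracAt p L v := dif_pos v.2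

/-- Multiplicativity survives the extension by zero when one of the points lies in `L_p`: the sum is
then in `L_p` exactly when the other point is. The base points built from class representatives
below may lie outside `L_p`. -/
theorem diracLoc_add (v : V) {y : V} (hy : y ∈ globalPoints p L) :
    diracLoc p L (v + y) = diracLoc p L v * diracLoc p L y := by
  by_cases hv : v ∈ globalPoints p L
  · exact (diracLoc_coe (⟨v, hv⟩ + ⟨y, hy⟩)).trans ((diracAt_add ⟨v, hv⟩ ⟨y, hy⟩).trans
      (by rw [← diracLoc_coe, ← diracLoc_coe]))
  · rw [diracLoc, diracLoc, dif_neg hv, dif_neg (mt (add_mem_cancel_right hy).1 hv), zero_mul]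

theorem diracLoc_add_sum {ι : Type*} (s : Finset ι) (v : V) {y : ι → V}
    (hy : ∀ i, y i ∈ globalPoints p L) :
    diracLoc p L (v + ∑ i ∈ s, y i) = diracLoc p L v * ∏ i ∈ s, diracLoc p L (y i) := by
  classical
  induction s using Finset.induction_on with
  | empty => simp
  | insert i s hi ih =>
    rw [Finset.sum_insert hi, Finset.prod_insert hi, add_comm (y i), ← add_assoc,
      diracLoc_add _ (hy i), ih]
    ring

theorem smul_mem_globalPoints {u : V} (hu : u ∈ globalPoints p L) {x : ℚ}
    (hx : ‖(x : ℚ_[p])‖ ≤ 1) : x • u ∈ globalPoints p L := by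
  rw [mem_globalPoints, toLocal_smul]
  exact (localLattice p L).smul_mem ⟨_, hx⟩ hu

/-- This is `dirac_sub_dirac_dvd` for the one-parameter subgroup `y ↦ y u` of `L_p`, with `x` read
as an element of `ℤ_p`. -/
theorem one_sub_diracLoc_dvd {u : V} (hu : u ∈ globalPoints p L) {x : ℚ}
    (hx : ‖(x : ℚ_[p])‖ ≤ 1) : 1 - diracLoc p L u ∣ 1 - diracLoc p L (x • u) := by
  let u' : localLattice p L := ⟨toLocal p u, hu⟩
  let φ : ℤ_[p] →+ localLattice p L := (LinearMap.toSpanSingleton ℤ_[p] (localLattice p L) u').toAddMonoidHom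
  have hφ : Continuous φ := by
    refine Continuous.subtype_mk (f := fun y : ℤ_[p] => (y : ℚ_[p]) • toLocal p u) ?_ _
    have h1 : Continuous fun y : ℤ_[p] => (y : ℚ_[p]) := continuous_subtype_val
    have h2 : Continuous fun _ : ℤ_[p] => toLocal p u := continuous_const
    exact h1.smul h2
  have h := dirac_sub_dirac_dvd φ hφ ⟨(x : ℚ_[p]), hx⟩
  have h1 : PadicMeasure.dirac p (φ 1) = diracLoc p L u := by
    rw [diracLoc, dif_pos hu, diracAt]
    congr 1
    exact one_smul ℤ_[p] u'
  have h2 : PadicMeasure.dirac p (φ ⟨(x : ℚ_[p]), hx⟩) = diracLoc p L (x • u) := by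
    rw [diracLoc, dif_pos (smul_mem_globalPoints hu hx), diracAt]
    congr 1
    ext
    exact (toLocal_smul p x u).symm
  rw [h1, h2, ← PadicMeasure.one_def] at h
  exact h

end DiracLoc

/-! ### The measure attached to a cone -/

section ConeMeasure

/-- The function `ρ` picks representatives of `ℚ / ℤ_(p)`. Splitting `x` as `ρ x + (x - ρ x)`
isolates the `p`-integral part, to which `one_sub_diracLoc_dvd` applies. -/
theorem exists_classRep (p : ℕ) [Fact p.Prime] :
    ∃ ρ : ℚ → ℚ, (∀ x y, ρ x = ρ y ↔ ‖((x - y : ℚ) : ℚ_[p])‖ ≤ 1) ∧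
      ∀ x, ‖((x - ρ x : ℚ) : ℚ_[p])‖ ≤ 1 := by
  let s : Setoid ℚ :=
    { r := fun x y => ‖((x - y : ℚ) : ℚ_[p])‖ ≤ 1
      iseqv := ⟨fun x => by simp, fun {x y} h => by
          rw [← neg_sub, Rat.cast_neg, norm_neg]
          exact h, fun {x y z} h h' => by
          rw [← sub_add_sub_cancel x y z, Rat.cast_add, norm_add_le_one_iff h']
          exact h⟩ }
  exact ⟨fun x => (Quotient.mk s x).out, fun x y => Quotient.out_inj.trans Quotient.eq,
    fun x => s.symm (Quotient.mk_out x)⟩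

/-- If the sums of `c` over the classes in the `j`-th direction vanish, then so does the sum of
`c • X` for every `X` which is constant on these classes. -/
theorem sum_piFinset_smul_eq_zero {r : ℕ} {A K : Type*} [AddCommGroup A] [DecidableEq K]
    (Q : Finset ℚ) (ρ : ℚ → K) (j : Fin r) (c : (Fin r → ℚ) → ℤ) (X : (Fin r → ℚ) → A)
    (hX : ∀ a x, ρ x = ρ (a j) → X (Function.update a j x) = X a)
    (hc : ∀ a ∈ Fintype.piFinset fun _ : Fin r => Q,
      ∑ x ∈ Q with ρ x = ρ (a j), c (Function.update a j x) = 0) :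
    ∑ a ∈ Fintype.piFinset fun _ : Fin r => Q, c a • X a = 0 := by
  classical
  -- The box is grouped by the coordinates other than `j` together with the class of the `j`-th one.
  -- On such a group `X` is constant and the coefficients sum to zero.
  let key : (Fin r → ℚ) → (Fin r → ℚ) × K := fun a => (Function.update a j 0, ρ (a j))
  set B := Fintype.piFinset fun _ : Fin r => Q with hB
  rw [← Finset.sum_fiberwise_of_maps_to (t := B.image key)
    fun a ha => Finset.mem_image_of_mem key ha]
  refine Finset.sum_eq_zero fun b hb => ?_
  obtain ⟨a₀, ha₀, rfl⟩ := Finset.mem_image.1 hb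
  have hfib : (B.filter fun a => key a = key a₀) =
      (Q.filter fun x => ρ x = ρ (a₀ j)).image (Function.update a₀ j) := by
    ext a
    simp only [Finset.mem_filter, Finset.mem_image, key, Prod.mk.injEq]
    constructor
    · rintro ⟨ha, h1, h2⟩
      refine ⟨a j, ⟨Fintype.mem_piFinset.1 ha j, h2⟩, ?_⟩
      have := congrArg (fun f => Function.update f j (a j)) h1
      simpa using this.symm
    · rintro ⟨x, ⟨hx, hρ⟩, rfl⟩
      refine ⟨Fintype.mem_piFinset.2 fun i => ?_, by simp, by simpa using hρ⟩
      by_cases hi : i = j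
      · subst hi
        simpa using hx
      · simpa [hi] using Fintype.mem_piFinset.1 ha₀ i
  rw [hfib, Finset.sum_image fun x _ y _ h => by simpa using congrFun h j,
    Finset.sum_congr rfl fun x hx => by rw [hX a₀ x (Finset.mem_filter.1 hx).2],
    ← Finset.sum_smul, hc a₀ ha₀, zero_smul]

variable (p : ℕ) [Fact p.Prime] {V : Type*} [AddCommGroup V] [Module ℚ V]
variable (L : Submodule ℤ V) [L.IsLattice ℚ]

/-- The half-open parallelepiped attached to `u` has finitely many points in the support of a
function supported on a lattice. -/
theorem finite_cell_support {r : ℕ} {u : Fin r → V} (hu : LinearIndependent ℚ u) {N : ℕ}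
    (hN : 0 < N) {F : V → ℤ} (hF : ∀ v, F v ≠ 0 → N • v ∈ L) :
    {a : Fin r → ℚ | (∀ i, a i ∈ Set.Ioc (0 : ℚ) 1) ∧
      F (Fintype.linearCombination ℚ u a) ≠ 0}.Finite := by
  refine Set.Finite.of_finite_image (f := Fintype.linearCombination ℚ u)
    ((finite_cell_inter L hN u).subset ?_)
    (linearIndependent_iff_injective_fintypeLinearCombination.1 hu).injOn
  rintro _ ⟨a, ⟨ha, h⟩, rfl⟩
  exact ⟨⟨a, fun i => ⟨(ha i).1, fun _ => (ha i).2⟩, Fintype.linearCombination_apply _ _ _⟩, hF _ h⟩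

/-- If the sums of `F` over the `p`-adic classes on all segments in the directions `u_i` vanish,
then `∑ F(v) δ_v`, summed over the half-open parallelepiped, is divisible by `∏ (δ_0 - δ_{u_i})`. -/
theorem prod_one_sub_diracLoc_dvd {r : ℕ} {u : Fin r → V}
    (huL : ∀ i, u i ∈ globalPoints p L) {F : V → ℤ}
    (hvan : ∀ i (y : V) (c : ℚ), ∑ᶠ x ∈ Set.Ioc 0 1 ∩ {x : ℚ | ‖((x - c : ℚ) : ℚ_[p])‖ ≤ 1},
      F (y + x • u i) = 0)
    (A : Finset (Fin r → ℚ)) (hA : ∀ a, a ∈ A ↔ (∀ i, a i ∈ Set.Ioc (0 : ℚ) 1) ∧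
      F (Fintype.linearCombination ℚ u a) ≠ 0) :
    ∏ i, (1 - diracLoc p L (u i)) ∣ ∑ a ∈ A,
      F (Fintype.linearCombination ℚ u a) • diracLoc p L (Fintype.linearCombination ℚ u a) := by
  classical
  obtain ⟨ρ, hρ, hρρ⟩ := exists_classRep p
  set pt := Fintype.linearCombination ℚ u with hpt
  -- `Q` collects all coordinates of the support points, so `A` sits in the box `Q^r`. The added
  -- points carry the coefficient `0`, and a box can be summed one coordinate at a time.
  let Q : Finset ℚ := A.biUnion fun a => Finset.univ.image a
  have hQ : ∀ x ∈ Q, x ∈ Set.Ioc (0 : ℚ) 1 := by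
    intro x hx
    obtain ⟨a, ha, hx⟩ := Finset.mem_biUnion.1 hx
    obtain ⟨i, -, rfl⟩ := Finset.mem_image.1 hx
    exact ((hA a).1 ha).1 i
  have hAQ : ∀ a ∈ A, ∀ i, a i ∈ Q := fun a ha i =>
    Finset.mem_biUnion.2 ⟨a, ha, Finset.mem_image_of_mem a (Finset.mem_univ i)⟩
  set B := Fintype.piFinset fun _ : Fin r => Q with hB
  have hupd : ∀ (a : Fin r → ℚ) j x,
      pt (Function.update a j x) = pt (Function.update a j 0) + x • u j := by
    intro a j x
    have e : Function.update a j x = Function.update a j 0 + Pi.single j x := by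
      ext i
      by_cases hi : i = j
      · subst hi
        simp
      · simp [hi]
    rw [e, map_add, hpt, Fintype.linearCombination_apply_single]
  have hAB : ∀ X : (Fin r → ℚ) → PadicMeasure p (localLattice p L),
      ∑ a ∈ A, F (pt a) • X a = ∑ a ∈ B, F (pt a) • X a := by
    intro X
    refine Finset.sum_subset (fun a ha => Fintype.mem_piFinset.2 (hAQ a ha)) fun a ha haA => ?_
    have : F (pt a) = 0 := by
      by_contra h
      exact haA ((hA a).2 ⟨fun i => hQ _ (Fintype.mem_piFinset.1 ha i), h⟩)
    rw [this, zero_smul]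
  -- The vanishing sum runs over a whole class in `(0, 1]`, but a parameter where `F` is nonzero
  -- gives a point of `A`, hence lies in `Q`.
  have hclass : ∀ j, ∀ a ∈ B, ∑ x ∈ Q with ρ x = ρ (a j), F (pt (Function.update a j x)) = 0 := by
    intro j a ha
    rw [← hvan j (pt (Function.update a j 0)) (a j)]
    symm
    rw [Finset.sum_congr rfl fun x _ => congrArg F (hupd a j x)]
    refine finsum_mem_eq_sum_of_inter_support_eq _ ?_
    ext x
    simp only [Set.mem_inter_iff, Set.mem_ofPred_eq, Finset.coe_filter, Function.mem_support, hρ]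
    constructor
    · rintro ⟨⟨hx1, hx2⟩, hx3⟩
      refine ⟨⟨?_, hx2⟩, hx3⟩
      rw [← hupd] at hx3
      have hmem : Function.update a j x ∈ A := by
        refine (hA _).2 ⟨fun i => ?_, hx3⟩
        by_cases hi : i = j
        · subst hi
          simpa using hx1
        · simpa [hi] using hQ _ (Fintype.mem_piFinset.1 ha i)
      simpa using hAQ _ hmem j
    · rintro ⟨⟨hx1, hx2⟩, hx3⟩
      exact ⟨⟨hQ x hx1, hx2⟩, hx3⟩
  let E : Fin r → ℚ → PadicMeasure p (localLattice p L) := fun i x =>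
    diracLoc p L ((x - ρ x) • u i)
  -- `X T` interpolates between `δ` at the point itself (`T = ∅`) and a product visibly divisible by
  -- `∏ (δ_0 - δ_{u i})` (`T = univ`). The common factor `δ` at the representatives depends only on
  -- the classes.
  let X : Finset (Fin r) → (Fin r → ℚ) → PadicMeasure p (localLattice p L) := fun T a =>
    diracLoc p L (pt (ρ ∘ a)) * ∏ i, if i ∈ T then E i (a i) - 1 else E i (a i)
  have hX0 : ∀ a, X ∅ a = diracLoc p L (pt a) := by
    intro a
    have e : pt a = pt (ρ ∘ a) + ∑ i, (a i - ρ (a i)) • u i := by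
      rw [hpt, Fintype.linearCombination_apply, Fintype.linearCombination_apply,
        ← Finset.sum_add_distrib]
      refine Finset.sum_congr rfl fun i _ => ?_
      rw [← add_smul, Function.comp_apply, add_sub_cancel]
    rw [e, diracLoc_add_sum _ _ fun i => smul_mem_globalPoints (huL i) (hρρ _)]
    simp [X, E]
  have hstep : ∀ T, ∑ a ∈ B, F (pt a) • X T a = ∑ a ∈ B, F (pt a) • X ∅ a := by
    intro T
    induction T using Finset.induction_on with
    | empty => rfl
    | insert j T hj ih =>
      rw [← ih, ← sub_eq_zero, ← Finset.sum_sub_distrib]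
      simp only [← smul_sub]
      refine sum_piFinset_smul_eq_zero Q ρ j (fun a => F (pt a)) _ ?_ (hclass j)
      -- Passing from `E_j` to `E_j - 1` changes the product by minus the product without its `j`-th
      -- factor. This depends on `a j` only through its class, so its weighted sum vanishes.
      have hXj : ∀ a, X (insert j T) a - X T a = -(diracLoc p L (pt (ρ ∘ a)) *
          ∏ i ∈ Finset.univ.erase j, if i ∈ T then E i (a i) - 1 else E i (a i)) := by
        intro a
        simp only [X]
        rw [← Finset.mul_prod_erase _ _ (Finset.mem_univ j),
          ← Finset.mul_prod_erase _ _ (Finset.mem_univ j), if_pos (Finset.mem_insert_self j T),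
          if_neg hj, Finset.prod_congr rfl (g := fun i => if i ∈ T then E i (a i) - 1 else E i (a i))]
        · ring
        · intro i hi
          simp [Finset.ne_of_mem_erase hi]
      intro a x hx
      rw [hXj, hXj]
      congr 2
      · congr 2
        ext i
        by_cases hi : i = j
        · subst hi
          simpa using hx
        · simp [hi]
      · refine Finset.prod_congr rfl fun i hi => ?_
        rw [Function.update_of_ne (Finset.ne_of_mem_erase hi)]
  rw [hAB]
  simp only [← hX0]
  rw [← hstep Finset.univ]
  refine Finset.dvd_sum fun a _ => ?_
  rw [zsmul_eq_mul]
  refine Dvd.dvd.mul_left (Dvd.dvd.mul_left (Finset.prod_dvd_prod_of_dvd _ _ fun i _ => ?_) _) _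
  rw [if_pos (Finset.mem_univ i), dvd_sub_comm]
  exact one_sub_diracLoc_dvd (huL i) (hρρ _)

/-- Multiplying the formal sum over an open cone by the `δ_0 - δ_{u_i}` gives the formal sum over
the half-open parallelepiped. -/
theorem exists_formalDiffs_openCone {r : ℕ} {u : Fin r → V} (hu : LinearIndependent ℚ u)
    (huL : ∀ i, u i ∈ globalPoints p L) {f : V → ℤ}
    (hper : ∀ v i, extendTest p L f (v - u i) = extendTest p L f v) :
    ∃ us : List (globalPoints p L), (∀ x ∈ us, x ≠ 0) ∧
      (us.map fun x => PadicMeasure.dirac p 0 - diracAt p L x).prod =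
        ∏ i, (1 - diracLoc p L (u i)) ∧
      formalDiffs us (coneSum p L f (charFn (openCone u))) =
        coneSum p L f (charFn (cell u Finset.univ)) := by
  classical
  suffices H : ∀ s : Finset (Fin r), ∃ us : List (globalPoints p L), (∀ x ∈ us, x ≠ 0) ∧
      (us.map fun x => PadicMeasure.dirac p 0 - diracAt p L x).prod =
        ∏ i ∈ s, (1 - diracLoc p L (u i)) ∧
      formalDiffs us (coneSum p L f (charFn (openCone u))) =
        coneSum p L f (charFn (cell u s)) from H Finset.univ
  intro s
  induction s using Finset.induction_on with
  | empty => exact ⟨[], by simp, by simp, by rw [openCone_eq_cell]; rfl⟩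
  | insert j s hj ih =>
    obtain ⟨us, hus, hprod, h⟩ := ih
    refine ⟨⟨u j, huL j⟩ :: us, ?_, ?_, ?_⟩
    · intro y hy
      rcases List.mem_cons.1 hy with rfl | hy
      · intro h0
        exact hu.ne_zero j (congrArg Subtype.val h0)
      · exact hus y hy
    · rw [List.map_cons, List.prod_cons, hprod, Finset.prod_insert hj, ← diracLoc_coe,
        PadicMeasure.one_def]
    -- `u j` is a period of the weight, so the difference operator acts on the characteristic
    -- function alone and truncates the `j`-th coordinate to `(0, 1]`.
    · refine (congrArg (formalDiff ⟨u j, huL j⟩) h).trans ?_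
      ext v
      change extendTest p L f v.1 * _ - extendTest p L f (v.1 - u j) * _ = _
      rw [hper, ← mul_sub]
      congr 1
      exact charFn_cell_sub hu hj v.1

/-- Under the vanishing condition for the directions `u_i`, the formal sum over the open cone spanned
by the `u_i` represents a measure. -/
theorem exists_represents_measure_openCone {r : ℕ} {u : Fin r → V} (hu : LinearIndependent ℚ u)
    (huL : ∀ i, u i ∈ globalPoints p L) {f : V → ℤ}
    (hper : ∀ v i, extendTest p L f (v - u i) = extendTest p L f v)
    {N : ℕ} (hN : 0 < N) (hsupp : ∀ v, extendTest p L f v ≠ 0 → N • v ∈ L)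
    (hvan : ∀ i (y : V) (c : ℚ), ∑ᶠ x ∈ Set.Ioc 0 1 ∩ {x : ℚ | ‖((x - c : ℚ) : ℚ_[p])‖ ≤ 1},
      extendTest p L f (y + x • u i) = 0) :
    ∃ μ : PadicMeasure p (localLattice p L),
      Represents p L (coneSum p L f (charFn (openCone u))) (algebraMap _ _ μ) := by
  classical
  obtain ⟨us, hus, hprod, hdiff⟩ := exists_formalDiffs_openCone p L hu huL hper
  have hfin := finite_cell_support L hu hN hsupp
  set pt := Fintype.linearCombination ℚ u with hpt
  have hinj : Function.Injective pt := linearIndependent_iff_injective_fintypeLinearCombination.1 hu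
  have hcell : ∀ a : Fin r → ℚ, pt a ∈ cell u Finset.univ ↔ ∀ i, a i ∈ Set.Ioc (0 : ℚ) 1 := by
    intro a
    rw [hpt, Fintype.linearCombination_apply, mem_cell_iff hu]
    simp
  obtain ⟨μ, hμ⟩ := prod_one_sub_diracLoc_dvd p L huL hvan hfin.toFinset
    fun a => hfin.mem_toFinset
  have hpt_mem : ∀ a, extendTest p L f (pt a) ≠ 0 → pt a ∈ globalPoints p L := by
    intro a ha
    by_contra h
    refine ha ?_
    rw [extendTest, latticeIndicator, if_neg (mt (mem_globalPoints p).2 h), mul_zero]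
  -- The sum over the parallelepiped as a finite formal sum. `attach` keeps the proof that `F` is
  -- nonzero at the point, which places the point in `L_p`.
  let h : globalPoints p L →₀ ℤ := ∑ a ∈ hfin.toFinset.attach,
    Finsupp.single ⟨pt a.1, hpt_mem _ (hfin.mem_toFinset.1 a.2).2⟩ (extendTest p L f (pt a.1))
  have hmeas : finiteMeasure p L h = ∑ a ∈ hfin.toFinset,
      extendTest p L f (pt a) • diracLoc p L (pt a) := by
    rw [← Finset.sum_attach]
    have : ∀ s : Finset hfin.toFinset, finiteMeasure p L (∑ a ∈ s,
        Finsupp.single ⟨pt a.1, hpt_mem _ (hfin.mem_toFinset.1 a.2).2⟩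
          (extendTest p L f (pt a.1))) =
        ∑ a ∈ s, extendTest p L f (pt a.1) • diracLoc p L (pt a.1) := by
      intro s
      induction s using Finset.induction_on with
      | empty => rfl
      | insert a s ha ih =>
        rw [Finset.sum_insert ha, Finset.sum_insert ha, finiteMeasure_add, ih,
          finiteMeasure_single, ← diracLoc_coe]
    exact this _
  have hcone : coneSum p L f (charFn (cell u Finset.univ)) = h := by
    ext v
    rw [Finsupp.finsetSum_apply]
    by_cases hv : ∃ a ∈ hfin.toFinset, pt a = v.1
    · obtain ⟨a, ha, hav⟩ := hv
      rw [Finset.sum_eq_single ⟨a, ha⟩]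
      · have e : (⟨pt a, hpt_mem _ (hfin.mem_toFinset.1 ha).2⟩ : globalPoints p L) = v :=
          Subtype.ext hav
        rw [e, Finsupp.single_eq_same, coneSum, ← hav,
          charFn_of_mem ((hcell a).2 (hfin.mem_toFinset.1 ha).1), mul_one]
      · intro b _ hb
        refine Finsupp.single_eq_of_ne fun e => hb (Subtype.ext (hinj ?_))
        exact (congrArg Subtype.val e).symm.trans hav.symm
      · exact fun h => absurd (Finset.mem_attach _ _) h
    · rw [Finset.sum_eq_zero]
      · rw [coneSum]
        by_contra hne
        have h1 := left_ne_zero_of_mul hne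
        have h2 : v.1 ∈ cell u Finset.univ := by
          by_contra h2
          exact right_ne_zero_of_mul hne (charFn_of_notMem h2)
        obtain ⟨a, ha, hav⟩ := id h2
        have hav' : pt a = v.1 := (Fintype.linearCombination_apply ℚ u a).trans hav.symm
        rw [← hav'] at h1 h2
        exact hv ⟨a, hfin.mem_toFinset.2 ⟨(hcell a).1 h2, h1⟩, hav'⟩
      · intro a _
        refine Finsupp.single_eq_of_ne fun e => hv ⟨a.1, a.2, ?_⟩
        exact (congrArg Subtype.val e).symm
  -- The quotient of the finite measure by `∏ (δ_0 - δ_{u i})` exists already among measures, and it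
  -- satisfies the equation that defines the represented pseudo-measure.
  refine ⟨μ, us, hus, h, hdiff.trans hcone, ?_⟩
  rw [← map_mul, hprod, hmeas, hμ]

end ConeMeasure

/-! ### Leading coefficients in the iterated Laurent series field -/

section LeadCoeff

theorem leadCoeff_ratCast (n : ℕ) (q : ℚ) : leadCoeff n (q : HillField n) = q := by
  induction n with
  | zero => simp [leadCoeff]
  | succ n ih =>
    have h : (toLaurent n) (q : HillField (n + 1)) = HahnSeries.C (q : HillField n) := by
      rw [map_ratCast, map_ratCast]
    rw [leadCoeff, h, HahnSeries.C_apply, HahnSeries.leadingCoeff_of_single, ih]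

theorem leadCoeff_mul {n : ℕ} (x y : HillField n) :
    leadCoeff n (x * y) = leadCoeff n x * leadCoeff n y := by
  induction n with
  | zero => simp [leadCoeff]
  | succ n ih => rw [leadCoeff, map_mul, HahnSeries.leadingCoeff_mul, ih]; rfl

theorem toLaurent_eps_castSucc (n : ℕ) (j : Fin n) :
    toLaurent n (eps (n + 1) j.castSucc) = HahnSeries.C (eps n j) := by
  simp [eps]

theorem toLaurent_eps_last (n : ℕ) :
    toLaurent n (eps (n + 1) (Fin.last n)) = HahnSeries.single 1 1 := by
  simp [eps]

/-- Sorting a polynomial by the exponent of the last variable, which is the Laurent variable of the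
outermost field; this is the inductive step for `leadCoeff_sum`. -/
theorem toLaurent_sum {n N : ℕ} (c : (Fin (n + 1) → Fin N) → ℚ) :
    toLaurent n (∑ r, (c r : HillField (n + 1)) * ∏ i, eps (n + 1) i ^ (r i : ℕ)) =
      ∑ m : Fin N, HahnSeries.single (m : ℤ) (∑ r : Fin n → Fin N,
        (c (Fin.snoc r m) : HillField n) * ∏ i, eps n i ^ (r i : ℕ)) := by
  have h1 : ∀ m : Fin N, ∀ r : Fin n → Fin N,
      toLaurent n ((c (Fin.snoc r m) : HillField (n + 1)) *
        ∏ i, eps (n + 1) i ^ ((Fin.snoc r m : Fin (n + 1) → Fin N) i : ℕ)) =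
      HahnSeries.single (m : ℤ) ((c (Fin.snoc r m) : HillField n) * ∏ i, eps n i ^ (r i : ℕ)) := by
    intro m r
    rw [Fin.prod_univ_castSucc]
    simp only [Fin.snoc_castSucc, Fin.snoc_last, map_mul, map_prod, map_pow,
      toLaurent_eps_castSucc, toLaurent_eps_last, map_ratCast, HahnSeries.single_pow, one_pow]
    have h2 : ((c (Fin.snoc r m) : ℚ) : LaurentSeries (HillField n)) =
        HahnSeries.C (c (Fin.snoc r m) : HillField n) := (map_ratCast _ _).symm
    rw [h2, ← mul_assoc]
    simp only [← map_pow, ← map_prod]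
    rw [← map_mul, HahnSeries.C_apply, HahnSeries.single_mul_single, zero_add, mul_one,
      nsmul_eq_mul, mul_one]
  rw [← (Fin.snocEquiv fun _ => Fin N).sum_comp, Fintype.sum_prod_type, map_sum]
  refine Finset.sum_congr rfl fun m _ => ?_
  rw [map_sum]
  refine (Finset.sum_congr rfl fun r _ => h1 m r).trans ?_
  exact (map_sum (HahnSeries.single.addMonoidHom (Γ := ℤ) (R := HillField n) (m : ℤ)) _ _).symm

theorem coeff_sum_single {R : Type*} [AddCommMonoid R] {N : ℕ} (P : Fin N → R) (g : Fin N) :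
    (∑ m : Fin N, HahnSeries.single (m : ℤ) (P m)).coeff (g : ℤ) = P g := by
  rw [HahnSeries.coeff_sum, Finset.sum_eq_single g]
  · exact HahnSeries.coeff_single_same _ _
  · intro m _ hm
    refine HahnSeries.coeff_single_of_ne fun h => hm ?_
    exact Fin.ext (by exact_mod_cast h.symm)
  · simp

theorem coeff_sum_single_of_ne {R : Type*} [AddCommMonoid R] {N : ℕ} (P : Fin N → R) {g : ℤ}
    (h : ∀ m : Fin N, g ≠ m) : (∑ m : Fin N, HahnSeries.single (m : ℤ) (P m)).coeff g = 0 := by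
  rw [HahnSeries.coeff_sum]
  exact Finset.sum_eq_zero fun m _ => HahnSeries.coeff_single_of_ne (h m)

/-- The leading coefficient of a polynomial in the `ε_i` is its coefficient at the smallest
exponent in the colexicographic order. -/
theorem leadCoeff_sum {n N : ℕ} (c : (Fin n → Fin N) → ℚ) (r₀ : Fin n → Fin N) (h₀ : c r₀ ≠ 0)
    (hmin : ∀ r, c r ≠ 0 → ¬ toColex r < toColex r₀) :
    leadCoeff n (∑ r, (c r : HillField n) * ∏ i, eps n i ^ (r i : ℕ)) = c r₀ := by
  induction n with
  | zero =>
    rw [Fintype.sum_unique, Fintype.prod_empty, mul_one, leadCoeff_ratCast]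
    exact congrArg c (Subsingleton.elim _ _)
  | succ n ih =>
    -- The leading term minimises the last exponent first, and so does the colexicographic order.
    -- Hence no term with last exponent below `m₀` occurs, and the coefficient at `m₀` is handled by
    -- induction.
    set m₀ := r₀ (Fin.last n) with hm₀
    have hsnoc : (Fin.snoc (Fin.init r₀) m₀ : Fin (n + 1) → Fin N) = r₀ := Fin.snoc_init_self r₀
    have hlead := ih (fun r => c (Fin.snoc r m₀)) (Fin.init r₀) (by rwa [hsnoc]) (by
      intro r hr
      rintro ⟨k, hk, hlt⟩
      refine hmin _ hr ⟨k.castSucc, fun j hj => ?_, ?_⟩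
      · induction j using Fin.lastCases with
        | last => simp [hm₀]
        | cast j =>
          simpa [Fin.init] using hk j (by simpa using hj)
      · simpa [Fin.init] using hlt)
    rw [hsnoc] at hlead
    set P : Fin N → HillField n := fun m => ∑ r : Fin n → Fin N,
        (c (Fin.snoc r m) : HillField n) * ∏ i, eps n i ^ (r i : ℕ) with hP
    have hP₀ : P m₀ ≠ 0 := by
      rw [← leadCoeff_eq_zero.ne, hlead]
      exact h₀
    have hPlt : ∀ m < m₀, P m = 0 := by
      intro m hm
      refine Finset.sum_eq_zero fun r _ => ?_
      have : c (Fin.snoc r m) = 0 := by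
        by_contra hr
        refine hmin _ hr ⟨Fin.last n, fun j hj => absurd hj (Fin.le_last j).not_gt, ?_⟩
        simpa using hm
      rw [this, Rat.cast_zero, zero_mul]
    have hcoeff := coeff_sum_single P m₀
    rw [leadCoeff, toLaurent_sum, leadingCoeff_eq_of_coeff (g := (m₀ : ℤ)), hcoeff]
    · exact hlead
    · rw [hcoeff]
      exact hP₀
    · intro k hk
      by_cases h : ∃ m : Fin N, k = m
      · obtain ⟨m, rfl⟩ := h
        rw [coeff_sum_single]
        exact hPlt m (Fin.lt_def.2 (by exact_mod_cast hk))
      · push Not at h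
        exact coeff_sum_single_of_ne _ h

end LeadCoeff

/-! ### Determinants -/

section Determinants

variable {V : Type*} [AddCommGroup V] [Module ℚ V] {n : ℕ}
variable (w : Module.Basis (Fin n) ℚ V)

theorem det_baseChange_one_tmul (K : Type*) [Field K] [Algebra ℚ K] (y : Fin n → V) :
    (w.baseChange K).det (fun i => (1 : K) ⊗ₜ[ℚ] y i) = algebraMap ℚ K (w.det y) := by
  rw [Module.Basis.det_apply, Module.Basis.det_apply, RingHom.map_det]
  congr 1
  ext i j
  simp [Module.Basis.toMatrix_apply, Algebra.smul_def]

/-- Multilinearity: the `i`-th vector involves only powers of `ε_i`, so different choices of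
exponents give different monomials, each with a rational determinant as its coefficient. -/
theorem det_sum_eps {N : ℕ} (Y : Fin n → Fin N → V) :
    (w.baseChange (HillField n)).det (fun i => ∑ k : Fin N, (eps n i ^ (k : ℕ)) ⊗ₜ[ℚ] Y i k) =
      ∑ r : Fin n → Fin N, ((w.det fun i => Y i (r i) : ℚ) : HillField n) *
        ∏ i, eps n i ^ (r i : ℕ) := by
  have h1 : ∀ i (k : Fin N), (eps n i ^ (k : ℕ)) ⊗ₜ[ℚ] Y i k =
      (eps n i ^ (k : ℕ)) • ((1 : HillField n) ⊗ₜ[ℚ] Y i k) := by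
    intro i k
    rw [TensorProduct.smul_tmul', smul_eq_mul, mul_one]
  simp only [h1]
  have h2 := (w.baseChange (HillField n)).det.toMultilinearMap.map_sum
    (fun i (k : Fin N) => (eps n i ^ (k : ℕ)) • ((1 : HillField n) ⊗ₜ[ℚ] Y i k))
  refine h2.trans (Finset.sum_congr rfl fun r _ => ?_)
  have h3 := (w.baseChange (HillField n)).det.toMultilinearMap.map_smul_univ
    (fun i => eps n i ^ (r i : ℕ)) (fun i => (1 : HillField n) ⊗ₜ[ℚ] Y i (r i))
  refine h3.trans ?_
  have h4 := det_baseChange_one_tmul w (HillField n) fun i => Y i (r i)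
  rw [smul_eq_mul, mul_comm]
  congr 1

theorem leadCoeff_det {N : ℕ} (Y : Fin n → Fin N → V) (r₀ : Fin n → Fin N)
    (h₀ : (w.det fun i => Y i (r₀ i)) ≠ 0)
    (hmin : ∀ r : Fin n → Fin N, (w.det fun i => Y i (r i)) ≠ 0 → ¬ toColex r < toColex r₀) :
    leadCoeff n ((w.baseChange (HillField n)).det
      fun i => ∑ k : Fin N, (eps n i ^ (k : ℕ)) ⊗ₜ[ℚ] Y i k) = w.det fun i => Y i (r₀ i) := by
  rw [det_sum_eps]
  exact leadCoeff_sum _ r₀ h₀ hmin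

end Determinants

/-! ### The faces of Hill's cone -/

section HillFaces

variable {V : Type*} [AddCommGroup V] [Module ℚ V] {n : ℕ}
variable (w : Module.Basis (Fin n) ℚ V) (α : Fin n → (V ≃ₗ[ℚ] V))

theorem hillFamily_eq (i : Fin n) :
    hillFamily w α i = ∑ k : Fin n, (eps n i ^ (k : ℕ)) ⊗ₜ[ℚ] α i (w k) := by
  simp [hillFamily, hillVector]

/-- The numerator in Cramer's rule for the `j`-th coordinate of `x` in the basis `α_i b_i`. -/
noncomputable def cramerNum (j : Fin n) (x : V) : HillField n :=
  (w.baseChange (HillField n)).det (Function.update (hillFamily w α) j ((1 : HillField n) ⊗ₜ[ℚ] x))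

/-- The coefficient of `∏ ε_i^{r_i}` in the numerator of Cramer's rule. -/
noncomputable def cramerCoeff [NeZero n] (j : Fin n) (r : Fin n → Fin n) : V →ₗ[ℚ] ℚ :=
  if r j = 0 then w.det.toMultilinearMap.toLinearMap (fun i => α i (w (r i))) j else 0

variable {w α}

theorem cramerCoeff_apply [NeZero n] (j : Fin n) (r : Fin n → Fin n) (x : V) :
    cramerCoeff w α j r x =
      if r j = 0 then w.det (Function.update (fun i => α i (w (r i))) j x) else 0 := by
  unfold cramerCoeff
  split_ifs <;> rfl

theorem leadCoeff_cramerNum [NeZero n] (j : Fin n) (x : V) (r₀ : Fin n → Fin n)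
    (h₀ : cramerCoeff w α j r₀ x ≠ 0)
    (hmin : ∀ r, cramerCoeff w α j r x ≠ 0 → ¬ toColex r < toColex r₀) :
    leadCoeff n (cramerNum w α j x) = cramerCoeff w α j r₀ x := by
  -- The replaced vector `1 ⊗ x` is regarded as a polynomial in `ε_j` with constant term `x` only.
  -- This fits `leadCoeff_det` and explains the condition `r j = 0` in `cramerCoeff`.
  let Y : Fin n → Fin n → V := Function.update (fun i k => α i (w k)) j (Pi.single 0 x)
  have hY : ∀ r : Fin n → Fin n, (w.det fun i => Y i (r i)) = cramerCoeff w α j r x := by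
    intro r
    rw [cramerCoeff_apply]
    split_ifs with h
    · congr 1
      ext i
      by_cases hi : i = j
      · subst hi
        simp [Y, h]
      · simp [Y, hi]
    · refine w.det.map_coord_zero j ?_
      simp [Y, h]
  have h := leadCoeff_det w Y r₀ (by rwa [hY]) (fun r hr => hmin r (by rwa [hY] at hr))
  rw [hY] at h
  rw [← h, cramerNum]
  congr 2
  ext i
  by_cases hi : i = j
  · subst hi
    rw [Function.update_self, Finset.sum_eq_single 0]
    · simp [Y]
    · intro k _ hk
      simp [Y, hk]
    · simp
  · rw [Function.update_of_ne hi, hillFamily_eq]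
    simp [Y, hi]

theorem not_toColex_lt_zero [NeZero n] (r : Fin n → Fin n) : ¬ toColex r < toColex 0 := by
  rintro ⟨k, -, hk⟩
  exact absurd hk (Fin.not_lt_zero _)

/-- If `r i = 0`, the vector `α i (w 0)` stands both at place `i` and at place `j`. Thus `α i (w 0)`
contributes to the `j`-th coordinate only through monomials divisible by `ε_i`. -/
theorem cramerCoeff_basis_eq_zero [NeZero n] {i j : Fin n} (hij : i ≠ j) {r : Fin n → Fin n}
    (hr : r i = 0) : cramerCoeff w α j r (α i (w 0)) = 0 := by
  rw [cramerCoeff_apply]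
  split_ifs
  · refine w.det.map_eq_zero_of_eq _ ?_ hij
    simp [hij, hr]
  · rfl

theorem det_ne_zero_of_linearIndependent {b : Fin n → V} (hb : LinearIndependent ℚ b) :
    w.det b ≠ 0 := by
  have : FiniteDimensional ℚ V := Module.Basis.finiteDimensional_of_finite w
  refine (w.is_basis_iff_det.1 ⟨hb, ?_⟩).ne_zero
  exact hb.span_eq_top_of_card_eq_finrank' (Module.finrank_eq_card_basis w).symm

/-- Non-degeneracy makes the constant term of the determinant nonzero, and the exponent `0` is the
smallest. -/
theorem leadCoeff_det_hillFamily [NeZero n] (hα : LinearIndependent ℚ fun i => α i (w 0)) :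
    leadCoeff n ((w.baseChange (HillField n)).det (hillFamily w α)) =
      w.det fun i => α i (w 0) := by
  have h := leadCoeff_det w (fun i k => α i (w k)) 0 (det_ne_zero_of_linearIndependent hα)
    fun r _ => not_toColex_lt_zero r
  have h2 : (fun i => ∑ k : Fin n, (eps n i ^ (k : ℕ)) ⊗ₜ[ℚ] α i (w k)) = hillFamily w α :=
    funext fun i => (hillFamily_eq w α i).symm
  rw [h2] at h
  exact h

/-- A nonzero unperturbed coordinate already appears in the constant term, so the perturbation
cannot change its sign. -/
theorem leadCoeff_cramerNum_of_ne_zero [NeZero n] (hα : LinearIndependent ℚ fun i => α i (w 0))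
    {j : Fin n} {a : Fin n → ℚ} (hj : a j ≠ 0) :
    leadCoeff n (cramerNum w α j (∑ i, a i • α i (w 0))) = a j * w.det fun i => α i (w 0) := by
  have h : cramerCoeff w α j 0 (∑ i, a i • α i (w 0)) = a j * w.det fun i => α i (w 0) := by
    rw [map_sum, Finset.sum_eq_single j]
    · rw [map_smul, cramerCoeff_apply, if_pos (Pi.zero_apply j), smul_eq_mul]
      congr 2
      exact Function.update_eq_self j fun i => α i (w 0)
    · intro i _ hi
      rw [map_smul, cramerCoeff_basis_eq_zero hi rfl, smul_zero]
    · simp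
  rw [leadCoeff_cramerNum j _ 0 _ fun r _ => not_toColex_lt_zero r, h]
  rw [h]
  exact mul_ne_zero hj (det_ne_zero_of_linearIndependent hα)

/-- Otherwise, with `α i₀ (w 0)` at place `j`, the determinant would vanish for every vector `α i₀
(w m)` at place `i₀`, hence for every vector of `V`. Inserting `α j (w 0)` there gives a
transposition of an independent family, whose determinant is nonzero. -/
theorem exists_cramerCoeff_single_ne_zero [NeZero n]
    (hα : LinearIndependent ℚ fun i => α i (w 0)) {i₀ j : Fin n} (hij : i₀ ≠ j) :
    ∃ m, cramerCoeff w α j (Pi.single i₀ m) (α i₀ (w 0)) ≠ 0 := by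
  by_contra hcon
  push Not at hcon
  set b : Fin n → V := fun i => α i (w 0) with hb
  have h1 : ∀ m, w.det (Function.update (Function.update b j (b i₀)) i₀ (α i₀ (w m))) = 0 := by
    intro m
    rw [← hcon m, cramerCoeff_apply, if_pos (by simp [hij.symm])]
    congr 1
    ext i
    by_cases hi : i = i₀
    · subst hi
      simp [hij]
    · by_cases hi' : i = j
      · subst hi'
        simp [hi, hb]
      · simp [hi, hi', hb]
  have h2 : ∀ x, w.det (Function.update (Function.update b j (b i₀)) i₀ x) = 0 := by
    have h3 : w.det.toMultilinearMap.toLinearMap (Function.update b j (b i₀)) i₀ = 0 :=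
      (w.map (α i₀)).ext fun m => by simpa using h1 m
    exact fun x => LinearMap.congr_fun h3 x
  have h4 : Function.update (Function.update b j (b i₀)) i₀ (b j) = b ∘ Equiv.swap i₀ j := by
    ext i
    by_cases hi : i = i₀
    · subst hi
      simp
    · by_cases hi' : i = j
      · subst hi'
        simp [hi]
      · simp [hi, hi', Equiv.swap_apply_of_ne_of_ne]
  have h5 := h2 (b j)
  rw [h4, w.det.map_swap b hij, neg_eq_zero] at h5
  exact det_ne_zero_of_linearIndependent hα h5

/-- When the `j`-th unperturbed coordinate vanishes, the first nonzero one, at `i₀`, decides the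
sign of the perturbed one. A term from `i > i₀` carries a positive power of `ε_i`, so it is
infinitely smaller than the leading term from `i₀`, which involves no `ε_k` with `k > i₀`. The
factor `τ` does not depend on `a`. -/
theorem exists_leadCoeff_cramerNum_eq [NeZero n] (hα : LinearIndependent ℚ fun i => α i (w 0))
    {i₀ j : Fin n} (hij : i₀ ≠ j) :
    ∃ τ : ℚ, ∀ a : Fin n → ℚ, a i₀ ≠ 0 → a j = 0 → (∀ i < i₀, a i = 0) →
      leadCoeff n (cramerNum w α j (∑ i, a i • α i (w 0))) = a i₀ * τ := by
  obtain ⟨m, hm⟩ := exists_cramerCoeff_single_ne_zero hα hij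
  have : Finite (Colex (Fin n → Fin n)) := inferInstanceAs (Finite (Fin n → Fin n))
  have hwf : WellFounded fun r s : Fin n → Fin n => toColex r < toColex s :=
    InvImage.wf toColex (Finite.wellFounded_of_trans_of_irrefl _)
  obtain ⟨r₀, hr₀, hmin⟩ := hwf.has_min {r | cramerCoeff w α j r (α i₀ (w 0)) ≠ 0} ⟨_, hm⟩
  -- At the largest index beyond `i₀` where `r₀` is nonzero, the competitor `Pi.single i₀ m` would
  -- be colexicographically smaller than the minimal `r₀`.
  have htail : ∀ k, i₀ < k → r₀ k = 0 := by
    intro k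
    by_contra! hk
    obtain ⟨hk, hne⟩ := hk
    have hne' : (Finset.univ.filter fun k => i₀ < k ∧ r₀ k ≠ 0).Nonempty :=
      ⟨k, by simp [hk, hne]⟩
    obtain ⟨l, hl, hmax⟩ := Finset.exists_max_image _ id hne'
    simp only [Finset.mem_filter, Finset.mem_univ, true_and, id] at hl hmax
    refine hmin _ hm ⟨l, fun k hk => ?_, ?_⟩
    · have h0 : r₀ k = 0 := by
        by_contra h
        exact (hmax k ⟨hl.1.trans hk, h⟩).not_gt hk
      simp [h0, (hl.1.trans hk).ne']
    · simpa [hl.1.ne'] using Fin.pos_iff_ne_zero.2 hl.2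
  refine ⟨cramerCoeff w α j r₀ (α i₀ (w 0)), fun a h₀ hj hlt => ?_⟩
  have hcoeff : cramerCoeff w α j r₀ (∑ i, a i • α i (w 0)) =
      a i₀ * cramerCoeff w α j r₀ (α i₀ (w 0)) := by
    rw [map_sum, Finset.sum_eq_single i₀]
    · rw [map_smul, smul_eq_mul]
    · intro i _ hi
      rw [map_smul]
      rcases lt_or_gt_of_ne hi with h | h
      · rw [hlt i h, zero_smul]
      · by_cases hij' : i = j
        · rw [hij', hj, zero_smul]
        · rw [cramerCoeff_basis_eq_zero hij' (htail i h), smul_zero]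
    · simp
  rw [leadCoeff_cramerNum j _ r₀, hcoeff]
  · rw [hcoeff]
    exact mul_ne_zero h₀ hr₀
  · intro r hr hltr
    rw [map_sum] at hr
    obtain ⟨i, -, hi⟩ := Finset.exists_ne_zero_of_sum_ne_zero hr
    rw [map_smul, smul_eq_mul] at hi
    have hai := left_ne_zero_of_mul hi
    have hci := right_ne_zero_of_mul hi
    have hij' : i ≠ j := by
      rintro rfl
      exact hai hj
    have hri : r i ≠ 0 := fun h => hci (cramerCoeff_basis_eq_zero hij' h)
    rcases lt_trichotomy i i₀ with h | rfl | h
    · exact hai (hlt i h)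
    · exact hmin r hci hltr
    -- Here `i > i₀`. An exponent below `r₀` agrees with it above the deciding index, which is at
    -- most `i₀`, so its value at `i` is `r₀ i = 0`; but a contribution from `i` needs a nonzero
    -- value.
    · obtain ⟨k, hk, hlk⟩ := hltr
      have hlk : r k < r₀ k := hlk
      have hki : k < i := by
        by_contra hki
        rw [htail k (h.trans_le (not_lt.1 hki))] at hlk
        exact Fin.not_lt_zero _ hlk
      exact hri ((hk i hki).trans (htail i h))

/-- Cramer's rule writes the `j`-th coordinate as `cramerNum` over the determinant `d`. Leading
coefficients are multiplicative, so its sign is that of the product of both leading coefficients,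
and that of `d` is rational and known. -/
theorem mem_hillCone_iff [NeZero n] (hα : LinearIndependent ℚ fun i => α i (w 0)) (v : V) :
    v ∈ hillCone w α ↔
      ∀ j, 0 < leadCoeff n (cramerNum w α j v) * w.det fun i => α i (w 0) := by
  set d := (w.baseChange (HillField n)).det (hillFamily w α) with hd
  have hlead : leadCoeff n d = w.det fun i => α i (w 0) := leadCoeff_det_hillFamily hα
  have hdet := det_ne_zero_of_linearIndependent (w := w) hα
  have hd0 : d ≠ 0 := by
    rw [← leadCoeff_eq_zero.ne, hlead]
    exact hdet
  obtain ⟨hli, hsp⟩ := (Module.Basis.is_basis_iff_det (w.baseChange (HillField n))).2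
    (isUnit_iff_ne_zero.2 hd0)
  have hcramer : ∀ c : Fin n → HillField n,
      (1 : HillField n) ⊗ₜ[ℚ] v = ∑ i, c i • hillFamily w α i →
      ∀ j, cramerNum w α j v = c j * d := by
    intro c hc j
    rw [cramerNum, hc, AlternatingMap.map_update_sum, Finset.sum_eq_single j]
    · rw [AlternatingMap.map_update_smul, Function.update_eq_self, smul_eq_mul]
    · intro i _ hi
      rw [AlternatingMap.map_update_smul, AlternatingMap.map_update_self _ _ hi.symm, smul_zero]
    · simp
  have hpos : ∀ x : HillField n,
      HillPos x ↔ 0 < leadCoeff n (x * d) * w.det fun i => α i (w 0) := by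
    intro x
    rw [leadCoeff_mul, hlead, mul_assoc]
    exact (mul_pos_iff_of_pos_right (mul_self_pos.2 hdet)).symm
  constructor
  · rintro ⟨c, hc, hv⟩ j
    rw [hcramer c hv j, ← hpos]
    exact hc j
  · intro h
    let B := Module.Basis.mk hli hsp.ge
    have hv : (1 : HillField n) ⊗ₜ[ℚ] v =
        ∑ i, B.repr ((1 : HillField n) ⊗ₜ[ℚ] v) i • hillFamily w α i := by
      conv_lhs => rw [← B.sum_repr ((1 : HillField n) ⊗ₜ[ℚ] v)]
      simp [B]
    refine ⟨_, fun j => ?_, hv⟩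
    rw [hpos, ← hcramer _ hv j]
    exact h j

/-- A nonzero coordinate with respect to the `α i (w 0)` has the same sign as the perturbed
coordinate, so it is positive; the face is given by the support of the coordinates. -/
theorem exists_mem_face_of_mem_hillCone [NeZero n]
    (hα : LinearIndependent ℚ fun i => α i (w 0)) {v : V} (hv : v ∈ hillCone w α) :
    ∃ S, v ∈ face (fun i => α i (w 0)) S := by
  have : FiniteDimensional ℚ V := Module.Basis.finiteDimensional_of_finite w
  have hsp := hα.span_eq_top_of_card_eq_finrank' (Module.finrank_eq_card_basis w).symm
  let B := Module.Basis.mk hα hsp.ge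
  have hv' : v = ∑ i, B.repr v i • α i (w 0) := by
    conv_lhs => rw [← B.sum_repr v]
    simp [B]
  refine ⟨Finset.univ.filter fun i => B.repr v i ≠ 0, B.repr v, fun k => ?_, hv'⟩
  by_cases hk : B.repr v k = 0
  · simp [hk]
  · simp only [Finset.mem_filter, Finset.mem_univ, true_and, hk, ne_eq, not_false_eq_true, if_true]
    have h := (mem_hillCone_iff hα v).1 hv k
    rw [hv', leadCoeff_cramerNum_of_ne_zero hα hk, mul_assoc] at h
    exact (mul_pos_iff_of_pos_right
      (mul_self_pos.2 (det_ne_zero_of_linearIndependent (w := w) hα))).1 h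

/-- All perturbed signs depend only on `S`: for `j` in `S` the sign is positive, for `j` outside it
is that of `τ`, up to a fixed factor, for `i₀ = min S`. If `S` is empty, both points are `0`. -/
theorem mem_hillCone_of_mem_face [NeZero n] (hα : LinearIndependent ℚ fun i => α i (w 0))
    {S : Finset (Fin n)} {v v' : V} (hv : v ∈ face (fun i => α i (w 0)) S)
    (hv' : v' ∈ face (fun i => α i (w 0)) S) (h : v ∈ hillCone w α) : v' ∈ hillCone w α := by
  obtain ⟨a, ha, rfl⟩ := hv
  obtain ⟨a', ha', rfl⟩ := hv'
  have hdet := mul_self_pos.2 (det_ne_zero_of_linearIndependent (w := w) hα)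
  rw [mem_hillCone_iff hα] at h ⊢
  intro j
  have hj := h j
  have haj := ha j
  have haj' := ha' j
  by_cases hjS : j ∈ S
  · rw [if_pos hjS] at haj haj'
    rw [leadCoeff_cramerNum_of_ne_zero hα haj'.ne', mul_assoc]
    exact mul_pos haj' hdet
  · rw [if_neg hjS] at haj haj'
    by_cases hS : S.Nonempty
    · have hmem := S.min'_mem hS
      set i₀ := S.min' hS with hi₀
      have hij : i₀ ≠ j := by
        intro e
        exact hjS (e ▸ hmem)
      have hlt : ∀ i < i₀, i ∉ S := fun i hi hiS => (S.min'_le i hiS).not_gt hi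
      have h₀ := ha i₀
      have h₀' := ha' i₀
      rw [if_pos hmem] at h₀ h₀'
      obtain ⟨τ, hτ⟩ := exists_leadCoeff_cramerNum_eq hα hij
      rw [hτ a h₀.ne' haj fun i hi => by simpa [hlt i hi] using ha i, mul_assoc] at hj
      rw [hτ a' h₀'.ne' haj' fun i hi => by simpa [hlt i hi] using ha' i, mul_assoc]
      exact mul_pos h₀' ((mul_pos_iff_of_pos_left h₀).1 hj)
    · rw [Finset.not_nonempty_iff_eq_empty] at hS
      subst hS
      have e : a' = a := funext fun i => by
        have h1 := ha i
        have h2 := ha' i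
        simp only [Finset.notMem_empty, if_false] at h1 h2
        rw [h1, h2]
      rw [e]
      exact hj

/-- Up to sign, Hill's function is a sum of characteristic functions of faces of the cone spanned
by the `α_i w_1`. -/
theorem charFn_hillCone_mem [NeZero n] (hα : LinearIndependent ℚ fun i => α i (w 0)) :
    charFn (hillCone w α) ∈
      AddSubgroup.closure {κ | ∃ S, κ = charFn (face (fun i => α i (w 0)) S)} := by
  classical
  -- The faces for different `S` are disjoint, and each one that meets Hill's cone lies inside it.
  have key : charFn (hillCone w α) = ∑ S : Finset (Fin n),
      if ∃ v ∈ face (fun i => α i (w 0)) S, v ∈ hillCone w α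
        then charFn (face (fun i => α i (w 0)) S) else 0 := by
    ext v
    rw [Finset.sum_apply]
    by_cases hv : v ∈ hillCone w α
    · obtain ⟨S, hS⟩ := exists_mem_face_of_mem_hillCone hα hv
      rw [charFn_of_mem hv, Finset.sum_eq_single S]
      · rw [if_pos ⟨v, hS, hv⟩, charFn_of_mem hS]
      · intro T _ hT
        have hvT : v ∉ face (fun i => α i (w 0)) T := by
          intro hvT
          obtain ⟨a, ha, rfl⟩ := hS
          rw [mem_face_iff hα] at hvT
          apply hT
          ext k
          have h1 := ha k
          have h2 := hvT k
          by_cases hkS : k ∈ S <;> by_cases hkT : k ∈ T <;>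
            simp only [hkS, hkT, if_true, if_false] at h1 h2 ⊢
          · exact (h1.ne' h2).elim
          · exact (h2.ne' h1).elim
        split_ifs
        · exact charFn_of_notMem hvT
        · rfl
      · simp
    · rw [charFn_of_notMem hv, Finset.sum_eq_zero]
      intro S _
      split_ifs with h
      · obtain ⟨v₀, hS, hv₀⟩ := h
        exact charFn_of_notMem fun hvS => hv (mem_hillCone_of_mem_face hα hS hvS hv₀)
      · rfl
  rw [key]
  refine sum_mem fun S _ => ?_
  split_ifs
  · exact AddSubgroup.subset_closure ⟨S, rfl⟩
  · exact zero_mem _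

end HillFaces

/-! ### The Shintani cocycle at non-degenerate tuples -/

section Main

theorem face_eq_openCone {V : Type*} [AddCommGroup V] [Module ℚ V] {r : ℕ} (u : Fin r → V)
    (S : Finset (Fin r)) : face u S = openCone fun k => u (S.orderEmbOfFin rfl k) := by
  have key : ∀ a : Fin r → ℚ, ∑ k, a (S.orderEmbOfFin rfl k) • u (S.orderEmbOfFin rfl k) =
      ∑ i ∈ S, a i • u i := by
    intro a
    conv_rhs => rw [← Finset.image_orderEmbOfFin_univ S rfl]
    rw [Finset.sum_image fun x _ y _ h => (S.orderEmbOfFin rfl).injective h]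
  ext v
  constructor
  · rintro ⟨a, ha, rfl⟩
    refine ⟨fun k => a (S.orderEmbOfFin rfl k), fun k => ?_, ?_⟩
    · simpa using ha (S.orderEmbOfFin rfl k)
    · rw [key]
      refine (Finset.sum_subset (Finset.subset_univ _) fun i _ hi => ?_).symm
      have := ha i
      rw [if_neg hi] at this
      rw [this, zero_smul]
  · rintro ⟨a, ha, rfl⟩
    refine ⟨Function.extend (S.orderEmbOfFin rfl) a 0, fun k => ?_, ?_⟩
    · split_ifs with hk
      · obtain ⟨l, rfl⟩ : k ∈ Set.range (S.orderEmbOfFin rfl) := by simpa using hk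
        rw [(S.orderEmbOfFin rfl).injective.extend_apply]
        exact ha l
      · refine Function.extend_apply' _ _ _ ?_
        rintro ⟨l, rfl⟩
        exact hk (S.orderEmbOfFin_mem rfl l)
    · have h := key (Function.extend (S.orderEmbOfFin rfl) a 0)
      simp only [(S.orderEmbOfFin rfl).injective.extend_apply] at h
      rw [h]
      refine Finset.sum_subset (Finset.subset_univ _) fun i _ hi => ?_
      rw [Function.extend_apply', Pi.zero_apply, zero_smul]
      rintro ⟨l, rfl⟩
      exact hi (S.orderEmbOfFin_mem rfl l)

variable (p : ℕ) [Fact p.Prime] {V : Type*} [AddCommGroup V] [Module ℚ V]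
variable (L : Submodule ℤ V) [L.IsLattice ℚ]

/-- The functions `κ` for which the formal sum `∑ (f' ⊗ [L_p])(v) κ(v) δ_v` represents a measure. -/
noncomputable def measureFunctions (f : V → ℤ) : AddSubgroup (V → ℤ) where
  carrier := {κ | ∃ μ : PadicMeasure p (localLattice p L),
    Represents p L (coneSum p L f κ) (algebraMap _ _ μ)}
  zero_mem' := by
    refine ⟨finiteMeasure p L 0, ?_⟩
    have h : coneSum p L f 0 = ⇑(0 : globalPoints p L →₀ ℤ) := by
      ext v
      simp [coneSum]
    rw [h]
    exact represents_finsupp 0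
  add_mem' := by
    rintro κ κ' ⟨μ, h⟩ ⟨ν, h'⟩
    refine ⟨μ + ν, ?_⟩
    have e : coneSum p L f (κ + κ') = coneSum p L f κ + coneSum p L f κ' := by
      ext v
      simp [coneSum, mul_add]
    rw [e, map_add]
    exact h.add h'
  neg_mem' := by
    rintro κ ⟨μ, h⟩
    refine ⟨-μ, ?_⟩
    have e : coneSum p L f (-κ) = -coneSum p L f κ := by
      ext v
      simp [coneSum]
    rw [e, map_neg]
    exact h.neg

variable {p L}

/-- Under the Vanishing Hypothesis for `w`, the open cones spanned by translates of `w` under the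
stabilizer of `f' ⊗ [L_p]` give rise to measures. -/
theorem charFn_openCone_mem_measureFunctions {f' : testFunctionsAway p L} {w : V}
    (hf' : VanishingHypothesis p L f' w) {r : ℕ} (γ : Fin r → stabilizerGroup p L f')
    (hγ : LinearIndependent ℚ fun i => (γ i).1 w) :
    charFn (openCone fun i => (γ i).1 w) ∈ measureFunctions p L f'.1 := by
  obtain ⟨N, hN, hper, hsupp⟩ := exists_period_latticeAway f'.2
  obtain ⟨N', hN', -, hsupp'⟩ := exists_period p L f'.2
  obtain ⟨k₀, hk₀, hk₀L⟩ := exists_nsmul_mem L w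
  choose k hk hkL using fun i => exists_nsmul_mem L ((γ i).1 w)
  -- `K` clears the denominators of `w` and of all `γ i w` at once. The further factor `N` in `M`
  -- puts `M w` into `N L`, so that it is a period of `f'`.
  set K := k₀ * ∏ i, k i with hK
  have hKpos : 0 < K := Nat.mul_pos hk₀ (Finset.prod_pos fun i _ => hk i)
  set M := N * K with hM
  have hMpos : 0 < M := Nat.mul_pos hN hKpos
  have hKw : K • w ∈ L := by
    rw [hK, mul_comm, mul_smul]
    exact L.smul_of_tower_mem _ hk₀L
  have hKγ : ∀ i, M • (γ i).1 w ∈ L := by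
    intro i
    obtain ⟨c, hc⟩ := Finset.dvd_prod_of_mem k (Finset.mem_univ i)
    rw [hM, hK, hc, show N * (k₀ * (k i * c)) = (N * k₀ * c) * k i by ring, mul_smul]
    exact L.smul_of_tower_mem _ (hkL i)
  have hMq : (0 : ℚ) < M := by exact_mod_cast hMpos
  set u : Fin r → V := fun i => M • (γ i).1 w with hu
  have hu' : u = fun i => (M : ℚ) • (γ i).1 w := by
    ext i
    rw [hu, Nat.cast_smul_eq_nsmul]
  have hcone : openCone (fun i => (γ i).1 w) = openCone u := by
    rw [hu', openCone_smul _ _ fun _ => hMq]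
  have hli : LinearIndependent ℚ u := by
    have := hγ.units_smul fun _ => Units.mk0 _ hMq.ne'
    rw [hu']
    exact this
  have huγ : ∀ i, u i = (γ i).1 (M • w) := fun i => (map_nsmul (γ i).1 M w).symm
  -- Invariance under `γ i` turns a translation in direction `γ i w` into one in direction `w`, from
  -- another base point. Both the periodicity and the vanishing are transported this way.
  have hF : ∀ i (y x : V), extendTest p L f'.1 (y + (γ i).1 x) =
      extendTest p L f'.1 ((γ i).1.symm y + x) := by
    intro i y x
    rw [← (γ i).2 ((γ i).1.symm y + x), map_add, LinearEquiv.apply_symm_apply]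
  rw [hcone]
  refine exists_represents_measure_openCone p L hli (fun i => toLocal_mem p (hKγ i)) ?_ hN' ?_ ?_
  · intro v i
    have hMw : M • w ∈ L := by
      rw [hM, mul_smul]
      exact L.smul_of_tower_mem _ hKw
    have hperF : ∀ y, extendTest p L f'.1 (y + M • w) = extendTest p L f'.1 y := by
      intro y
      have h2 : toLocal p (y + M • w) ∈ localLattice p L ↔ toLocal p y ∈ localLattice p L := by
        rw [map_add]
        exact (localLattice p L).add_mem_iff_left (toLocal_mem p hMw)
      have h1 : f'.1 (y + M • w) = f'.1 y := by
        rw [hM, mul_smul]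
        exact hper y _ (mem_latticeAway_of_mem hKw)
      rw [extendTest, extendTest, h1]
      congr 1
      by_cases h3 : toLocal p y ∈ localLattice p L
      · rw [latticeIndicator, latticeIndicator, if_pos h3, if_pos (h2.2 h3)]
      · rw [latticeIndicator, latticeIndicator, if_neg h3, if_neg (mt h2.1 h3)]
    rw [← sub_add_cancel v (u i)]
    generalize v - u i = y
    rw [add_sub_cancel_right, huγ, hF, hperF, ← (γ i).2 ((γ i).1.symm y),
      LinearEquiv.apply_symm_apply]
  · intro v hv
    refine hsupp' v (left_ne_zero_of_mul hv) ?_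
    by_contra h
    refine right_ne_zero_of_mul hv ?_
    rw [latticeIndicator, if_neg h]
  · intro i y c
    have hw : w ≠ 0 := by
      rintro rfl
      exact hγ.ne_zero i (map_zero _)
    have h := hf'.finsum_class_eq_zero hw hN hper hsupp hMpos hKw
      (mul_smul N K w) ((γ i).1.symm y) c
    rw [← h]
    refine finsum_mem_congr rfl fun x _ => ?_
    rw [huγ, ← map_smul, hF]

theorem charFn_face_mem_measureFunctions {f' : testFunctionsAway p L} {w : V}
    (hf' : VanishingHypothesis p L f' w) {r : ℕ} (γ : Fin r → stabilizerGroup p L f')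
    (hγ : LinearIndependent ℚ fun i => (γ i).1 w) (S : Finset (Fin r)) :
    charFn (face (fun i => (γ i).1 w) S) ∈ measureFunctions p L f'.1 := by
  rw [face_eq_openCone]
  exact charFn_openCone_mem_measureFunctions hf' (fun k => γ (S.orderEmbOfFin rfl k))
    (hγ.comp _ (S.orderEmbOfFin rfl).injective)

end Main

end PadicShintani

theorem theoremT {V : Type*} [AddCommGroup V] [Module ℚ V]
    {n : ℕ} [NeZero n] (w : Module.Basis (Fin n) ℚ V)
    (L : Submodule ℤ V) [L.IsLattice ℚ]
    (p : ℕ) [Fact p.Prime]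
    (f' : PadicShintani.testFunctionsAway p L)
    (hf' : PadicShintani.VanishingHypothesis p L f' (w 0))
    (α : Fin n → PadicShintani.stabilizerGroup p L f')
    (hα : LinearIndependent ℚ fun i => (α i).1 (w 0)) :
    ∃ μ : PadicShintani.PadicMeasure p (PadicShintani.localLattice p L),
      PadicShintani.shintaniCocycle p L w f' α =
        QuotientAddGroup.mk
          (algebraMap (PadicShintani.PadicMeasure p (PadicShintani.localLattice p L))
            (PadicShintani.PseudoMeasure p (PadicShintani.localLattice p L)) μ) := by
  have hcone : PadicShintani.hillFunction w (fun i => (α i).1) ∈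
      PadicShintani.measureFunctions p L f'.1 := by
    -- `hillSign` is only an integer factor, so it suffices to treat the faces.
    refine zsmul_mem ((AddSubgroup.closure_le _).2 ?_
      (PadicShintani.charFn_hillCone_mem (w := w) (α := fun i => (α i).1) hα)) _
    rintro _ ⟨S, rfl⟩
    exact PadicShintani.charFn_face_mem_measureFunctions hf' α hα S
  obtain ⟨μ, hμ⟩ := hcone
  -- A formal sum represents at most one pseudo-measure. The equality with `μ` therefore holds
  -- already before passing to the quotient by `ℤ δ_0`.
  exact ⟨μ, congrArg QuotientAddGroup.mk
    ((PadicShintani.represents_conePseudoMeasure p L f' _).unique hμ)⟩
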